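/- Let $\mathcal M$ be a left proper pointed model category and let $\mathcal G$ be a class of injective models in $\mathcal M$: a class of fibrant objects of $\mathcal M$ that are group objects in the homotopy category $\mathrm{Ho}(\mathcal M)$, closed under loops (for $G\in\mathcal G$ the loop object $\Omega G$ is isomorphic in $\mathrm{Ho}(\mathcal M)$ to a member of $\mathcal G$). Write $[-,-]$ for morphisms in $\mathrm{Ho}(\mathcal M)$ and $c\mathcal M$ for the category of cosimplicial objects of $\mathcal M$. A morphism $X^\bullet\to Y^\bullet$ of $c\mathcal M$ is a *$\mathcal G$-equivalence* if it induces isomorphisms $\pi_s[Y^\bullet,G]\to\pi_s[X^\bullet,G]$ for all $s\ge 0$ and all $G\in\mathcal G$. For $s\ge 0$ and $G\in\mathcal G$, put $\pi^\natural_s(X^\bullet,G):=\pi_s\,\mathrm{Hom}_{\mathcal M}(X^\bullet,G)$, the homotopy of the simplicial set $[m]\mapsto \mathrm{Hom}_{\mathcal M}(X^m,G)$ based at the zero map. A *Reedy cofibrant approximation* of $f\colon X^\bullet\to Y^\bullet$ is a morphism $\tilde f\colon\tilde X^\bullet\to\tilde Y^\bullet$ between Reedy cofibrant objects together with degreewise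 weak equivalences $\tilde X^\bullet\to X^\bullet$ and $\tilde Y^\bullet\to Y^\bullet$ forming a commutative square with $f$. For $n\ge 0$, $f$ is an *$n$-$\mathcal G$-equivalence* if $\mathrm{sk}_{n+1}\tilde f\colon \mathrm{sk}_{n+1}\tilde X^\bullet\to\mathrm{sk}_{n+1}\tilde Y^\bullet$ is a $\mathcal G$-equivalence for some Reedy cofibrant approximation $\tilde f$ of $f$. **Lemma.** Let $n\ge 0$ and let $f\colon X^\bullet\to Y^\bullet$ be a morphism of $c\mathcal M$. The following are equivalent: 1. $f$ is an $n$-$\mathcal G$-equivalence; 2. for every Reedy cofibrant approximation $\tilde f$ of $f$, the map $\mathrm{sk}_{n+1}\tilde f$ is a $\mathcal G$-equivalence; 3. for every Reedy cofibrant approximation $\tilde f\colon\tilde X^\bullet\to\tilde Y^\bullet$ of $f$, every $G\in\mathcal G$ and all $0\le s\le n$, the induced map $\pi^\natural_s(\tilde Y^\bullet,G)\to\pi^\natural_s(\tilde X^\bullet,G)$ is an isomorphism; 4. for some Reedy cofibrant approximation $\tilde f\colon\tilde X^\bullet\to\tilde Y^\bullet$ of $f$, every $G\in\mathcal G$ and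 all $0\le s\le n$, the induced map $\pi^\natural_s(\tilde Y^\bullet,G)\to\pi^\natural_s(\tilde X^\bullet,G)$ is an isomorphism. -/

import Mathlib

open CategoryTheory Limits HomotopicalAlgebra Opposite Simplicial

universe w v u

namespace TruncatedResolution

noncomputable section

/-! ### Homotopy groups of pointed simplicial sets -/

/-- The set underlying the `s`-th homotopy group `π_s(K, x)` of a Kan complex `K` at a vertex `x`:
the `s`-simplices of `K` all of whose faces are constant at `x`, two of them being identified if
they are the last two faces of an `(s + 1)`-simplex whose other faces are constant at `x`. For a
Kan complex this relation is the usual (equivalence) relation of simplicial homotopy relative to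
the boundary. -/
def homotopyGroup (s : ℕ) (K : SSet.{w}) (x : K _⦋0⦌) : Type w :=
  Quot (fun f g : K.PtSimplex s x => Nonempty (f.RelStruct g (Fin.last s)))

lemma const_comp_eq {A K L : SSet.{w}} (φ : K ⟶ L) {x : K _⦋0⦌} {y : L _⦋0⦌}
    (h : φ.app _ x = y) :
    (SSet.const x : A ⟶ K) ≫ φ = SSet.const y := by
  subst h
  rw [SSet.const_comp]

/-- The action of a pointed map `φ : (K, x) ⟶ (L, y)` on pointed simplices. -/
def mapPtSimplex {s : ℕ} {K L : SSet.{w}} (φ : K ⟶ L) {x : K _⦋0⦌} {y : L _⦋0⦌}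
    (h : φ.app _ x = y) (f : K.PtSimplex s x) : L.PtSimplex s y :=
  f.comp (SSet.RelativeMorphism.ofSimplex₀ φ x y h) (by
    subst h
    rfl)

/-- The map `π_s(K, x) → π_s(L, y)` induced by a pointed map `φ : (K, x) ⟶ (L, y)`. -/
def homotopyGroupMap (s : ℕ) {K L : SSet.{w}} (φ : K ⟶ L) {x : K _⦋0⦌} {y : L _⦋0⦌}
    (h : φ.app _ x = y) : homotopyGroup s K x → homotopyGroup s L y :=
  Quot.map (mapPtSimplex φ h) (by
    rintro f g ⟨r⟩
    exact ⟨{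
      map := r.map ≫ φ
      δ_castSucc_map := by
        rw [r.δ_castSucc_map_assoc]; rfl
      δ_succ_map := by
        rw [r.δ_succ_map_assoc]; rfl
      δ_map_of_lt := fun j hj => by
        rw [r.δ_map_of_lt_assoc j hj, const_comp_eq φ h]
      δ_map_of_gt := fun j hj => by
        rw [r.δ_map_of_gt_assoc j hj, const_comp_eq φ h] }⟩)

/-! ### The simplicial sets `Hom(X, G)` -/

section HomSSet

variable {C : Type u} [Category.{v} C]

/-- The simplicial set `[n] ↦ Hom(Xⁿ, G)` for a cosimplicial object `X` and an object `G`. -/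
abbrev homSSet (X : CosimplicialObject C) (G : C) : SSet.{v} :=
  Functor.op X ⋙ yoneda.obj G

/-- The map `Hom(Y, G) ⟶ Hom(X, G)` given by precomposition with `f : X ⟶ Y`. -/
abbrev homSSetMap {X Y : CosimplicialObject C} (f : X ⟶ Y) (G : C) :
    homSSet Y G ⟶ homSSet X G :=
  Functor.whiskerRight (NatTrans.op f) (yoneda.obj G)

end HomSSet

/-! ### Skeleta and latching objects of cosimplicial objects -/

instance finite_truncated (n : ℕ) : Finite (SimplexCategory.Truncated n) :=
  Finite.of_injective (β := Fin (n + 1))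
    (fun a => ⟨a.obj.len, Nat.lt_succ_of_le a.property⟩) (by
      rintro ⟨a, ha⟩ ⟨b, hb⟩ h
      have h' : a = b := SimplexCategory.ext (congrArg Fin.val h)
      subst h'
      rfl)

/-- A small category with finitely many objects and arrows is a finite category. -/
@[reducible]
def finCategoryOfFinite (J : Type) [SmallCategory J] [Finite J] [∀ a b : J, Finite (a ⟶ b)] :
    FinCategory J where
  fintypeObj := Fintype.ofFinite J
  fintypeHom a b := Fintype.ofFinite (a ⟶ b)

instance finite_truncated_hom {n : ℕ} (a b : SimplexCategory.Truncated n) : Finite (a ⟶ b) :=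
  Finite.of_injective (fun f => f.hom) (fun _ _ h => ObjectProperty.hom_ext _ h)

instance finite_costructuredArrow (n : ℕ) (k : SimplexCategory) :
    Finite (CostructuredArrow (SimplexCategory.Truncated.inclusion n) k) :=
  Finite.of_injective
    (β := Σ a : SimplexCategory.Truncated n, (SimplexCategory.Truncated.inclusion n).obj a ⟶ k)
    (fun φ => ⟨φ.left, φ.hom⟩) (by
      rintro ⟨a, ⟨⟨⟩⟩, f⟩ ⟨b, ⟨⟨⟩⟩, g⟩ h
      cases h
      rfl)

instance finite_costructuredArrow_hom {n : ℕ} {k : SimplexCategory}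
    (a b : CostructuredArrow (SimplexCategory.Truncated.inclusion n) k) : Finite (a ⟶ b) :=
  Finite.of_injective (fun f => f.left) (fun _ _ h => CostructuredArrow.hom_ext _ _ h)

instance hasColimitsOfShape_costructuredArrow (M : Type u) [Category.{v} M] [HasFiniteColimits M]
    (n : ℕ) (k : SimplexCategory) :
    HasColimitsOfShape (CostructuredArrow (SimplexCategory.Truncated.inclusion n) k) M :=
  letI := finCategoryOfFinite (CostructuredArrow (SimplexCategory.Truncated.inclusion n) k)
  inferInstance

instance hasLeftKanExtension_truncated {M : Type u} [Category.{v} M] [HasFiniteColimits M]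
    (n : ℕ) (F : SimplexCategory.Truncated n ⥤ M) :
    (SimplexCategory.Truncated.inclusion n).HasLeftKanExtension F :=
  inferInstance

/-- The `n`-skeleton functor on cosimplicial objects: restriction to the full subcategory of `Δ`
on `[0], …, [n]`, followed by left Kan extension. -/
def sk (M : Type u) [Category.{v} M] [HasFiniteColimits M] (n : ℕ) :
    CosimplicialObject M ⥤ CosimplicialObject M :=
  CosimplicialObject.truncation n ⋙ (SimplexCategory.Truncated.inclusion n).lan

/-- The latching category at `[s]`: injective, non-identity maps `[m] ⟶ [s]` in `Δ`. -/
abbrev LatchingCategory (s : ℕ) : Type :=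
  ObjectProperty.FullSubcategory (fun φ : Over ⦋s⦌ => Mono φ.hom ∧ ¬ IsIso φ.hom)

instance finite_latchingCategory (s : ℕ) : Finite (LatchingCategory s) :=
  Finite.of_injective (β := Σ m : Fin (s + 1), (⦋(m : ℕ)⦌ ⟶ ⦋s⦌))
    (fun φ => ⟨⟨φ.obj.left.len, Nat.lt_succ_of_le (by
      have := φ.property.1
      exact SimplexCategory.len_le_of_mono φ.obj.hom)⟩, φ.obj.hom⟩) (by
      rintro ⟨⟨a, ⟨⟨⟩⟩, f⟩, hf⟩ ⟨⟨b, ⟨⟨⟩⟩, g⟩, hg⟩ h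
      have h1 := congrArg (fun p => (p.1 : ℕ)) h
      have h' : a = b := SimplexCategory.ext h1
      subst h'
      have h2 : f = g := by
        simp only [Sigma.mk.injEq, heq_eq_eq, true_and] at h
        exact h
      subst h2
      rfl)

instance finite_latchingCategory_hom {s : ℕ} (a b : LatchingCategory s) : Finite (a ⟶ b) :=
  Finite.of_injective (fun f => f.hom.left)
    (fun _ _ h => ObjectProperty.hom_ext _ (Over.OverMorphism.ext h))

instance hasColimitsOfShape_latchingCategory (M : Type u) [Category.{v} M] [HasFiniteColimits M]
    (s : ℕ) : HasColimitsOfShape (LatchingCategory s) M :=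
  letI := finCategoryOfFinite (LatchingCategory s)
  inferInstance

section Latching

variable {M : Type u} [Category.{v} M] [HasFiniteColimits M]

/-- The diagram `([m] ⟶ [s]) ↦ Xᵐ` on the latching category. -/
abbrev latchingDiagram (X : CosimplicialObject M) (s : ℕ) : LatchingCategory s ⥤ M :=
  ObjectProperty.ι _ ⋙ Over.forget _ ⋙ X

/-- The latching object `L^s X`. -/
abbrev latchingObj (X : CosimplicialObject M) (s : ℕ) : M := colimit (latchingDiagram X s)

/-- The latching map `L^s X ⟶ X^s`. -/
def latchingMap (X : CosimplicialObject M) (s : ℕ) : latchingObj X s ⟶ X.obj ⦋s⦌ :=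
  colimit.desc (latchingDiagram X s)
    { pt := X.obj ⦋s⦌
      ι :=
        { app := fun φ => X.map φ.obj.hom
          naturality := fun φ ψ f => by
            have h : f.hom.left ≫ ψ.obj.hom = φ.obj.hom := Over.w f.hom
            change X.map f.hom.left ≫ X.map ψ.obj.hom = X.map φ.obj.hom ≫ 𝟙 _
            rw [← X.map_comp, h, Category.comp_id] } }

end Latching

section Model

variable {M : Type u} [Category.{v} M] [ModelCategory M]

/-- A cosimplicial object is Reedy cofibrant if all its latching maps are cofibrations. -/
def IsReedyCofibrant (X : CosimplicialObject M) : Prop :=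
  ∀ s : ℕ, Cofibration (latchingMap X s)

/-- A morphism of cosimplicial objects is a Reedy equivalence if it is a weak equivalence in every
cosimplicial degree. -/
def IsReedyEquivalence {X Y : CosimplicialObject M} (f : X ⟶ Y) : Prop :=
  ∀ s : ℕ, WeakEquivalence (f.app ⦋s⦌)

/-- A Reedy cofibrant approximation `X' ⟶ Y'` of a morphism `f : X ⟶ Y`: a commutative square with
Reedy cofibrant `X'`, `Y'` whose maps `X' ⟶ X` and `Y' ⟶ Y` are Reedy equivalences. -/
structure ReedyCofibrantApproximation {X Y : CosimplicialObject M} (f : X ⟶ Y) where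
  /-- the approximation of the source -/
  source : CosimplicialObject M
  /-- the approximation of the target -/
  target : CosimplicialObject M
  /-- the approximating map -/
  map : source ⟶ target
  /-- the augmentation of the source -/
  toSource : source ⟶ X
  /-- the augmentation of the target -/
  toTarget : target ⟶ Y
  comm : map ≫ toTarget = toSource ≫ f
  source_cofibrant : IsReedyCofibrant source
  target_cofibrant : IsReedyCofibrant target
  toSource_equivalence : IsReedyEquivalence toSource
  toTarget_equivalence : IsReedyEquivalence toTarget

variable (M) in
/-- A model category is left proper if weak equivalences are stable under pushout along
cofibrations. -/
class IsLeftProper : Prop where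
  weakEquivalence_of_isPushout {A B A' B' : M} (w : A ⟶ B) (i : A ⟶ A') (j : B ⟶ B')
    (w' : A' ⟶ B') (sq : IsPushout w i j w') [WeakEquivalence w] [Cofibration i] :
    WeakEquivalence w'

/-! ### The homotopy category and injective models -/

variable (M) in
/-- The homotopy category: the localization at the weak equivalences. -/
abbrev Ho : Type u := (weakEquivalences M).Localization

variable (M) in
/-- The canonical functor to the homotopy category. -/
abbrev toHo : M ⥤ Ho M := (weakEquivalences M).Q

/-- A group object structure exists on `X`: the functor `Hom(-, X)` lifts to groups. -/
def IsGroupObject {C : Type u} [Category.{v} C] (X : C) : Prop :=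
  ∃ F : Cᵒᵖ ⥤ GrpCat.{v}, Nonempty ((F ⋙ forget GrpCat).RepresentableBy X)

variable [HasZeroObject M] [HasZeroMorphisms M]

/-- The loop object of `G` formed with a path object `P`: the fibre over the zero point of
`P ⟶ G ⨯ G`. It represents `ΩG` in the homotopy category if `G` is fibrant and `P` is good. -/
abbrev loopObj {G : M} (P : PathObject G) : M := kernel P.p

/-- A class `𝒢` of injective models: its members are fibrant objects that are group objects in the
homotopy category, and it is closed (up to isomorphism in the homotopy category) under loops. -/
structure IsClassOfInjectiveModels (𝒢 : ObjectProperty M) : Prop where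
  isFibrant (G : M) (hG : 𝒢 G) : IsFibrant G
  isGroupObject (G : M) (hG : 𝒢 G) : IsGroupObject ((toHo M).obj G)
  loop (G : M) (hG : 𝒢 G) : ∃ (P : PathObject G) (G' : M),
    P.IsGood ∧ 𝒢 G' ∧ Nonempty ((toHo M).obj G' ≅ (toHo M).obj (loopObj P))

/-! ### Natural homotopy groups -/

/-- The natural homotopy group `π^♮_s(X, G) = π_s Hom_M(X, G)`, based at the zero map. -/
def naturalPi (s : ℕ) (X : CosimplicialObject M) (G : M) : Type v :=
  homotopyGroup s (homSSet X G) (0 : X.obj ⦋0⦌ ⟶ G)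

/-- The map `π^♮_s(Y, G) → π^♮_s(X, G)` induced by `f : X ⟶ Y`. -/
def naturalPiMap (s : ℕ) {X Y : CosimplicialObject M} (f : X ⟶ Y) (G : M) :
    naturalPi s Y G → naturalPi s X G :=
  homotopyGroupMap s (homSSetMap f G) (by
    change f.app ⦋0⦌ ≫ (0 : Y.obj ⦋0⦌ ⟶ G) = 0
    simp)

/-- The homotopy group `π_s [X, G]` of the simplicial set `[n] ↦ [Xⁿ, G]` of morphisms in the
homotopy category, based at the zero map. -/
def hoPi (s : ℕ) (X : CosimplicialObject M) (G : M) : Type (max u v) :=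
  homotopyGroup s (homSSet (((CosimplicialObject.whiskering _ _).obj (toHo M)).obj X)
    ((toHo M).obj G)) ((toHo M).map (0 : X.obj ⦋0⦌ ⟶ G))

/-- The map `π_s [Y, G] → π_s [X, G]` induced by `f : X ⟶ Y`. -/
def hoPiMap (s : ℕ) {X Y : CosimplicialObject M} (f : X ⟶ Y) (G : M) :
    hoPi s Y G → hoPi s X G :=
  homotopyGroupMap s
    (homSSetMap (((CosimplicialObject.whiskering _ _).obj (toHo M)).map f) ((toHo M).obj G)) (by
      change (toHo M).map (f.app ⦋0⦌) ≫ (toHo M).map (0 : Y.obj ⦋0⦌ ⟶ G) = (toHo M).map 0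
      rw [← Functor.map_comp, comp_zero])

/-! ### Equivalences

The maps on homotopy groups are group homomorphisms for the group structures coming from `G` being
a group object in the homotopy category, so they are isomorphisms exactly if they are bijective. -/

/-- `f : X ⟶ Y` is a `𝒢`-equivalence: it induces isomorphisms `π_s [Y, G] → π_s [X, G]` for all
`s ≥ 0` and all `G` in `𝒢`. -/
def IsGEquivalence (𝒢 : ObjectProperty M) {X Y : CosimplicialObject M} (f : X ⟶ Y) : Prop :=
  ∀ (G : M), 𝒢 G → ∀ s : ℕ, Function.Bijective (hoPiMap s f G)

/-- `f : X ⟶ Y` is an `n`-`𝒢`-equivalence: the map `sk_{n+1} X' ⟶ sk_{n+1} Y'` is a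
`𝒢`-equivalence for a Reedy cofibrant approximation `X' ⟶ Y'` of `f`. -/
def IsNGEquivalence (𝒢 : ObjectProperty M) (n : ℕ) {X Y : CosimplicialObject M} (f : X ⟶ Y) :
    Prop :=
  ∃ A : ReedyCofibrantApproximation f, IsGEquivalence 𝒢 ((sk M (n + 1)).map A.map)

end Model

end

end TruncatedResolution

/-!
For a Reedy cofibrant `X` and a fibrant `G` the natural homotopy groups `π^♮_s(X, G)` only involve
`X` in degrees up to `s + 1`, and they vanish for `s > n` if `X` is an `(n + 1)`-skeleton, because
every boundary of dimension greater than `n + 1` can be filled uniquely. The equivalence of the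
four conditions therefore follows from two facts: for maps between Reedy cofibrant objects, the
natural homotopy groups detect `𝒢`-equivalences
(`isGEquivalence_iff_naturalPiMap_bijective`, and `isGEquivalence_sk_iff` for skeleta), and any two
Reedy cofibrant approximations of a map can be compared (`exists_common_approximation`).

The first fact is a form of the spiral exact sequence. Dividing out the first `s` and the first
`s + 1` cofaces of `X^s` gives objects `N^s` and `Z^s` which form cofibre sequences
`Z^s ⟶ N^{s + 1} ⟶ Z^{s + 1}`. The homology of the complex of groups `[N^s, G]` is `π_s[X, G]`, and
the cosets of the image of `[N^{s + 1}, G]` in `[Z^s, G]` form `π^♮_s(X, G)`. Since `G` is a group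
object in the homotopy category and `𝒢` is closed under loops, every cofibre sequence `A ⟶ B ⟶ C`
has a connecting homomorphism `[A, ΩG] → [C, G]` (`IsClassOfInjectiveModels.exists_connecting`),
which makes the cofibre sequences above into an exact couple; an induction on `s`, for all `G` at
once, then compares the two families of groups (`Tower.Hom.bijective_iff`). Left properness enters
through the connecting homomorphism: it makes the cone of `A ⟶ B` weakly equivalent to `C`. The
natural homotopy is merely a set of cosets, since the image of `[N^{s + 1}, G]` is not known to be
a normal subgroup.

For the second fact, every map of cosimplicial objects is factored into a Reedy cofibration followed
by a degreewise weak equivalence (`exists_reedy_factorization`): cells are attached in one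
cosimplicial degree after another, each of them chosen to make the map to the relative matching
object a trivial fibration.

Latching and matching objects are avoided in favour of the maps out of them and into them. A map out
of the latching object at `[m + 1]` is a compatible family of `m + 2` maps out of `X^m`
(`isReedyCofibrant_iff`). Both for the faces of maps out of a cosimplicial object and for the
codegeneracies of maps into one, lifts with few prescribed faces are reduced to lifts with all faces
prescribed by one combinatorial argument (`exists_partial_filler`).
-/

namespace TruncatedResolution

noncomputable section

/-! ### Group-valued homotopy classes of maps -/

lemma isIso_map_of_weakEquivalence {C H : Type*} [Category* C] [ModelCategory C] [Category* H]
    (L : C ⥤ H) [L.IsLocalization (weakEquivalences C)] {X Y : C} (f : X ⟶ Y)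
    [WeakEquivalence f] : IsIso (L.map f) :=
  Localization.inverts L (weakEquivalences C) f (by rwa [← weakEquivalence_iff])

section HoGroup

open scoped ZeroObject

variable {M : Type u} [Category.{v} M] [ModelCategory M]

/-- A group structure on the sets `[A, G]` of morphisms in the homotopy category, for `A` cofibrant,
which is natural with respect to morphisms of `M`. -/
structure HoGroup (G : M) where
  /-- the group structure on `[A, G]` -/
  grp : ∀ (A : M) [IsCofibrant A], Group ((toHo M).obj A ⟶ (toHo M).obj G)
  comp_mul : ∀ {A B : M} [IsCofibrant A] [IsCofibrant B] (f : A ⟶ B)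
    (x y : (toHo M).obj B ⟶ (toHo M).obj G),
    (toHo M).map f ≫ (grp B).mul x y = (grp A).mul ((toHo M).map f ≫ x) ((toHo M).map f ≫ y)

namespace HoGroup

variable {G : M} (𝔤 : HoGroup G)

/-- The set `[A, G]`, as a type which carries the group structure `𝔤`. -/
def Cls (_ : HoGroup G) (A : M) [IsCofibrant A] : Type (max u v) :=
  (toHo M).obj A ⟶ (toHo M).obj G

instance (A : M) [IsCofibrant A] : Group (𝔤.Cls A) := 𝔤.grp A

/-- The class in `[A, G]` of a morphism `A ⟶ G`. -/
def cls {A : M} [IsCofibrant A] (x : A ⟶ G) : 𝔤.Cls A := (toHo M).map x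

/-- The restriction homomorphism `[B, G] → [A, G]` along `f : A ⟶ B`. -/
def res {A B : M} [IsCofibrant A] [IsCofibrant B] (f : A ⟶ B) : 𝔤.Cls B →* 𝔤.Cls A :=
  MonoidHom.mk' (fun x => (toHo M).map f ≫ x) (fun x y => 𝔤.comp_mul f x y)

section

variable {A B C : M} [IsCofibrant A] [IsCofibrant B] [IsCofibrant C]

lemma res_cls (f : A ⟶ B) (x : B ⟶ G) : 𝔤.res f (𝔤.cls x) = 𝔤.cls (f ≫ x) :=
  ((toHo M).map_comp f x).symm

lemma res_res (f : A ⟶ B) (g : B ⟶ C) (x : 𝔤.Cls C) :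
    𝔤.res f (𝔤.res g x) = 𝔤.res (f ≫ g) x := by
  have (y : (toHo M).obj C ⟶ (toHo M).obj G) :
      (toHo M).map f ≫ (toHo M).map g ≫ y = (toHo M).map (f ≫ g) ≫ y := by
    rw [Functor.map_comp, Category.assoc]
  exact this x

@[simp]
lemma res_id (x : 𝔤.Cls A) : 𝔤.res (𝟙 A) x = x := by
  have (y : (toHo M).obj A ⟶ (toHo M).obj G) : (toHo M).map (𝟙 A) ≫ y = y := by
    rw [CategoryTheory.Functor.map_id, Category.id_comp]
  exact this x

lemma res_comm {D : M} [IsCofibrant D] {f : A ⟶ B} {g : B ⟶ D} {f' : A ⟶ C} {g' : C ⟶ D}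
    (h : f ≫ g = f' ≫ g') (x : 𝔤.Cls D) :
    𝔤.res f (𝔤.res g x) = 𝔤.res f' (𝔤.res g' x) := by
  rw [res_res, res_res, h]

lemma res_bijective (f : A ⟶ B) [WeakEquivalence f] : Function.Bijective (𝔤.res f) := by
  have := isIso_map_of_weakEquivalence (toHo M) f
  constructor
  · intro x y h
    exact (cancel_epi ((toHo M).map f)).1 h
  · intro x
    have (y : (toHo M).obj A ⟶ (toHo M).obj G) :
        (toHo M).map f ≫ inv ((toHo M).map f) ≫ y = y := IsIso.hom_inv_id_assoc _ _
    exact ⟨_, this x⟩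

lemma cls_surjective [IsFibrant G] (x : 𝔤.Cls A) : ∃ f : A ⟶ G, 𝔤.cls f = x :=
  map_surjective_of_isLocalization (toHo M) A G x

/-- Homotopy extension: a map defined on a cofibrant object can be modified within its homotopy
class so that it restricts to any given map homotopic to its restriction. -/
lemma exists_extension [IsFibrant G] (i : A ⟶ B) [Cofibration i] (u : B ⟶ G) (v : A ⟶ G)
    (h : 𝔤.cls (i ≫ u) = 𝔤.cls v) : ∃ u' : B ⟶ G, i ≫ u' = v ∧ 𝔤.cls u' = 𝔤.cls u := by
  obtain ⟨P, hP, ⟨r⟩⟩ :=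
    ((RightHomotopyRel.iff_map_eq (toHo M) _ _).2 h).exists_good_pathObject
  obtain ⟨u', r', hr'⟩ := PathObject.RightHomotopy.homotopy_extension r i u
  refine ⟨u', ?_, ?_⟩
  · rw [← r'.h₁, reassoc_of% hr', r.h₁]
  · exact ((RightHomotopyRel.iff_map_eq (toHo M) _ _).1 r'.rightHomotopyRel).symm

end

lemma subsingleton_cls_of_isZero [IsFibrant G] {Z : M} [IsCofibrant Z] (hZ : IsZero Z) :
    Subsingleton (𝔤.Cls Z) where
  allEq x y := by
    obtain ⟨f, rfl⟩ := 𝔤.cls_surjective x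
    obtain ⟨g, rfl⟩ := 𝔤.cls_surjective y
    rw [hZ.eq_of_src f g]

variable [HasZeroObject M]

instance (priority := 50) isCofibrant_zero : IsCofibrant (0 : M) :=
  (isCofibrant_iff_of_isInitial (𝟙 (0 : M)) HasZeroObject.zeroIsInitial).2 inferInstance

variable [HasZeroMorphisms M]

@[simp]
lemma cls_zero [IsFibrant G] (A : M) [IsCofibrant A] : 𝔤.cls (0 : A ⟶ G) = 1 := by
  have := 𝔤.subsingleton_cls_of_isZero (isZero_zero M)
  have h := 𝔤.res_cls (0 : A ⟶ 0) (0 : (0 : M) ⟶ G)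
  rw [zero_comp] at h
  rw [← h, Subsingleton.elim (𝔤.cls (0 : (0 : M) ⟶ G)) 1, map_one]

@[simp]
lemma res_zero [IsFibrant G] {A B : M} [IsCofibrant A] [IsCofibrant B] (x : 𝔤.Cls B) :
    𝔤.res (0 : A ⟶ B) x = 1 := by
  obtain ⟨f, rfl⟩ := 𝔤.cls_surjective x
  rw [res_cls, zero_comp, cls_zero]

end HoGroup

end HoGroup

/-! ### Cofibre sequences -/

section Cofiber

open scoped ZeroObject

variable {M : Type u} [Category.{v} M] [ModelCategory M] [HasZeroObject M] [HasZeroMorphisms M]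

/-- `A ⟶ B ⟶ C` is a cofibre sequence: the first map is a cofibration and the second map is
its cokernel, expressed as a pushout along `A ⟶ 0`. -/
structure IsCofiberSequence {A B C : M} (i : A ⟶ B) (p : B ⟶ C) : Prop where
  cofibration : Cofibration i
  isPushout : IsPushout i (0 : A ⟶ 0) p (0 : 0 ⟶ C)

namespace IsCofiberSequence

variable {A B C : M} {i : A ⟶ B} {p : B ⟶ C}

/-- A cofibre sequence from the universal property of a cokernel. -/
lemma of_existsUnique [Cofibration i] (w : i ≫ p = 0)
    (h : ∀ {T : M} (t : B ⟶ T), i ≫ t = 0 → ∃! s : C ⟶ T, p ≫ s = t) :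
    IsCofiberSequence i p where
  cofibration := inferInstance
  isPushout :=
    { w := by simp [w]
      isColimit' := ⟨PushoutCocone.IsColimit.mk _
        (fun s => (h s.inl (by rw [s.condition, zero_comp])).choose)
        (fun s => (h s.inl (by rw [s.condition, zero_comp])).choose_spec.1)
        (fun s => (isZero_zero M).eq_of_src _ _)
        (fun s m hm _ => (h s.inl (by rw [s.condition, zero_comp])).choose_spec.2 _ hm)⟩ }

lemma of_cokernel (i : A ⟶ B) [Cofibration i] :
    IsCofiberSequence i (cokernel.π i) :=
  of_existsUnique (cokernel.condition i) (fun t ht =>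
    ⟨cokernel.desc i t ht, by simp, fun s hs => by
      rw [← cancel_epi (cokernel.π i), cokernel.π_desc]; exact hs⟩)

variable (h : IsCofiberSequence i p)
include h

lemma w : i ≫ p = 0 := by rw [h.isPushout.w, zero_comp]

lemma exists_desc {T : M} (t : B ⟶ T) (ht : i ≫ t = 0) : ∃ s : C ⟶ T, p ≫ s = t :=
  ⟨h.isPushout.desc t 0 (by simp [ht]), h.isPushout.inl_desc _ _ _⟩

lemma epi : Epi p where
  left_cancellation _ _ hab :=
    h.isPushout.hom_ext hab ((isZero_zero M).eq_of_src _ _)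

lemma isCofibrant : IsCofibrant C := by
  rw [isCofibrant_iff_of_isInitial (0 : (0 : M) ⟶ C) HasZeroObject.zeroIsInitial,
    cofibration_iff]
  exact MorphismProperty.of_isPushout h.isPushout.flip h.cofibration.mem

/-- A cofibre sequence is exact for maps in the homotopy category. -/
lemma exact [IsCofibrant A] [IsCofibrant B] [IsCofibrant C] {G : M} [IsFibrant G]
    (𝔤 : HoGroup G) (y : 𝔤.Cls B) : 𝔤.res i y = 1 ↔ ∃ x : 𝔤.Cls C, 𝔤.res p x = y := by
  constructor
  · intro hy
    obtain ⟨u, rfl⟩ := 𝔤.cls_surjective y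
    have := h.cofibration
    obtain ⟨u', hu', hu''⟩ := 𝔤.exists_extension i u 0 (by
      rw [← 𝔤.res_cls, hy, 𝔤.cls_zero])
    obtain ⟨s, rfl⟩ := h.exists_desc u' hu'
    exact ⟨𝔤.cls s, by rw [𝔤.res_cls, hu'']⟩
  · rintro ⟨x, rfl⟩
    rw [𝔤.res_res, h.w, 𝔤.res_zero]

end IsCofiberSequence

end Cofiber

/-! ### Comparison of maps into a fibration with maps out of a cofibration -/

section Fiber

variable {C : Type*} [Category* C] [ModelCategory C]

lemma exists_isPullback {X Y Z : C} (f : X ⟶ Z) (g : Y ⟶ Z) :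
    ∃ (P : C) (fst : P ⟶ X) (snd : P ⟶ Y), IsPullback fst snd f g :=
  ⟨_, _, _, IsPullback.of_hasPullback f g⟩

lemma fibration_of_isPullback {P X Y Z : C} {fst : P ⟶ X} {snd : P ⟶ Y} {f : X ⟶ Z} {g : Y ⟶ Z}
    (sq : IsPullback fst snd f g) [hf : Fibration f] : Fibration snd := by
  rw [fibration_iff] at hf ⊢
  exact MorphismProperty.of_isPullback sq hf

lemma weakEquivalence_of_isPullback {P X Y Z : C} {fst : P ⟶ X} {snd : P ⟶ Y} {f : X ⟶ Z}
    {g : Y ⟶ Z} (sq : IsPullback fst snd f g) [Fibration f] [WeakEquivalence f] :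
    WeakEquivalence snd := by
  rw [weakEquivalence_iff]
  exact (MorphismProperty.of_isPullback sq (mem_trivialFibrations f)).2

variable [HasZeroMorphisms C]

lemma exists_fiber {Z E B : C} (hZ : IsZero Z) (q : E ⟶ B) :
    ∃ (Ω : C) (ω : Ω ⟶ E), IsPullback ω (0 : Ω ⟶ Z) q 0 := by
  obtain ⟨Ω, ω, z, sq⟩ := exists_isPullback q (0 : Z ⟶ B)
  obtain rfl : z = 0 := hZ.eq_of_tgt _ _
  exact ⟨Ω, ω, sq⟩

/-- A weak equivalence over `B` between fibrations over `B` induces a weak equivalence between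
the fibres. -/
lemma weakEquivalence_fiber {Z E E' B Ω Ω' : C} (hZ : IsZero Z) {q : E ⟶ B} [Fibration q]
    {q' : E' ⟶ B} [Fibration q'] {w : E ⟶ E'} [WeakEquivalence w] (hw : w ≫ q' = q)
    {ω : Ω ⟶ E} {ω' : Ω' ⟶ E'} (sq : IsPullback ω (0 : Ω ⟶ Z) q 0)
    (sq' : IsPullback ω' (0 : Ω' ⟶ Z) q' 0) {j : Ω ⟶ Ω'} (hj : j ≫ ω' = ω ≫ w) :
    WeakEquivalence j := by
  -- the trick of K. Brown: factor the graph of `w`, so that both projections of the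
  -- intermediate object are trivial fibrations over `B`
  obtain ⟨P, π₁, π₂, sqP⟩ := exists_isPullback q q'
  have : Fibration π₂ := fibration_of_isPullback sqP
  have : Fibration π₁ := fibration_of_isPullback sqP.flip
  let d := MorphismProperty.factorizationData (trivialCofibrations C) (fibrations C)
    (sqP.lift (𝟙 E) w (by simp [hw]))
  let r₁ : d.Z ⟶ E := d.p ≫ π₁
  let r₂ : d.Z ⟶ E' := d.p ≫ π₂
  have hr : r₁ ≫ q = r₂ ≫ q' := by simp [r₁, r₂, sqP.w]
  have hi₁ : d.i ≫ r₁ = 𝟙 E := by simp [r₁]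
  have hi₂ : d.i ≫ r₂ = w := by simp [r₂]
  have := weakEquivalence_of_precomp_of_fac hi₁
  have := weakEquivalence_of_precomp_of_fac hi₂
  obtain ⟨K, κ, sqK⟩ := exists_fiber hZ (r₁ ≫ q)
  let u₁ : K ⟶ Ω := sq.lift (κ ≫ r₁) 0 (by simpa using sqK.w)
  let u₂ : K ⟶ Ω' := sq'.lift (κ ≫ r₂) 0 (by simpa [← hr] using sqK.w)
  have sq₁ : IsPullback κ u₁ r₁ ω := IsPullback.of_bot (by simpa [u₁] using sqK) (by simp [u₁]) sq
  have sq₂ : IsPullback κ u₂ r₂ ω' :=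
    IsPullback.of_bot (by simpa [u₂, ← hr] using sqK) (by simp [u₂]) sq'
  have := weakEquivalence_of_isPullback sq₁
  have := weakEquivalence_of_isPullback sq₂
  let s : Ω ⟶ K := sqK.lift (ω ≫ d.i) 0 (by simpa [reassoc_of% hi₁] using sq.w)
  have hs : s ≫ u₁ = 𝟙 Ω := sq.hom_ext (by simp [s, u₁, hi₁]) (hZ.eq_of_tgt _ _)
  have := weakEquivalence_of_postcomp_of_fac hs
  have : s ≫ u₂ = j := sq'.hom_ext (by simp [s, u₂, hi₂, hj]) (hZ.eq_of_tgt _ _)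
  rw [← this]
  infer_instance

variable {H : Type*} [Category* H] (L : C ⥤ H) [L.IsLocalization (weakEquivalences C)]

/-- Two maps `h, h' : D ⟶ E` over `B` from a contractible object which restrict along `A ⟶ D` to
maps into the fibre have homotopic restrictions. -/
lemma map_eq_map_of_lift {Z A D E B Ω : C} (hZ : IsZero Z) {i : A ⟶ D} [IsCofibrant D]
    [WeakEquivalence (0 : Z ⟶ D)] {q : E ⟶ B} [Fibration q] {ω : Ω ⟶ E}
    (sq : IsPullback ω (0 : Ω ⟶ Z) q 0) {h h' : D ⟶ E} (hq : h ≫ q = h' ≫ q)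
    {a a' : A ⟶ Ω} (ha : a ≫ ω = i ≫ h) (ha' : a' ≫ ω = i ≫ h') : L.map a = L.map a' := by
  -- lift `(h, h')` to a path object of `E` over `B`; its fibre is a path object of `Ω`
  obtain ⟨P, π₁, π₂, sqP⟩ := exists_isPullback q q
  have : Fibration π₁ := fibration_of_isPullback sqP.flip
  let d := MorphismProperty.factorizationData (trivialCofibrations C) (fibrations C)
    (sqP.lift (𝟙 E) (𝟙 E) (by simp))
  let r : d.Z ⟶ B := d.p ≫ π₁ ≫ q
  have hr : d.i ≫ r = q := by simp [r]
  obtain ⟨K, κ, sqK⟩ := exists_fiber hZ r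
  have : Cofibration (0 : Z ⟶ D) := by rwa [← isCofibrant_iff_of_isInitial _ hZ.isInitial]
  have sqL : CommSq (0 : Z ⟶ d.Z) (0 : Z ⟶ D) d.p (sqP.lift h h' hq) := ⟨hZ.eq_of_src _ _⟩
  let p₁ : K ⟶ Ω := sq.lift (κ ≫ d.p ≫ π₁) 0 (by simpa [r] using sqK.w)
  let p₂ : K ⟶ Ω := sq.lift (κ ≫ d.p ≫ π₂) 0 (by simpa [r, ← sqP.w] using sqK.w)
  let k : A ⟶ K := sqK.lift (i ≫ sqL.lift) 0 (by
    simp only [r, Category.assoc, sqL.fac_right_assoc, zero_comp]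
    rw [sqP.lift_fst_assoc, ← Category.assoc, ← ha, Category.assoc, sq.w, comp_zero, comp_zero])
  let j : Ω ⟶ K := sqK.lift (ω ≫ d.i) 0 (by simpa [hr] using sq.w)
  have : WeakEquivalence j := weakEquivalence_fiber hZ hr sq sqK (by simp [j])
  have hj₁ : j ≫ p₁ = 𝟙 Ω := sq.hom_ext (by simp [j, p₁]) (hZ.eq_of_tgt _ _)
  have hj₂ : j ≫ p₂ = 𝟙 Ω := sq.hom_ext (by simp [j, p₂]) (hZ.eq_of_tgt _ _)
  have hk₁ : k ≫ p₁ = a := sq.hom_ext (by simp [k, p₁, ha]) (hZ.eq_of_tgt _ _)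
  have hk₂ : k ≫ p₂ = a' := sq.hom_ext (by simp [k, p₂, ha']) (hZ.eq_of_tgt _ _)
  have := isIso_map_of_weakEquivalence L j
  have : L.map p₁ = L.map p₂ := by
    rw [← cancel_epi (L.map j), ← L.map_comp, ← L.map_comp, hj₁, hj₂]
  rw [← hk₁, ← hk₂, L.map_comp, L.map_comp, this]

/-- Replacement of a fibration `q : E ⟶ B` by the fibration of pairs of a point `e` of `E` and a
path starting at `q e`, which is sent to the endpoint of the path. -/
lemma exists_translation {Z E B Ω : C} (hZ : IsZero Z) {q : E ⟶ B} [IsFibrant B] [Fibration q]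
    {ω : Ω ⟶ E} (sq : IsPullback ω (0 : Ω ⟶ Z) q 0) (P : PathObject B) [P.IsGood] :
    ∃ (E' Ω' : C) (pr : E' ⟶ E) (k : E' ⟶ P.P) (r : E' ⟶ B) (ω' : Ω' ⟶ E') (j : Ω ⟶ Ω'),
      IsPullback pr k q P.p₀ ∧ r = k ≫ P.p₁ ∧ Fibration r ∧
      IsPullback ω' (0 : Ω' ⟶ Z) r 0 ∧ WeakEquivalence j ∧ j ≫ ω' ≫ pr = ω ∧
      j ≫ ω' ≫ k = 0 := by
  obtain ⟨E', pr, k, sqE⟩ := exists_isPullback q P.p₀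
  have : IsFibrant E := isFibrant_of_fibration q
  have sqB : IsPullback (prod.lift pr (k ≫ P.p₁)) k (prod.map q (𝟙 B)) P.p := by
    refine ⟨⟨?_⟩, ⟨PullbackCone.IsLimit.mk _
      (fun s => sqE.lift (s.fst ≫ prod.fst) s.snd ?_) (fun s => ?_)
      (fun s => sqE.lift_snd _ _ _) (fun s m hm hm' => ?_)⟩⟩
    · apply Limits.prod.hom_ext
      · rw [Category.assoc, Category.assoc, prod.map_fst, prod.lift_fst_assoc, P.p_fst, sqE.w]
      · rw [Category.assoc, Category.assoc, prod.map_snd, prod.lift_snd_assoc, P.p_snd,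
          Category.comp_id]
    · rw [Category.assoc, ← prod.map_fst q (𝟙 B), s.condition_assoc, P.p_fst]
    · apply Limits.prod.hom_ext
      · rw [Category.assoc, prod.lift_fst, sqE.lift_fst]
      · rw [Category.assoc, prod.lift_snd, sqE.lift_snd_assoc, ← P.p_snd, ← s.condition_assoc,
          prod.map_snd, Category.comp_id]
    · apply sqE.hom_ext
      · rw [sqE.lift_fst, ← hm, Category.assoc, prod.lift_fst]
      · rw [sqE.lift_snd, hm']
  have h₁ : Fibration (prod.lift pr (k ≫ P.p₁)) := fibration_of_isPullback sqB.flip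
  have hr : Fibration (k ≫ P.p₁) := by
    rw [← prod.lift_snd pr (k ≫ P.p₁)]
    infer_instance
  have : WeakEquivalence pr := weakEquivalence_of_isPullback sqE.flip
  let e : E ⟶ E' := sqE.lift (𝟙 E) (q ≫ P.ι) (by simp)
  have he : e ≫ pr = 𝟙 E := by simp [e]
  have := weakEquivalence_of_postcomp_of_fac he
  have her : e ≫ k ≫ P.p₁ = q := by simp [e]
  obtain ⟨Ω', ω', sq'⟩ := exists_fiber hZ (k ≫ P.p₁)
  let j : Ω ⟶ Ω' := sq'.lift (ω ≫ e) 0 (by simpa [her] using sq.w)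
  refine ⟨E', Ω', pr, k, _, ω', j, sqE, rfl, hr, sq',
    weakEquivalence_fiber hZ her sq sq' (by simp [j]), by simp [j, he], ?_⟩
  have : ω ≫ q = 0 := by rw [sq.w, zero_comp]
  simp [j, e, reassoc_of% this]

/-- The homotopy class of the restriction `A ⟶ Ω` of a map `D ⟶ E` from a contractible object only
depends on the homotopy class of the induced map `S ⟶ B` from the quotient. -/
lemma map_eq_map_of_map_eq {Z A D S E B Ω : C} (hZ : IsZero Z) {i : A ⟶ D} {σ : D ⟶ S}
    (hi : i ≫ σ = 0) [IsCofibrant D] [IsCofibrant S] [WeakEquivalence (0 : Z ⟶ D)]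
    {q : E ⟶ B} [IsFibrant B] [Fibration q] {ω : Ω ⟶ E}
    (sq : IsPullback ω (0 : Ω ⟶ Z) q 0) {h h' : D ⟶ E} {b b' : S ⟶ B}
    (hb : h ≫ q = σ ≫ b) (hb' : h' ≫ q = σ ≫ b')
    {a a' : A ⟶ Ω} (ha : a ≫ ω = i ≫ h) (ha' : a' ≫ ω = i ≫ h') (hbb' : L.map b = L.map b') :
    L.map a = L.map a' := by
  obtain ⟨P, hP, ⟨s⟩⟩ :=
    ((RightHomotopyRel.iff_map_eq L _ _).2 hbb').exists_good_pathObject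
  obtain ⟨E', Ω', pr, k, r, ω', j, sqE, rfl, _, sq', _, hj₁, hj₂⟩ := exists_translation hZ sq P
  let g : D ⟶ E' := sqE.lift h (σ ≫ s.h) (by simp [hb])
  let g' : D ⟶ E' := sqE.lift h' (h' ≫ q ≫ P.ι) (by simp)
  have hj : j ≫ ω' = sqE.lift ω 0 (by simp [sq.w]) :=
    sqE.hom_ext (by simp [hj₁]) (by simp [hj₂])
  have key := map_eq_map_of_lift L hZ sq' (i := i) (h := g) (h' := g') (a := a ≫ j) (a' := a' ≫ j)
    (by simp [g, g', hb']) ?_ ?_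
  · have := isIso_map_of_weakEquivalence L j
    rwa [L.map_comp, L.map_comp, cancel_mono] at key
  · rw [Category.assoc, hj]
    exact sqE.hom_ext (by simp [g, ha]) (by simp [g, reassoc_of% hi])
  · rw [Category.assoc, hj]
    exact sqE.hom_ext (by simp [g', ha']) (by simp [g', reassoc_of% hb', reassoc_of% hi])

/-- The dual of `map_eq_map_of_map_eq`. -/
lemma map_eq_map_of_map_eq' {Z A D S E B Ω : C} (hZ : IsZero Z) {i : A ⟶ D} [IsCofibrant A]
    [Cofibration i] {σ : D ⟶ S} (sq : IsPushout i (0 : A ⟶ Z) σ 0)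
    {q : E ⟶ B} {ω : Ω ⟶ E} (hω : ω ≫ q = 0) [IsFibrant E] [IsFibrant Ω]
    [WeakEquivalence (0 : E ⟶ Z)] {h h' : D ⟶ E} {b b' : S ⟶ B}
    (hb : h ≫ q = σ ≫ b) (hb' : h' ≫ q = σ ≫ b')
    {a a' : A ⟶ Ω} (ha : a ≫ ω = i ≫ h) (ha' : a' ≫ ω = i ≫ h') (haa' : L.map a = L.map a') :
    L.map b = L.map b' := by
  have : L.op.IsLocalization (weakEquivalences Cᵒᵖ) :=
    inferInstanceAs (L.op.IsLocalization (weakEquivalences C).op)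
  have : IsCofibrant (op E) := by
    rw [isCofibrant_iff_of_isInitial (0 : E ⟶ Z).op hZ.op.isInitial, cofibration_op_iff]
    rwa [← isFibrant_iff_of_isTerminal _ hZ.isTerminal]
  have : IsCofibrant (op Ω) := by
    rw [isCofibrant_iff_of_isInitial (0 : Ω ⟶ Z).op hZ.op.isInitial, cofibration_op_iff]
    rwa [← isFibrant_iff_of_isTerminal _ hZ.isTerminal]
  have : IsFibrant (op A) := by
    rw [isFibrant_iff_of_isTerminal (0 : Z ⟶ A).op hZ.op.isTerminal, fibration_op_iff]
    rwa [← isCofibrant_iff_of_isInitial _ hZ.isInitial]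
  have : WeakEquivalence (0 : op Z ⟶ op E) :=
    (weakEquivalences_op_iff (0 : E ⟶ Z)).2 inferInstance
  have key := map_eq_map_of_map_eq L.op hZ.op (i := q.op) (σ := ω.op) (q := i.op) (ω := σ.op)
    (h := h.op) (h' := h'.op) (b := a.op) (b' := a'.op) (a := b.op) (a' := b'.op)
    (congrArg Quiver.Hom.op hω) sq.flip.op (congrArg Quiver.Hom.op ha.symm)
    (congrArg Quiver.Hom.op ha'.symm) (congrArg Quiver.Hom.op hb.symm)
    (congrArg Quiver.Hom.op hb'.symm) (congrArg Quiver.Hom.op haa')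
  exact Quiver.Hom.op_inj key

end Fiber

/-! ### Loop objects and suspensions -/

section Loop

open scoped ZeroObject

variable {M : Type u} [Category.{v} M] [ModelCategory M] [HasZeroObject M] [HasZeroMorphisms M]

/-- A fibration `E ⟶ G` with fibre `Ω` whose total space is trivially fibrant, so that `Ω`
is a loop object of `G`. -/
structure LoopFibration (G Ω : M) where
  /-- the total space -/
  E : M
  /-- the fibration -/
  q : E ⟶ G
  /-- the inclusion of the fibre -/
  ω : Ω ⟶ E
  fibration_q : Fibration q
  fibration_zero : Fibration (0 : E ⟶ (0 : M))
  weakEquivalence_zero : WeakEquivalence (0 : E ⟶ (0 : M))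
  isPullback : IsPullback ω (0 : Ω ⟶ 0) q 0

lemma nonempty_loopFibration {G : M} [IsFibrant G] (P : PathObject G) [P.IsGood] :
    Nonempty (LoopFibration G (loopObj P)) := by
  obtain ⟨E, e, sq⟩ := exists_fiber (isZero_zero M) P.p₀
  have hk₀ : kernel.ι P.p ≫ P.p₀ = 0 := by
    rw [← P.p_fst, kernel.condition_assoc, zero_comp]
  have hk₁ : kernel.ι P.p ≫ P.p₁ = 0 := by
    rw [← P.p_snd, kernel.condition_assoc, zero_comp]
  have hw : e ≫ P.p₀ = 0 := by rw [sq.w, zero_comp]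
  have sqB : IsPullback e (e ≫ P.p₁) P.p (prod.lift 0 (𝟙 G)) := by
    have hs (s : PullbackCone P.p (prod.lift 0 (𝟙 G))) : s.fst ≫ P.p₀ = 0 := by
      rw [← P.p_fst, s.condition_assoc, prod.lift_fst, comp_zero]
    refine ⟨⟨?_⟩, ⟨PullbackCone.IsLimit.mk _
      (fun s => sq.lift s.fst 0 (by rw [hs, zero_comp]))
      (fun s => sq.lift_fst _ _ _) (fun s => ?_) (fun s m hm _ => ?_)⟩⟩
    · apply Limits.prod.hom_ext
      · rw [Category.assoc, Category.assoc, P.p_fst, prod.lift_fst, hw, comp_zero]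
      · rw [Category.assoc, Category.assoc, P.p_snd, prod.lift_snd, Category.comp_id]
    · rw [sq.lift_fst_assoc, ← P.p_snd, s.condition_assoc, prod.lift_snd, Category.comp_id]
    · apply sq.hom_ext
      · rw [sq.lift_fst, hm]
      · exact (isZero_zero M).eq_of_tgt _ _
  refine ⟨{
    E := E
    q := e ≫ P.p₁
    ω := sq.lift (kernel.ι P.p) 0 (by rw [hk₀, zero_comp])
    fibration_q := fibration_of_isPullback sqB
    fibration_zero := fibration_of_isPullback sq
    weakEquivalence_zero := weakEquivalence_of_isPullback sq
    isPullback := ?_ }⟩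
  refine ⟨⟨?_⟩, ⟨PullbackCone.IsLimit.mk _
    (fun s => kernel.lift P.p (s.fst ≫ e) ?_)
    (fun s => ?_) (fun s => (isZero_zero M).eq_of_tgt _ _) (fun s m hm _ => ?_)⟩⟩
  · rw [sq.lift_fst_assoc, hk₁, zero_comp]
  · have := s.condition
    rw [comp_zero] at this
    apply Limits.prod.hom_ext
    · rw [Category.assoc, Category.assoc, P.p_fst, hw, comp_zero, zero_comp]
    · rw [Category.assoc, Category.assoc, P.p_snd, this, zero_comp]
  · apply sq.hom_ext
    · rw [Category.assoc, sq.lift_fst, kernel.lift_ι]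
    · exact (isZero_zero M).eq_of_tgt _ _
  · rw [← cancel_mono (kernel.ι P.p), kernel.lift_ι, ← hm, Category.assoc, sq.lift_fst]

/-- A cone of `A`: a factorization of `A ⟶ 0` as a cofibration followed by a trivial fibration. -/
def coneData (A : M) : MorphismProperty.MapFactorizationData (cofibrations M)
    (trivialFibrations M) (0 : A ⟶ (0 : M)) :=
  MorphismProperty.factorizationData _ _ _

/-- The cone of `A`. -/
def cone (A : M) : M := (coneData A).Z

/-- The inclusion of `A` in its cone. -/
def coneι (A : M) : A ⟶ cone A := (coneData A).i

instance (A : M) : Cofibration (coneι A) := inferInstanceAs (Cofibration (coneData A).i)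

instance (A : M) : Fibration (0 : cone A ⟶ (0 : M)) := by
  have h : (0 : cone A ⟶ (0 : M)) = (coneData A).p := (isZero_zero M).eq_of_tgt _ _
  rw [h]
  exact inferInstanceAs (Fibration (coneData A).p)

instance (A : M) : WeakEquivalence (0 : cone A ⟶ (0 : M)) := by
  have h : (0 : cone A ⟶ (0 : M)) = (coneData A).p := (isZero_zero M).eq_of_tgt _ _
  rw [h]
  exact inferInstanceAs (WeakEquivalence (coneData A).p)

instance (A : M) [IsCofibrant A] : IsCofibrant (cone A) := isCofibrant_of_cofibration (coneι A)

lemma weakEquivalence_from_zero (B : M) [WeakEquivalence (0 : B ⟶ (0 : M))] :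
    WeakEquivalence (0 : (0 : M) ⟶ B) := by
  have : (0 : (0 : M) ⟶ B) ≫ (0 : B ⟶ 0) = 𝟙 0 := (isZero_zero M).eq_of_src _ _
  exact weakEquivalence_of_postcomp_of_fac this

/-- The suspension of `A`. -/
def susp (A : M) : M := cokernel (coneι A)

/-- The projection from the cone of `A` to the suspension of `A`. -/
def suspπ (A : M) : cone A ⟶ susp A := cokernel.π (coneι A)

lemma isCofiberSequence_cone (A : M) : IsCofiberSequence (coneι A) (suspπ A) :=
  .of_cokernel _

instance (A : M) : IsCofibrant (susp A) := (isCofiberSequence_cone A).isCofibrant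

/-- A morphism extends to the cones and the suspensions. -/
lemma exists_cone_map {A B : M} (f : A ⟶ B) :
    ∃ (c : cone A ⟶ cone B) (s : susp A ⟶ susp B), coneι A ≫ c = f ≫ coneι B ∧
      suspπ A ≫ s = c ≫ suspπ B := by
  have sq : CommSq (f ≫ coneι B) (coneι A) (0 : cone B ⟶ 0) 0 := ⟨by simp⟩
  obtain ⟨s, hs⟩ := (isCofiberSequence_cone A).exists_desc (sq.lift ≫ suspπ B) (by
    rw [sq.fac_left_assoc, Category.assoc, (isCofiberSequence_cone B).w, comp_zero])
  exact ⟨sq.lift, s, sq.fac_left, hs⟩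

namespace LoopFibration

variable {G Ω : M} (F : LoopFibration G Ω)

attribute [instance] fibration_q fibration_zero weakEquivalence_zero

lemma ω_q : F.ω ≫ F.q = 0 := by rw [F.isPullback.w, zero_comp]

include F in
lemma isFibrant_fiber : IsFibrant Ω := by
  have : Fibration (0 : Ω ⟶ (0 : M)) := fibration_of_isPullback F.isPullback
  rwa [isFibrant_iff_of_isTerminal _ HasZeroObject.zeroIsTerminal]

instance : IsFibrant F.E :=
  (isFibrant_iff_of_isTerminal _ HasZeroObject.zeroIsTerminal).2 F.fibration_zero

lemma exists_lift {T : M} (t : T ⟶ F.E) (ht : t ≫ F.q = 0) : ∃ a : T ⟶ Ω, a ≫ F.ω = t :=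
  ⟨F.isPullback.lift t 0 (by simp [ht]), F.isPullback.lift_fst _ _ _⟩

/-- For `A ⟶ B ⟶ C` with zero composition, `a : A ⟶ Ω` transgresses to `b : C ⟶ G` if both are
induced by some `B ⟶ E`. -/
def Transgress {A B C : M} (i : A ⟶ B) (p : B ⟶ C) (a : A ⟶ Ω) (b : C ⟶ G) : Prop :=
  ∃ h : B ⟶ F.E, a ≫ F.ω = i ≫ h ∧ h ≫ F.q = p ≫ b

variable {F}

lemma Transgress.comp {A B C A' B' C' : M} {i : A ⟶ B} {p : B ⟶ C} {i' : A' ⟶ B'} {p' : B' ⟶ C'}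
    {α : A ⟶ A'} {β : B ⟶ B'} {χ : C ⟶ C'} (hi : i ≫ β = α ≫ i') (hp : p ≫ χ = β ≫ p')
    {a : A' ⟶ Ω} {b : C' ⟶ G} (h : F.Transgress i' p' a b) :
    F.Transgress i p (α ≫ a) (χ ≫ b) := by
  obtain ⟨h, h₁, h₂⟩ := h
  exact ⟨β ≫ h, by rw [Category.assoc, h₁, reassoc_of% hi],
    by rw [Category.assoc, h₂, reassoc_of% hp]⟩

variable {A B C : M} {i : A ⟶ B} {p : B ⟶ C}

lemma exists_transgress (h : IsCofiberSequence i p) (a : A ⟶ Ω) : ∃ b, F.Transgress i p a b := by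
  have := h.cofibration
  have sq : CommSq (a ≫ F.ω) i (0 : F.E ⟶ 0) 0 := ⟨by simp⟩
  obtain ⟨b, hb⟩ := h.exists_desc (sq.lift ≫ F.q) (by
    rw [sq.fac_left_assoc, Category.assoc, F.ω_q, comp_zero])
  exact ⟨b, sq.lift, sq.fac_left.symm, hb.symm⟩

lemma exists_transgress' (h : IsCofiberSequence i p) [IsCofibrant B]
    [WeakEquivalence (0 : B ⟶ (0 : M))] (b : C ⟶ G) : ∃ a, F.Transgress i p a b := by
  have := weakEquivalence_from_zero B
  have : Cofibration (0 : (0 : M) ⟶ B) := by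
    rwa [← isCofibrant_iff_of_isInitial _ HasZeroObject.zeroIsInitial]
  have sq : CommSq (0 : 0 ⟶ F.E) (0 : (0 : M) ⟶ B) F.q (p ≫ b) := ⟨by simp⟩
  obtain ⟨a, ha⟩ := F.exists_lift (i ≫ sq.lift) (by
    rw [Category.assoc, sq.fac_right, reassoc_of% h.w, zero_comp])
  exact ⟨a, sq.lift, ha, sq.fac_right⟩

lemma Transgress.map_eq (h : IsCofiberSequence i p) [IsCofibrant A] {a a' : A ⟶ Ω} {b b' : C ⟶ G}
    (t : F.Transgress i p a b) (t' : F.Transgress i p a' b')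
    (haa' : (toHo M).map a = (toHo M).map a') : (toHo M).map b = (toHo M).map b' := by
  obtain ⟨_, h₁, h₂⟩ := t
  obtain ⟨_, h₁', h₂'⟩ := t'
  have := h.cofibration
  have := F.isFibrant_fiber
  exact map_eq_map_of_map_eq' (toHo M) (isZero_zero M) h.isPushout F.ω_q h₂ h₂' h₁ h₁' haa'

lemma Transgress.map_eq' (h : IsCofiberSequence i p) [IsCofibrant B] [IsFibrant G]
    [WeakEquivalence (0 : B ⟶ (0 : M))] {a a' : A ⟶ Ω} {b b' : C ⟶ G}
    (t : F.Transgress i p a b) (t' : F.Transgress i p a' b')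
    (hbb' : (toHo M).map b = (toHo M).map b') : (toHo M).map a = (toHo M).map a' := by
  obtain ⟨_, h₁, h₂⟩ := t
  obtain ⟨_, h₁', h₂'⟩ := t'
  have := h.isCofibrant
  have := weakEquivalence_from_zero B
  exact map_eq_map_of_map_eq (toHo M) (isZero_zero M) h.w F.isPullback h₂ h₂' h₁ h₁' hbb'

variable (F) [IsFibrant G] (𝔤 : HoGroup G)

/-- The map `[A, Ω] → [susp A, G]` given by transgression. -/
def suspMap (A : M) [IsCofibrant A] (x : (toHo M).obj A ⟶ (toHo M).obj Ω) :
    𝔤.Cls (susp A) :=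
  𝔤.cls (exists_transgress (F := F) (isCofiberSequence_cone A)
    (by
      have := F.isFibrant_fiber
      exact (map_surjective_of_isLocalization (toHo M) A Ω x).choose)).choose

omit [IsFibrant G] in
variable {F} in
lemma suspMap_map {A : M} [IsCofibrant A] {a : A ⟶ Ω} {b : susp A ⟶ G}
    (t : F.Transgress (coneι A) (suspπ A) a b) :
    F.suspMap 𝔤 A ((toHo M).map a) = 𝔤.cls b := by
  have := F.isFibrant_fiber
  refine Transgress.map_eq (isCofiberSequence_cone A)
    (exists_transgress (F := F) (isCofiberSequence_cone A) _).choose_spec t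
    (map_surjective_of_isLocalization (toHo M) A Ω _).choose_spec

lemma suspMap_bijective (A : M) [IsCofibrant A] : Function.Bijective (F.suspMap 𝔤 A) := by
  have := F.isFibrant_fiber
  constructor
  · intro x y hxy
    obtain ⟨a, rfl⟩ := map_surjective_of_isLocalization (toHo M) A Ω x
    obtain ⟨a', rfl⟩ := map_surjective_of_isLocalization (toHo M) A Ω y
    obtain ⟨b, t⟩ := exists_transgress (F := F) (isCofiberSequence_cone A) a
    obtain ⟨b', t'⟩ := exists_transgress (F := F) (isCofiberSequence_cone A) a'
    rw [suspMap_map 𝔤 t, suspMap_map 𝔤 t'] at hxy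
    exact Transgress.map_eq' (isCofiberSequence_cone A) t t' hxy
  · intro y
    obtain ⟨b, rfl⟩ := 𝔤.cls_surjective y
    obtain ⟨a, t⟩ := exists_transgress' (F := F) (isCofiberSequence_cone A) b
    exact ⟨_, suspMap_map 𝔤 t⟩

omit [IsFibrant G] in
lemma suspMap_comp {A B : M} [IsCofibrant A] [IsCofibrant B] (f : A ⟶ B) {c : cone A ⟶ cone B}
    {s : susp A ⟶ susp B} (hc : coneι A ≫ c = f ≫ coneι B) (hs : suspπ A ≫ s = c ≫ suspπ B)
    (x : (toHo M).obj B ⟶ (toHo M).obj Ω) :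
    F.suspMap 𝔤 A ((toHo M).map f ≫ x) = 𝔤.res s (F.suspMap 𝔤 B x) := by
  have := F.isFibrant_fiber
  obtain ⟨a, rfl⟩ := map_surjective_of_isLocalization (toHo M) B Ω x
  obtain ⟨b, t⟩ := exists_transgress (F := F) (isCofiberSequence_cone B) a
  rw [suspMap_map 𝔤 t, ← Functor.map_comp, suspMap_map 𝔤 (t.comp hc hs), 𝔤.res_cls]

/-- The group structure on `[A, Ω]` coming from the bijection with `[susp A, G]`. -/
def hoGroup : HoGroup Ω where
  grp A _ := (Equiv.ofBijective _ (F.suspMap_bijective 𝔤 A)).group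
  comp_mul {A B _ _} f x y := by
    obtain ⟨c, s, hc, hs⟩ := exists_cone_map f
    apply (F.suspMap_bijective 𝔤 A).1
    rw [F.suspMap_comp 𝔤 f hc hs]
    have h (A : M) [IsCofibrant A] (x y : (toHo M).obj A ⟶ (toHo M).obj Ω) :
        F.suspMap 𝔤 A ((Equiv.ofBijective _ (F.suspMap_bijective 𝔤 A)).group.mul x y) =
          F.suspMap 𝔤 A x * F.suspMap 𝔤 A y :=
      (Equiv.ofBijective _ (F.suspMap_bijective 𝔤 A)).apply_symm_apply _
    rw [h, h, map_mul, F.suspMap_comp 𝔤 f hc hs, F.suspMap_comp 𝔤 f hc hs]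

/-- The isomorphism of groups between `[A, Ω]` and `[susp A, G]`. -/
def suspEquiv (A : M) [IsCofibrant A] : (F.hoGroup 𝔤).Cls A ≃* 𝔤.Cls (susp A) where
  toEquiv := Equiv.ofBijective _ (F.suspMap_bijective 𝔤 A)
  map_mul' _ _ := (Equiv.ofBijective _ (F.suspMap_bijective 𝔤 A)).apply_symm_apply _

variable {F} in
lemma suspEquiv_cls {A : M} [IsCofibrant A] {a : A ⟶ Ω} {b : susp A ⟶ G}
    (t : F.Transgress (coneι A) (suspπ A) a b) :
    F.suspEquiv 𝔤 A ((F.hoGroup 𝔤).cls a) = 𝔤.cls b :=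
  suspMap_map 𝔤 t

end LoopFibration

end Loop

/-! ### The connecting homomorphism -/

section Connecting

open scoped ZeroObject

variable {M : Type u} [Category.{v} M] [ModelCategory M] [HasZeroObject M] [HasZeroMorphisms M]

/-- A class of maps out of a coproduct is determined by its restrictions to both summands. -/
lemma HoGroup.coprod_ext {G : M} [IsFibrant G] (𝔤 : HoGroup G) {A B : M} [IsCofibrant A]
    [IsCofibrant B] [IsCofibrant (A ⨿ B)] {x y : 𝔤.Cls (A ⨿ B)}
    (h₁ : 𝔤.res coprod.inl x = 𝔤.res coprod.inl y)
    (h₂ : 𝔤.res coprod.inr x = 𝔤.res coprod.inr y) : x = y := by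
  have hs : IsCofiberSequence (coprod.inl : A ⟶ A ⨿ B) (coprod.desc 0 (𝟙 B)) :=
    .of_existsUnique (coprod.inl_desc _ _) (fun t ht => ⟨coprod.inr ≫ t, by
      apply coprod.hom_ext
      · rw [coprod.inl_desc_assoc, zero_comp, ht]
      · rw [coprod.inr_desc_assoc, Category.id_comp], fun s hs => by
      rw [← hs, coprod.inr_desc_assoc, Category.id_comp]⟩)
  obtain ⟨w, hw⟩ := (hs.exact 𝔤 (x * y⁻¹)).1 (by rw [map_mul, map_inv, h₁, mul_inv_cancel])
  have : 𝔤.res coprod.inr (x * y⁻¹) = w := by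
    rw [← hw, 𝔤.res_res, coprod.inr_desc, 𝔤.res_id]
  rw [map_mul, map_inv, h₂, mul_inv_cancel] at this
  rw [← this, map_one] at hw
  exact (mul_inv_eq_one.1 hw.symm)

instance (A B : M) [IsCofibrant A] [IsCofibrant B] : IsCofibrant (A ⨿ B) :=
  isCofibrant_of_cofibration (coprod.inl : A ⟶ A ⨿ B)

lemma HoGroup.cls_coprod_desc {G : M} [IsFibrant G] (𝔤 : HoGroup G) {A B : M} [IsCofibrant A]
    [IsCofibrant B] (f : A ⟶ G) (g : B ⟶ G) :
    𝔤.cls (coprod.desc f g) =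
      𝔤.res (coprod.desc (𝟙 A) 0) (𝔤.cls f) * 𝔤.res (coprod.desc 0 (𝟙 B)) (𝔤.cls g) := by
  apply 𝔤.coprod_ext
  · rw [map_mul, 𝔤.res_res, 𝔤.res_res, 𝔤.res_cls, coprod.inl_desc, coprod.inl_desc,
      coprod.inl_desc, 𝔤.res_id, 𝔤.res_zero, mul_one]
  · rw [map_mul, 𝔤.res_res, 𝔤.res_res, 𝔤.res_cls, coprod.inr_desc, coprod.inr_desc,
      coprod.inr_desc, 𝔤.res_id, 𝔤.res_zero, one_mul]

lemma HoGroup.commute_coprod {G : M} [IsFibrant G] (𝔤 : HoGroup G) {A B : M} [IsCofibrant A]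
    [IsCofibrant B] (x : 𝔤.Cls A) (y : 𝔤.Cls B) :
    Commute (𝔤.res (coprod.desc (𝟙 A) 0) x) (𝔤.res (coprod.desc 0 (𝟙 B)) y) := by
  apply 𝔤.coprod_ext
  · simp only [map_mul, 𝔤.res_res, coprod.inl_desc, 𝔤.res_id, 𝔤.res_zero, mul_one, one_mul]
  · simp only [map_mul, 𝔤.res_res, coprod.inr_desc, 𝔤.res_id, 𝔤.res_zero, mul_one, one_mul]

/-- A connecting homomorphism for the functors `[-, G]` and `[-, H]`: it extends the exact sequences
associated to cofibre sequences `A ⟶ B ⟶ C` to the left,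
`[B, H] → [A, H] → [C, G] → [B, G]`. It exists if `H` is a loop object of `G`. -/
structure Connecting {G H : M} (𝔤 : HoGroup G) (𝔥 : HoGroup H) where
  /-- the connecting homomorphism -/
  δ : ∀ {A B C : M} [IsCofibrant A] [IsCofibrant B] [IsCofibrant C] {i : A ⟶ B} {p : B ⟶ C}
    (_ : IsCofiberSequence i p), 𝔥.Cls A →* 𝔤.Cls C
  naturality : ∀ {A B C A' B' C' : M} [IsCofibrant A] [IsCofibrant B] [IsCofibrant C]
    [IsCofibrant A'] [IsCofibrant B'] [IsCofibrant C']
    {i : A ⟶ B} {p : B ⟶ C} {i' : A' ⟶ B'} {p' : B' ⟶ C'}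
    (h : IsCofiberSequence i p) (h' : IsCofiberSequence i' p')
    {α : A ⟶ A'} {β : B ⟶ B'} {χ : C ⟶ C'} (_ : i ≫ β = α ≫ i') (_ : p ≫ χ = β ≫ p')
    (x : 𝔥.Cls A'), δ h (𝔥.res α x) = 𝔤.res χ (δ h' x)
  exact_target : ∀ {A B C : M} [IsCofibrant A] [IsCofibrant B] [IsCofibrant C]
    {i : A ⟶ B} {p : B ⟶ C} (h : IsCofiberSequence i p) (y : 𝔤.Cls C),
    𝔤.res p y = 1 ↔ ∃ x, δ h x = y
  exact_source : ∀ {A B C : M} [IsCofibrant A] [IsCofibrant B] [IsCofibrant C]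
    {i : A ⟶ B} {p : B ⟶ C} (h : IsCofiberSequence i p) (x : 𝔥.Cls A),
    δ h x = 1 ↔ ∃ y, 𝔥.res i y = x

namespace LoopFibration

variable {G Ω : M} (F : LoopFibration G Ω) [IsFibrant G] (𝔤 : HoGroup G)

include F in
lemma cls_comp_q {B : M} [IsCofibrant B] (h : B ⟶ F.E) : 𝔤.cls (h ≫ F.q) = 1 := by
  have : (toHo M).map h = (toHo M).map 0 := by
    have := isIso_map_of_weakEquivalence (toHo M) (0 : F.E ⟶ (0 : M))
    rw [← cancel_mono ((toHo M).map (0 : F.E ⟶ (0 : M))), ← Functor.map_comp, ← Functor.map_comp,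
      comp_zero, comp_zero]
  rw [← 𝔤.cls_zero B]
  change (toHo M).map (h ≫ F.q) = (toHo M).map 0
  rw [Functor.map_comp, this, ← Functor.map_comp, zero_comp]

variable {A B C : M} [IsCofibrant A] [IsCofibrant B] [IsCofibrant C] {i : A ⟶ B} {p : B ⟶ C}

lemma exists_connecting [IsLeftProper M] (h : IsCofiberSequence i p) :
    ∃ δ : (F.hoGroup 𝔤).Cls A →* 𝔤.Cls C, ∀ (a : A ⟶ Ω) (b : C ⟶ G),
      F.Transgress i p a b → δ ((F.hoGroup 𝔤).cls a) = (𝔤.cls b)⁻¹ := by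
  -- `δ` is the restriction along the zigzag `C ← B ⊔_A cone A → susp A`
  have hi := h.cofibration
  obtain ⟨D, l, r, sq⟩ : ∃ (D : M) (l : B ⟶ D) (r : cone A ⟶ D), IsPushout i (coneι A) l r :=
    ⟨_, _, _, IsPushout.of_hasPushout i (coneι A)⟩
  have hr : Cofibration r := by
    rw [cofibration_iff] at hi ⊢
    exact MorphismProperty.of_isPushout sq.flip hi
  have hl : Cofibration l := by
    rw [cofibration_iff]
    exact MorphismProperty.of_isPushout sq (mem_cofibrations (coneι A))
  have : IsCofibrant D := isCofibrant_of_cofibration l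
  let w : D ⟶ C := sq.desc p 0 (by rw [h.w, comp_zero])
  let d : D ⟶ susp A := sq.desc 0 (suspπ A) (by
    rw [(isCofiberSequence_cone A).w, comp_zero])
  have sqw : IsPushout (0 : cone A ⟶ (0 : M)) r 0 w :=
    IsPushout.of_left (h₁₁ := coneι A) (v₁₁ := i) (h₂₁ := l)
      (by simpa [w] using h.isPushout.flip) (by simp [w]) sq.flip
  have : WeakEquivalence w := IsLeftProper.weakEquivalence_of_isPushout _ _ _ _ sqw
  let e := MulEquiv.ofBijective _ (𝔤.res_bijective w)
  refine ⟨e.symm.toMonoidHom.comp ((𝔤.res d).comp (F.suspEquiv 𝔤 A).toMonoidHom),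
    fun a b t => ?_⟩
  obtain ⟨b₁, t₁⟩ := exists_transgress (F := F) (isCofiberSequence_cone A) a
  change e.symm (𝔤.res d (F.suspEquiv 𝔤 A ((F.hoGroup 𝔤).cls a))) = _
  rw [suspEquiv_cls 𝔤 t₁, MulEquiv.symm_apply_eq, map_inv]
  change 𝔤.res d (𝔤.cls b₁) = (𝔤.res w (𝔤.cls b))⁻¹
  obtain ⟨g, hg, hgb⟩ := t
  obtain ⟨g₁, hg₁, hgb₁⟩ := t₁
  let u : D ⟶ C ⨿ susp A := sq.desc (p ≫ coprod.inl) (suspπ A ≫ coprod.inr) (by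
    rw [reassoc_of% h.w, reassoc_of% (isCofiberSequence_cone A).w, zero_comp, zero_comp])
  have hu : u ≫ coprod.desc b b₁ = sq.desc g g₁ (by rw [← hg, hg₁]) ≫ F.q := by
    apply sq.hom_ext
    · rw [sq.inl_desc_assoc, sq.inl_desc_assoc, Category.assoc, coprod.inl_desc, hgb]
    · rw [sq.inr_desc_assoc, sq.inr_desc_assoc, Category.assoc, coprod.inr_desc, hgb₁]
  have hu₁ : u ≫ coprod.desc (𝟙 C) 0 = w := by
    apply sq.hom_ext
    · rw [sq.inl_desc_assoc, Category.assoc, coprod.inl_desc, Category.comp_id, sq.inl_desc]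
    · rw [sq.inr_desc_assoc, Category.assoc, coprod.inr_desc, comp_zero, sq.inr_desc]
  have hu₂ : u ≫ coprod.desc 0 (𝟙 (susp A)) = d := by
    apply sq.hom_ext
    · rw [sq.inl_desc_assoc, Category.assoc, coprod.inl_desc, comp_zero, sq.inl_desc]
    · rw [sq.inr_desc_assoc, Category.assoc, coprod.inr_desc, Category.comp_id, sq.inr_desc]
  have key : 𝔤.res u (𝔤.cls (coprod.desc b b₁)) = 1 := by
    rw [𝔤.res_cls, hu, F.cls_comp_q]
  rw [𝔤.cls_coprod_desc, map_mul, 𝔤.res_res, 𝔤.res_res, hu₁, hu₂] at key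
  exact eq_inv_of_mul_eq_one_right key

/-- A null homotopic map to `G` lifts to the total space of the fibration. -/
lemma exists_lift_of_cls_eq_one (b : B ⟶ G) (hb : 𝔤.cls b = 1) : ∃ h : B ⟶ F.E, h ≫ F.q = b := by
  obtain ⟨Q, hQ⟩ := Cylinder.exists_very_good B
  have : LeftHomotopyRel 0 b :=
    (LeftHomotopyRel.iff_map_eq (toHo M) _ _).2 ((𝔤.cls_zero B).trans hb.symm)
  obtain ⟨h, k, hk⟩ := Cylinder.LeftHomotopy.covering_homotopy (this.leftHomotopy Q) F.q 0
  exact ⟨h, by rw [← k.h₁, Category.assoc, hk, (this.leftHomotopy Q).h₁]⟩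

/-- The connecting homomorphism of a loop fibration. -/
def connecting [IsLeftProper M] : Connecting 𝔤 (F.hoGroup 𝔤) where
  δ h := (F.exists_connecting 𝔤 h).choose
  naturality h h' α β χ hi hp x := by
    have := F.isFibrant_fiber
    obtain ⟨a, rfl⟩ := (F.hoGroup 𝔤).cls_surjective x
    obtain ⟨b, t⟩ := exists_transgress (F := F) h' a
    rw [(F.exists_connecting 𝔤 h').choose_spec _ _ t, map_inv, 𝔤.res_cls, (F.hoGroup 𝔤).res_cls]
    exact (F.exists_connecting 𝔤 h).choose_spec _ _ (t.comp hi hp)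
  exact_target {A B C _ _ _ i p} h y := by
    have := F.isFibrant_fiber
    constructor
    · intro hy
      obtain ⟨b, hb⟩ := 𝔤.cls_surjective y⁻¹
      obtain ⟨g, hg⟩ := F.exists_lift_of_cls_eq_one 𝔤 (p ≫ b) (by
        rw [← 𝔤.res_cls, hb, map_inv, hy, inv_one])
      obtain ⟨a, ha⟩ := F.exists_lift (i ≫ g) (by
        rw [Category.assoc, hg, reassoc_of% h.w, zero_comp])
      refine ⟨(F.hoGroup 𝔤).cls a, ?_⟩
      rw [(F.exists_connecting 𝔤 h).choose_spec _ _ ⟨g, ha, hg⟩, hb, inv_inv]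
    · rintro ⟨x, rfl⟩
      obtain ⟨a, rfl⟩ := (F.hoGroup 𝔤).cls_surjective x
      obtain ⟨b, t⟩ := exists_transgress (F := F) h a
      rw [(F.exists_connecting 𝔤 h).choose_spec _ _ t, map_inv, 𝔤.res_cls]
      obtain ⟨g, -, hg⟩ := t
      rw [← hg, F.cls_comp_q, inv_one]
  exact_source {A B C _ _ _ i p} h x := by
    have := F.isFibrant_fiber
    constructor
    · intro hx
      obtain ⟨a, rfl⟩ := (F.hoGroup 𝔤).cls_surjective x
      obtain ⟨b, t⟩ := exists_transgress (F := F) h a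
      rw [(F.exists_connecting 𝔤 h).choose_spec _ _ t, inv_eq_one] at hx
      obtain ⟨g, hg, hgb⟩ := t
      -- translating `g : B ⟶ E` along a null homotopy of `b` gives a map `B ⟶ Ω` up to homotopy
      have : (toHo M).map b = (toHo M).map 0 := hx.trans (𝔤.cls_zero C).symm
      obtain ⟨P, hP, ⟨s⟩⟩ :=
        ((RightHomotopyRel.iff_map_eq (toHo M) _ _).2 this).exists_good_pathObject
      obtain ⟨E', Ω', pr, k, r, ω', j, sqE, rfl, _, sq', _, hj₁, hj₂⟩ :=
        exists_translation (isZero_zero M) F.isPullback P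
      let y : B ⟶ Ω' := sq'.lift (sqE.lift g (p ≫ s.h) (by simp [hgb])) 0 (by simp)
      have hy : i ≫ y = a ≫ j := by
        apply sq'.hom_ext
        · apply sqE.hom_ext
          · simp [y, hj₁, hg]
          · simp [y, hj₂, reassoc_of% h.w]
        · exact (isZero_zero M).eq_of_tgt _ _
      have := isIso_map_of_weakEquivalence (toHo M) j
      have key : (toHo M).map i ≫ (toHo M).map y ≫ inv ((toHo M).map j) = (toHo M).map a := by
        rw [← Category.assoc, IsIso.comp_inv_eq, ← Functor.map_comp, hy, Functor.map_comp]
      exact ⟨_, key⟩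
    · rintro ⟨y, rfl⟩
      obtain ⟨a, rfl⟩ := (F.hoGroup 𝔤).cls_surjective y
      rw [(F.hoGroup 𝔤).res_cls, (F.exists_connecting 𝔤 h).choose_spec _ 0
        ⟨a ≫ F.ω, by rw [Category.assoc], by rw [Category.assoc, F.ω_q, comp_zero, comp_zero]⟩,
        𝔤.cls_zero, inv_one]

end LoopFibration

/-- Transport of a group structure along an isomorphism in the homotopy category. -/
def HoGroup.ofIso {H H' : M} (𝔥 : HoGroup H) (e : (toHo M).obj H' ≅ (toHo M).obj H) :
    HoGroup H' where
  grp A _ := letI := 𝔥.grp A; (e.homToEquiv (Z := (toHo M).obj A)).group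
  comp_mul {A B _ _} f x y := by
    let _ := 𝔥.grp A
    let _ := 𝔥.grp B
    change (toHo M).map f ≫ ((x ≫ e.hom) * (y ≫ e.hom)) ≫ e.inv =
      ((((toHo M).map f ≫ x) ≫ e.hom) * (((toHo M).map f ≫ y) ≫ e.hom)) ≫ e.inv
    have := 𝔥.comp_mul f (x ≫ e.hom) (y ≫ e.hom)
    rw [Category.assoc, Category.assoc, ← Category.assoc]
    exact congrArg (· ≫ e.inv) this

/-- The isomorphism of groups between the classes of maps to isomorphic objects. -/
def HoGroup.ofIsoEquiv {H H' : M} (𝔥 : HoGroup H) (e : (toHo M).obj H' ≅ (toHo M).obj H)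
    (A : M) [IsCofibrant A] : (𝔥.ofIso e).Cls A ≃* 𝔥.Cls A where
  toEquiv := e.homToEquiv (Z := (toHo M).obj A)
  map_mul' _ _ := (e.homToEquiv (Z := (toHo M).obj A)).apply_symm_apply _

omit [HasZeroObject M] [HasZeroMorphisms M] in
lemma HoGroup.res_ofIsoEquiv {H H' : M} (𝔥 : HoGroup H) (e : (toHo M).obj H' ≅ (toHo M).obj H)
    {A B : M} [IsCofibrant A] [IsCofibrant B] (f : A ⟶ B) (x : (𝔥.ofIso e).Cls B) :
    𝔥.ofIsoEquiv e A ((𝔥.ofIso e).res f x) = 𝔥.res f (𝔥.ofIsoEquiv e B x) :=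
  Category.assoc ((toHo M).map f) _ e.hom

/-- Transport of a connecting homomorphism along an isomorphism in the homotopy category. -/
def Connecting.ofIso {G H H' : M} {𝔤 : HoGroup G} {𝔥 : HoGroup H} (c : Connecting 𝔤 𝔥)
    (e : (toHo M).obj H' ≅ (toHo M).obj H) : Connecting 𝔤 (𝔥.ofIso e) where
  δ {A B C _ _ _ i p} h := (c.δ h).comp (𝔥.ofIsoEquiv e A).toMonoidHom
  naturality h h' α β χ hi hp x := by
    change c.δ h (𝔥.ofIsoEquiv e _ _) = 𝔤.res χ (c.δ h' (𝔥.ofIsoEquiv e _ _))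
    rw [𝔥.res_ofIsoEquiv, c.naturality h h' hi hp]
  exact_target {A _ _ _ _ _ _ _} h y := by
    rw [c.exact_target h, (𝔥.ofIsoEquiv e A).surjective.exists]
    rfl
  exact_source {A B _ _ _ _ i _} h x := by
    change c.δ h (𝔥.ofIsoEquiv e _ _) = 1 ↔ _
    rw [c.exact_source h, (𝔥.ofIsoEquiv e B).surjective.exists]
    simp only [← 𝔥.res_ofIsoEquiv, (𝔥.ofIsoEquiv e A).injective.eq_iff]

omit [HasZeroObject M] in
/-- A group object of the homotopy category represents a functor to groups. -/
lemma IsClassOfInjectiveModels.nonempty_hoGroup {𝒢 : ObjectProperty M}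
    (h𝒢 : IsClassOfInjectiveModels 𝒢) {G : M} (hG : 𝒢 G) : Nonempty (HoGroup G) := by
  obtain ⟨F, ⟨r⟩⟩ := h𝒢.isGroupObject G hG
  let e (X : Ho M) : (X ⟶ (toHo M).obj G) ≃ F.obj (op X) := r.homEquiv
  have he {X Y : Ho M} (f : X ⟶ Y) (x : Y ⟶ (toHo M).obj G) : e X (f ≫ x) = F.map f.op (e Y x) :=
    r.homEquiv_comp f x
  refine ⟨{
    grp := fun A _ => (e ((toHo M).obj A)).group
    comp_mul := fun {A B _ _} f x y => ?_ }⟩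
  apply (e _).injective
  change e _ (_ ≫ (e _).symm (e _ x * e _ y)) = e _ ((e _).symm (e _ _ * e _ _))
  rw [Equiv.apply_symm_apply, he, Equiv.apply_symm_apply, he, he, map_mul]

/-- A class of injective models is closed under passing to loop objects, in the sense that
the exact sequences of its members extend to the left. -/
lemma IsClassOfInjectiveModels.exists_connecting [IsLeftProper M] {𝒢 : ObjectProperty M}
    (h𝒢 : IsClassOfInjectiveModels 𝒢) {G : M} (hG : 𝒢 G) (𝔤 : HoGroup G) :
    ∃ (G' : M) (_ : 𝒢 G') (𝔤' : HoGroup G'), Nonempty (Connecting 𝔤 𝔤') := by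
  have := h𝒢.isFibrant G hG
  obtain ⟨P, G', hP, hG', ⟨e⟩⟩ := h𝒢.loop G hG
  obtain ⟨F⟩ := nonempty_loopFibration P
  exact ⟨G', hG', _, ⟨(F.connecting 𝔤).ofIso e⟩⟩

end Connecting

/-! ### The exact couple of a sequence of cofibre sequences -/

section Tower

open scoped ZeroObject

/-- Cofibre sequences `Z k ⟶ N (k + 1) ⟶ Z (k + 1)` for all `k`, where `Z 0` and `Z 1` vanish.
The latter condition makes the truncation at the bottom invisible: in the application, `Z (s + 2)`
and `N (s + 2)` are the objects which belong to the cosimplicial degree `s`. -/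
structure Tower (M : Type u) [Category.{v} M] [ModelCategory M] [HasZeroObject M]
    [HasZeroMorphisms M] where
  /-- the outer objects of the cofibre sequences -/
  Z : ℕ → M
  /-- the middle objects of the cofibre sequences -/
  N : ℕ → M
  isCofibrant_Z : ∀ k, IsCofibrant (Z k)
  isCofibrant_N : ∀ k, IsCofibrant (N k)
  /-- the cofibrations -/
  ζ : ∀ k, Z k ⟶ N (k + 1)
  /-- the projections -/
  π : ∀ k, N k ⟶ Z k
  seq : ∀ k, IsCofiberSequence (ζ k) (π (k + 1))
  isZero_Z_zero : IsZero (Z 0)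
  isZero_Z_one : IsZero (Z 1)

variable {M : Type u} [Category.{v} M] [ModelCategory M] [HasZeroObject M] [HasZeroMorphisms M]

namespace Tower

attribute [instance] isCofibrant_Z isCofibrant_N

section

variable (T : Tower M) {G H : M} (𝔤 : HoGroup G)

/-- The homomorphism `[N (k + 1), G] → [Z k, G]`. -/
def d (k : ℕ) : 𝔤.Cls (T.N (k + 1)) →* 𝔤.Cls (T.Z k) := 𝔤.res (T.ζ k)

/-- The homomorphism `[Z k, G] → [N k, G]`. -/
def j (k : ℕ) : 𝔤.Cls (T.Z k) →* 𝔤.Cls (T.N k) := 𝔤.res (T.π k)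

/-- The connecting homomorphism `[Z k, ΩG] → [Z (k + 1), G]`. -/
def bd {𝔤 : HoGroup G} {𝔥 : HoGroup H} (c : Connecting 𝔤 𝔥) (k : ℕ) :
    𝔥.Cls (T.Z k) →* 𝔤.Cls (T.Z (k + 1)) := c.δ (T.seq k)

lemma d_eq_one_iff [IsFibrant G] {k : ℕ} (x : 𝔤.Cls (T.N (k + 1))) :
    T.d 𝔤 k x = 1 ↔ ∃ y, T.j 𝔤 (k + 1) y = x := (T.seq k).exact 𝔤 x

lemma d_j [IsFibrant G] {k : ℕ} (x : 𝔤.Cls (T.Z (k + 1))) : T.d 𝔤 k (T.j 𝔤 (k + 1) x) = 1 :=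
  (T.d_eq_one_iff 𝔤 _).2 ⟨x, rfl⟩

variable {𝔤} {𝔥 : HoGroup H} (c : Connecting 𝔤 𝔥)

lemma j_eq_one_iff {k : ℕ} (x : 𝔤.Cls (T.Z (k + 1))) :
    T.j 𝔤 (k + 1) x = 1 ↔ ∃ t, T.bd c k t = x := c.exact_target (T.seq k) x

lemma j_bd {k : ℕ} (t : 𝔥.Cls (T.Z k)) : T.j 𝔤 (k + 1) (T.bd c k t) = 1 :=
  (T.j_eq_one_iff c _).2 ⟨t, rfl⟩

lemma bd_eq_one_iff {k : ℕ} (t : 𝔥.Cls (T.Z k)) :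
    T.bd c k t = 1 ↔ ∃ n, T.d 𝔥 k n = t := c.exact_source (T.seq k) t

lemma bd_d {k : ℕ} (n : 𝔥.Cls (T.N (k + 1))) : T.bd c k (T.d 𝔥 k n) = 1 :=
  (T.bd_eq_one_iff c _).2 ⟨n, rfl⟩

end

/-- Morphisms of towers. -/
structure Hom (T T' : Tower M) where
  /-- the morphisms between the outer objects -/
  onZ : ∀ k, T.Z k ⟶ T'.Z k
  /-- the morphisms between the middle objects -/
  onN : ∀ k, T.N k ⟶ T'.N k
  comm_ζ : ∀ k, T.ζ k ≫ onN (k + 1) = onZ k ≫ T'.ζ k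
  comm_π : ∀ k, T.π k ≫ onZ k = onN k ≫ T'.π k

namespace Hom

variable {T T' : Tower M} (f : Hom T T')

section

variable {G H : M} (𝔤 : HoGroup G)

/-- The restriction homomorphism `[Z' k, G] → [Z k, G]`. -/
def z (k : ℕ) : 𝔤.Cls (T'.Z k) →* 𝔤.Cls (T.Z k) := 𝔤.res (f.onZ k)

/-- The restriction homomorphism `[N' k, G] → [N k, G]`. -/
def n (k : ℕ) : 𝔤.Cls (T'.N k) →* 𝔤.Cls (T.N k) := 𝔤.res (f.onN k)

lemma d_n {k : ℕ} (x : 𝔤.Cls (T'.N (k + 1))) :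
    T.d 𝔤 k (f.n 𝔤 (k + 1) x) = f.z 𝔤 k (T'.d 𝔤 k x) := 𝔤.res_comm (f.comm_ζ k) x

lemma j_z {k : ℕ} (x : 𝔤.Cls (T'.Z k)) :
    T.j 𝔤 k (f.z 𝔤 k x) = f.n 𝔤 k (T'.j 𝔤 k x) := 𝔤.res_comm (f.comm_π k) x

lemma bd_z {𝔤 : HoGroup G} {𝔥 : HoGroup H} (c : Connecting 𝔤 𝔥) {k : ℕ} (x : 𝔥.Cls (T'.Z k)) :
    T.bd c k (f.z 𝔥 k x) = f.z 𝔤 (k + 1) (T'.bd c k x) :=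
  c.naturality (T.seq k) (T'.seq k) (f.comm_ζ k) (f.comm_π (k + 1)) x

/-- `f` induces an injection between the cosets of `[N (k + 1), G]` in `[Z k, G]`. -/
def InjZ (k : ℕ) : Prop :=
  ∀ y : 𝔤.Cls (T'.Z k), (∃ w, T.d 𝔤 k w = f.z 𝔤 k y) → ∃ w, T'.d 𝔤 k w = y

/-- `f` induces a surjection between the cosets of `[N (k + 1), G]` in `[Z k, G]`. -/
def SurjZ (k : ℕ) : Prop :=
  ∀ x : 𝔤.Cls (T.Z k), ∃ (w : 𝔤.Cls (T.N (k + 1))) (y : 𝔤.Cls (T'.Z k)),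
    x = T.d 𝔤 k w * f.z 𝔤 k y

/-- `f` induces an injection between the homology groups of the complexes `[N k, G]`, in
degree `k + 1`. -/
def InjN (k : ℕ) : Prop :=
  ∀ y : 𝔤.Cls (T'.N (k + 1)), T'.j 𝔤 k (T'.d 𝔤 k y) = 1 →
    (∃ w, T.j 𝔤 (k + 1) (T.d 𝔤 (k + 1) w) = f.n 𝔤 (k + 1) y) →
      ∃ w, T'.j 𝔤 (k + 1) (T'.d 𝔤 (k + 1) w) = y

/-- `f` induces a surjection between the homology groups of the complexes `[N k, G]`, in
degree `k + 1`. -/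
def SurjN (k : ℕ) : Prop :=
  ∀ x : 𝔤.Cls (T.N (k + 1)), T.j 𝔤 k (T.d 𝔤 k x) = 1 →
    ∃ (w : 𝔤.Cls (T.N (k + 2))) (y : 𝔤.Cls (T'.N (k + 1))), T'.j 𝔤 k (T'.d 𝔤 k y) = 1 ∧
      x = T.j 𝔤 (k + 1) (T.d 𝔤 (k + 1) w) * f.n 𝔤 (k + 1) y

section

variable {𝔤} [IsFibrant G] {𝔥 : HoGroup H} (c : Connecting 𝔤 𝔥)

include c

lemma surjZ_of {k : ℕ} (h₀ : f.InjZ 𝔥 k) (h₁ : f.SurjZ 𝔥 (k + 1)) (h₂ : f.SurjN 𝔤 (k + 1)) :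
    f.SurjZ 𝔤 (k + 2) := by
  intro x
  obtain ⟨w, y, hy, hx⟩ := h₂ (T.j 𝔤 _ x) (by rw [T.d_j, map_one])
  obtain ⟨t, ht⟩ := (T'.j_eq_one_iff c _).1 hy
  have hdy : T'.d 𝔤 (k + 1) y = 1 := by
    have := congrArg (T.d 𝔤 (k + 1)) hx
    rw [map_mul, T.d_j, T.d_j, one_mul, f.d_n, ← ht, ← f.bd_z c] at this
    rw [← ht, T'.bd_eq_one_iff c]
    exact h₀ _ ((T.bd_eq_one_iff c _).1 this.symm)
  obtain ⟨y, rfl⟩ := (T'.d_eq_one_iff 𝔤 _).1 hdy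
  obtain ⟨t, ht⟩ := (T.j_eq_one_iff c ((T.d 𝔤 _ w * f.z 𝔤 _ y)⁻¹ * x)).1 (by
    rw [map_mul, map_inv, map_mul, f.j_z, ← hx, inv_mul_cancel])
  obtain ⟨w', t', rfl⟩ := h₁ t
  rw [map_mul, T.bd_d, one_mul, f.bd_z c] at ht
  exact ⟨w, y * T'.bd c _ t', by rw [map_mul, ht, ← mul_assoc, mul_inv_cancel_left]⟩

lemma injZ_of {k : ℕ} (h₁ : f.InjZ 𝔥 (k + 1)) (h₂ : f.InjN 𝔤 (k + 1))
    (h₃ : f.SurjN 𝔤 (k + 2)) : f.InjZ 𝔤 (k + 2) := by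
  rintro y ⟨w, hw⟩
  obtain ⟨v, hv⟩ := h₂ (T'.j 𝔤 _ y) (by rw [T'.d_j, map_one]) ⟨w, by rw [hw, f.j_z]⟩
  obtain ⟨t, ht⟩ := (T'.j_eq_one_iff c ((T'.d 𝔤 _ v)⁻¹ * y)).1 (by
    rw [map_mul, map_inv, hv, inv_mul_cancel])
  have hft : T.d 𝔤 _ ((f.n 𝔤 _ v)⁻¹ * w) = f.z 𝔤 _ (T'.bd c _ t) := by
    rw [map_mul, map_inv, f.d_n, hw, ht, map_mul, map_inv]
  obtain ⟨u, v', hv', huv⟩ := h₃ ((f.n 𝔤 _ v)⁻¹ * w) (by rw [hft, ← f.bd_z c, T.j_bd])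
  obtain ⟨t₂, ht₂⟩ := (T'.j_eq_one_iff c _).1 hv'
  have : T'.bd c _ (t * t₂⁻¹) = 1 := by
    rw [T'.bd_eq_one_iff c]
    apply h₁
    rw [← T.bd_eq_one_iff c, f.bd_z, map_mul, map_mul, map_inv, map_inv, ← hft, huv, map_mul,
      T.d_j, one_mul, f.d_n, ht₂, mul_inv_cancel]
  rw [map_mul, map_inv, mul_inv_eq_one] at this
  refine ⟨v * v', ?_⟩
  rw [map_mul, ← ht₂, ← this, ht, mul_inv_cancel_left]

lemma surjN_of {k : ℕ} (h₀ : f.SurjZ 𝔥 k) (h₁ : f.InjZ 𝔤 (k + 1)) (h₂ : f.SurjZ 𝔤 (k + 2)) :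
    f.SurjN 𝔤 (k + 1) := by
  intro x hx
  obtain ⟨t, ht⟩ := (T.j_eq_one_iff c _).1 hx
  obtain ⟨w, t', rfl⟩ := h₀ t
  rw [map_mul, T.bd_d, one_mul, f.bd_z c] at ht
  obtain ⟨v, hv⟩ := h₁ _ ⟨_, ht.symm⟩
  obtain ⟨y, hy⟩ := (T.d_eq_one_iff 𝔤 (x * (f.n 𝔤 _ v)⁻¹)).1 (by
    rw [map_mul, map_inv, f.d_n, hv, ht, mul_inv_cancel])
  obtain ⟨w', y', rfl⟩ := h₂ y
  refine ⟨w', T'.j 𝔤 _ y' * v, ?_, ?_⟩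
  · rw [map_mul, T'.d_j, one_mul, hv, T'.j_bd]
  · rw [map_mul, ← f.j_z, ← mul_assoc, ← map_mul, hy, inv_mul_cancel_right]

lemma injN_of {k : ℕ} (h₀ : f.InjZ 𝔥 k) (h₁ : f.SurjZ 𝔥 (k + 1)) (h₂ : f.InjZ 𝔤 (k + 2)) :
    f.InjN 𝔤 (k + 1) := by
  rintro y hy ⟨w, hw⟩
  obtain ⟨t, ht⟩ := (T'.j_eq_one_iff c _).1 hy
  have hdy : T'.d 𝔤 (k + 1) y = 1 := by
    rw [← ht, T'.bd_eq_one_iff c]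
    apply h₀
    rw [← T.bd_eq_one_iff c, f.bd_z, ht, ← f.d_n, ← hw, T.d_j]
  obtain ⟨y, rfl⟩ := (T'.d_eq_one_iff 𝔤 _).1 hdy
  obtain ⟨t, ht⟩ := (T.j_eq_one_iff c ((T.d 𝔤 _ w)⁻¹ * f.z 𝔤 _ y)).1 (by
    rw [map_mul, map_inv, hw, f.j_z, inv_mul_cancel])
  obtain ⟨n, t', rfl⟩ := h₁ t
  rw [map_mul, T.bd_d, one_mul, f.bd_z c] at ht
  obtain ⟨v, hv⟩ := h₂ (y * (T'.bd c _ t')⁻¹) ⟨w, by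
    rw [map_mul, map_inv, ht, mul_inv_rev, inv_inv, mul_inv_cancel_left]⟩
  refine ⟨v, ?_⟩
  rw [hv, map_mul, map_inv, T'.j_bd, inv_one, mul_one]

end

lemma injZ_of_isZero [IsFibrant G] {k : ℕ} (h : IsZero (T'.Z k)) : f.InjZ 𝔤 k := by
  have := 𝔤.subsingleton_cls_of_isZero h
  exact fun y _ => ⟨1, Subsingleton.elim _ _⟩

lemma surjZ_of_isZero [IsFibrant G] {k : ℕ} (h : IsZero (T.Z k)) : f.SurjZ 𝔤 k := by
  have := 𝔤.subsingleton_cls_of_isZero h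
  exact fun x => ⟨1, 1, Subsingleton.elim _ _⟩

end

variable [IsLeftProper M] {𝒢 : ObjectProperty M} (h𝒢 : IsClassOfInjectiveModels 𝒢)

include h𝒢

/-- The exact couples of two towers show that a morphism induces bijections between the cosets of
`[N (k + 1), G]` in `[Z k, G]` if and only if it induces isomorphisms between the homology groups
of the complexes `[N k, G]`. -/
theorem bijective_iff :
    (∀ G, 𝒢 G → ∀ (𝔤 : HoGroup G) k, f.InjN 𝔤 (k + 1) ∧ f.SurjN 𝔤 (k + 1)) ↔
      ∀ G, 𝒢 G → ∀ (𝔤 : HoGroup G) k, f.InjZ 𝔤 (k + 2) ∧ f.SurjZ 𝔤 (k + 2) := by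
  have aux₀ (G) (hG : 𝒢 G) (𝔤 : HoGroup G) : f.InjZ 𝔤 0 ∧ f.SurjZ 𝔤 0 := by
    have := h𝒢.isFibrant G hG
    exact ⟨f.injZ_of_isZero 𝔤 T'.isZero_Z_zero, f.surjZ_of_isZero 𝔤 T.isZero_Z_zero⟩
  have aux₁ (G) (hG : 𝒢 G) (𝔤 : HoGroup G) : f.InjZ 𝔤 1 ∧ f.SurjZ 𝔤 1 := by
    have := h𝒢.isFibrant G hG
    exact ⟨f.injZ_of_isZero 𝔤 T'.isZero_Z_one, f.surjZ_of_isZero 𝔤 T.isZero_Z_one⟩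
  constructor
  · intro h
    have (k : ℕ) : ∀ G, 𝒢 G → ∀ 𝔤 : HoGroup G, f.InjZ 𝔤 k ∧ f.SurjZ 𝔤 k := by
      induction k using Nat.strong_induction_on with
      | _ k ih =>
        match k, ih with
        | 0, _ => exact aux₀
        | 1, _ => exact aux₁
        | k + 2, ih =>
          intro G hG 𝔤
          have := h𝒢.isFibrant G hG
          obtain ⟨G', hG', 𝔤', ⟨c⟩⟩ := h𝒢.exists_connecting hG 𝔤
          exact ⟨f.injZ_of c (ih (k + 1) (by lia) G' hG' 𝔤').1 (h G hG 𝔤 k).1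
              (h G hG 𝔤 (k + 1)).2,
            f.surjZ_of c (ih k (by lia) G' hG' 𝔤').1 (ih (k + 1) (by lia) G' hG' 𝔤').2
              (h G hG 𝔤 k).2⟩
    exact fun G hG 𝔤 k => this (k + 2) G hG 𝔤
  · intro h
    have h' (k : ℕ) : ∀ G, 𝒢 G → ∀ 𝔤 : HoGroup G, f.InjZ 𝔤 k ∧ f.SurjZ 𝔤 k :=
      match k with
      | 0 => aux₀
      | 1 => aux₁
      | k + 2 => fun G hG 𝔤 => h G hG 𝔤 k
    intro G hG 𝔤 k
    have := h𝒢.isFibrant G hG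
    obtain ⟨G', hG', 𝔤', ⟨c⟩⟩ := h𝒢.exists_connecting hG 𝔤
    exact ⟨f.injN_of c (h' k G' hG' 𝔤').1 (h' (k + 1) G' hG' 𝔤').2 (h' (k + 2) G hG 𝔤).1,
      f.surjN_of c (h' k G' hG' 𝔤').2 (h' (k + 1) G hG 𝔤).1 (h' (k + 2) G hG 𝔤).2⟩

end Hom

end Tower

end Tower

/-! ### Cofaces and codegeneracies -/

section Simplex

open SimplexCategory

/-- The `i`-th coface map `[m] ⟶ [m + 1]`, indexed by a natural number `i ≤ m + 1`. -/
def cf (m i : ℕ) : ⦋m⦌ ⟶ ⦋m + 1⦌ := SimplexCategory.δ (Fin.ofNat (m + 2) i)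

/-- The `i`-th codegeneracy map `[m + 1] ⟶ [m]`, indexed by a natural number `i ≤ m`. -/
def cd (m i : ℕ) : ⦋m + 1⦌ ⟶ ⦋m⦌ := SimplexCategory.σ (Fin.ofNat (m + 1) i)

lemma cf_eq {m i : ℕ} (h : i < m + 2) : cf m i = SimplexCategory.δ ⟨i, h⟩ := by
  rw [cf]; congr; exact Fin.ext (Nat.mod_eq_of_lt h)

lemma cd_eq {m i : ℕ} (h : i < m + 1) : cd m i = SimplexCategory.σ ⟨i, h⟩ := by
  rw [cd]; congr; exact Fin.ext (Nat.mod_eq_of_lt h)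

lemma δ_eq_cf {m : ℕ} (i : Fin (m + 2)) : SimplexCategory.δ i = cf m i := (cf_eq i.2).symm

lemma σ_eq_cd {m : ℕ} (i : Fin (m + 1)) : SimplexCategory.σ i = cd m i := (cd_eq i.2).symm

lemma cf_comp_cf {m i j : ℕ} (hij : i < j) (hj : j < m + 3) :
    cf m i ≫ cf (m + 1) j = cf m (j - 1) ≫ cf (m + 1) i := by
  obtain ⟨j, rfl⟩ := Nat.exists_eq_succ_of_ne_zero (Nat.ne_of_gt (Nat.zero_lt_of_lt hij))
  simp only [Nat.succ_eq_add_one, Nat.add_sub_cancel]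
  rw [cf_eq (by lia), cf_eq (by lia), cf_eq (by lia), cf_eq (by lia)]
  exact δ_comp_δ (i := ⟨i, by lia⟩) (j := ⟨j, by lia⟩) (by simp; lia)

lemma cd_comp_cd {m i j : ℕ} (hij : i < j) (hj : j < m + 2) :
    cd (m + 1) j ≫ cd m i = cd (m + 1) i ≫ cd m (j - 1) := by
  obtain ⟨j, rfl⟩ := Nat.exists_eq_succ_of_ne_zero (Nat.ne_of_gt (Nat.zero_lt_of_lt hij))
  simp only [Nat.succ_eq_add_one, Nat.add_sub_cancel]
  rw [cd_eq (by lia), cd_eq (by lia), cd_eq (by lia), cd_eq (by lia)]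
  exact (σ_comp_σ (i := ⟨i, by lia⟩) (j := ⟨j, by lia⟩) (by simp; lia)).symm

lemma cf_comp_cd_self {m i : ℕ} (h : i < m + 1) : cf m i ≫ cd m i = 𝟙 _ := by
  rw [cf_eq (by lia), cd_eq h]
  exact δ_comp_σ_self (i := ⟨i, h⟩)

lemma cf_succ_comp_cd {m i : ℕ} (h : i < m + 1) : cf m (i + 1) ≫ cd m i = 𝟙 _ := by
  rw [cf_eq (by lia), cd_eq h]
  exact δ_comp_σ_succ (i := ⟨i, h⟩)

lemma cf_comp_cd_of_lt {m i j : ℕ} (hij : i < j) (hj : j < m + 2) :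
    cf (m + 1) i ≫ cd (m + 1) j = cd m (j - 1) ≫ cf m i := by
  obtain ⟨j, rfl⟩ := Nat.exists_eq_succ_of_ne_zero (Nat.ne_of_gt (Nat.zero_lt_of_lt hij))
  simp only [Nat.succ_eq_add_one, Nat.add_sub_cancel]
  rw [cf_eq (by lia), cf_eq (by lia), cd_eq (by lia), cd_eq (by lia)]
  exact δ_comp_σ_of_le (i := ⟨i, by lia⟩) (j := ⟨j, by lia⟩) (by simp; lia)

lemma cf_comp_cd_of_gt {m i j : ℕ} (hij : i < j) (hj : j < m + 2) :
    cf (m + 1) (j + 1) ≫ cd (m + 1) i = cd m i ≫ cf m j := by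
  rw [cf_eq (by lia), cf_eq (by lia), cd_eq (by lia), cd_eq (by lia)]
  exact δ_comp_σ_of_gt (i := ⟨j, by lia⟩) (j := ⟨i, by lia⟩) (by simp; lia)

instance (m i : ℕ) : Mono (cf m i) := by rw [cf]; infer_instance

/-- A common value of two distinct cofaces comes from a common iterated coface. -/
lemma exists_of_comp_cf_eq {l : SimplexCategory} {m i j : ℕ} (hij : i < j) (hj : j < m + 3)
    {φ ψ : l ⟶ ⦋m + 1⦌} (h : φ ≫ cf (m + 1) i = ψ ≫ cf (m + 1) j) :
    ∃ χ : l ⟶ ⦋m⦌, φ = χ ≫ cf m (j - 1) ∧ ψ = χ ≫ cf m i := by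
  obtain ⟨χ, hχ⟩ := eq_comp_δ_of_not_surjective' φ ⟨j - 1, by lia⟩ (fun x hx => by
    have h1 := congrArg (fun f => f.toOrderHom x) h
    rw [cf_eq (by lia), cf_eq hj] at h1
    change Fin.succAbove _ (φ.toOrderHom x) = Fin.succAbove _ (ψ.toOrderHom x) at h1
    refine Fin.succAbove_ne ⟨j, hj⟩ (ψ.toOrderHom x) (h1.symm.trans ?_)
    rw [hx, Fin.succAbove_of_le_castSucc _ _ (by simp [Fin.le_def]; lia)]
    simp; lia)
  rw [δ_eq_cf] at hχ
  refine ⟨χ, hχ, ?_⟩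
  rw [← cancel_mono (cf (m + 1) j), ← h, hχ, Category.assoc, Category.assoc,
    cf_comp_cf hij hj]

/-- The cofaces of `[0]` have disjoint images. -/
lemma eq_of_comp_cf_eq_zero {l : SimplexCategory} {i j : ℕ} (hi : i < 2) (hj : j < 2)
    {φ ψ : l ⟶ ⦋0⦌} (h : φ ≫ cf 0 i = ψ ≫ cf 0 j) : i = j := by
  have h1 := congrArg (fun f => f.toOrderHom 0) h
  rw [cf_eq (by lia), cf_eq hj] at h1
  change Fin.succAbove _ (φ.toOrderHom 0) = Fin.succAbove _ (ψ.toOrderHom 0) at h1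
  have h2 : φ.toOrderHom 0 = ψ.toOrderHom 0 := Subsingleton.elim (α := Fin 1) _ _
  rw [h2] at h1
  have h3 : ψ.toOrderHom 0 = (0 : Fin 1) := Subsingleton.elim (α := Fin 1) _ _
  rw [h3] at h1
  interval_cases i <;> interval_cases j <;> first | rfl | exact absurd h1 (by decide +revert)

/-- A non-injective map out of `[m + 1]` factors through a codegeneracy. -/
lemma exists_cd_comp_eq {l : SimplexCategory} {m : ℕ} (θ : ⦋m + 1⦌ ⟶ l) (h : ¬ Mono θ) :
    ∃ i < m + 1, ∃ θ' : ⦋m⦌ ⟶ l, θ = cd m i ≫ θ' := by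
  rw [SimplexCategory.mono_iff_injective] at h
  obtain ⟨i, θ', hθ⟩ := eq_σ_comp_of_not_injective θ h
  exact ⟨i, i.2, θ', by rw [← σ_eq_cd, hθ]⟩

/-- A map which factors through two distinct codegeneracies factors through an iterated one. -/
lemma exists_of_cd_comp_eq {l : SimplexCategory} {m i j : ℕ} (hij : i < j) (hj : j < m + 2)
    {φ ψ : ⦋m + 1⦌ ⟶ l} (h : cd (m + 1) i ≫ φ = cd (m + 1) j ≫ ψ) :
    ∃ χ : ⦋m⦌ ⟶ l, φ = cd m (j - 1) ≫ χ ∧ ψ = cd m i ≫ χ := by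
  have hφ : φ = cd m (j - 1) ≫ cf m i ≫ ψ := by
    have := congrArg (fun f => cf (m + 1) i ≫ f) h
    simp only [← Category.assoc] at this
    rwa [cf_comp_cd_self (by lia), Category.id_comp, cf_comp_cd_of_lt hij hj,
      Category.assoc] at this
  have hψ : ψ = cd m i ≫ cf m j ≫ φ := by
    have := congrArg (fun f => cf (m + 1) (j + 1) ≫ f) h
    simp only [← Category.assoc] at this
    rwa [cf_succ_comp_cd hj, Category.id_comp, cf_comp_cd_of_gt hij hj, Category.assoc,
      eq_comm] at this
  refine ⟨cf m i ≫ ψ, hφ, ?_⟩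
  rw [hψ, reassoc_of% cf_comp_cd_self (m := m) (i := i) (by lia)]

/-- A map which is not surjective factors through a coface. -/
lemma exists_comp_cf_eq {l : SimplexCategory} {m : ℕ} (θ : l ⟶ ⦋m + 1⦌) (h : ¬ Epi θ) :
    ∃ i < m + 2, ∃ θ' : l ⟶ ⦋m⦌, θ = θ' ≫ cf m i := by
  rw [SimplexCategory.epi_iff_surjective] at h
  obtain ⟨i, θ', hθ⟩ := eq_comp_δ_of_not_surjective θ h
  exact ⟨i, i.2, θ', by rw [← δ_eq_cf, hθ]⟩

end Simplex

/-! ### Systems of sets with face operators -/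

section Filler

universe w₁ w₂

variable {S : ℕ → Type w₁} {L : ℕ → Type w₂}

/-- The condition on elements `z 0, …, z (k - 1)` of `S n` to be the first faces of an element of
`S (n + 1)` which is forced by the simplicial identities. -/
def IsCompatible (d : ∀ n, ℕ → S (n + 1) → S n) (n : ℕ) (z : ℕ → S n)
    (k : ℕ) : Prop :=
  match n, z with
  | 0, _ => True
  | n + 1, z => ∀ i j, i < j → j < k → d n i (z j) = d n (j - 1) (z i)

/-- Let `q : S ⟶ L` be a map of systems of sets with face operators subject to the simplicial
identities, where the elements of `S (n + 1)` have `n + c` faces. If all complete boundaries can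
be filled relative to `q`, then so can all initial parts of boundaries: the missing faces are
constructed one after another, by induction on the degree. Apart from the maps into an object out
of a cosimplicial object, this applies to the maps from an object into a cosimplicial object,
whose codegeneracies obey the same identities. -/
lemma exists_partial_filler (c : ℕ) (d : ∀ n, ℕ → S (n + 1) → S n)
    (d' : ∀ n, ℕ → L (n + 1) → L n) (q : ∀ n, S n → L n)
    (hd : ∀ n i j x, i < j → j < n + 1 + c →
      d n i (d (n + 1) j x) = d n (j - 1) (d (n + 1) i x))
    (hd' : ∀ n i j x, i < j → j < n + 1 + c →
      d' n i (d' (n + 1) j x) = d' n (j - 1) (d' (n + 1) i x))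
    (hq : ∀ n i x, q n (d n i x) = d' n i (q (n + 1) x))
    (h0 : Function.Surjective (q 0)) (m : ℕ)
    (hF : ∀ n ≤ m, ∀ (z : ℕ → S n) (l : L (n + 1)), IsCompatible d n z (n + c) →
      (∀ i < n + c, q n (z i) = d' n i l) →
        ∃ y : S (n + 1), (∀ i < n + c, d n i y = z i) ∧ q (n + 1) y = l) :
    ∀ k ≤ m + c, ∀ (z : ℕ → S m) (l : L (m + 1)), IsCompatible d m z k →
      (∀ i < k, q m (z i) = d' m i l) →
        ∃ y : S (m + 1), (∀ i < k, d m i y = z i) ∧ q (m + 1) y = l := by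
  induction m with
  | zero =>
    intro k hk
    induction hk using Nat.decreasingInduction with
    | self => exact hF 0 le_rfl
    | of_succ k hk ih =>
      intro z l hz hl
      obtain ⟨a, ha⟩ := h0 (d' 0 k l)
      obtain ⟨y, hy, hy'⟩ := ih (Function.update z k a) l trivial (fun i hi => by
        rcases eq_or_ne i k with rfl | hik
        · simpa using ha
        · rw [Function.update_of_ne hik]; exact hl i (by lia))
      exact ⟨y, fun i hi => by rw [hy i (by lia), Function.update_of_ne (by lia)], hy'⟩
  | succ m ihm =>
    intro k hk
    induction hk using Nat.decreasingInduction with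
    | self => exact hF _ le_rfl
    | of_succ k hk ih =>
      intro z l hz hl
      obtain ⟨a, ha, ha'⟩ := ihm (fun n hn => hF n (by lia)) k (by lia)
        (fun i => d m (k - 1) (z i)) (d' (m + 1) k l) (by
          cases m with
          | zero => trivial
          | succ m =>
            intro i j hij hj
            rw [hd _ _ _ _ (by lia) (by lia), hz i j hij hj,
              hd m (j - 1) (k - 1) _ (by lia) (by lia)])
        (fun i hi => by rw [hq, hl i hi, hd' _ _ _ _ hi (by lia)])
      obtain ⟨y, hy, hy'⟩ := ih (Function.update z k a) l
        (fun i j hij hj => by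
          rcases eq_or_ne j k with rfl | hjk
          · rw [Function.update_self, Function.update_of_ne (by lia), ha i hij]
          · rw [Function.update_of_ne hjk, Function.update_of_ne (by lia)]
            exact hz i j hij (by lia))
        (fun i hi => by
          rcases eq_or_ne i k with rfl | hik
          · simpa using ha'
          · rw [Function.update_of_ne hik]; exact hl i (by lia))
      exact ⟨y, fun i hi => by rw [hy i (by lia), Function.update_of_ne (by lia)], hy'⟩

end Filler

/-! ### Reedy cofibrations through lifting properties -/

section Compatible

variable {C : Type u} [Category.{v} C]

/-- The action of the cofaces of `X` on the maps from `X` to an object `E`. -/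
abbrev faceAct (X : CosimplicialObject C) (E : C) (n i : ℕ) (y : X.obj ⦋n + 1⦌ ⟶ E) :
    X.obj ⦋n⦌ ⟶ E := X.map (cf n i) ≫ y

/-- Maps `z 0, …, z (k - 1)` which agree where the simplicial identities require it. -/
abbrev CompatibleFaces (X : CosimplicialObject C) {E : C} (m : ℕ) (z : ℕ → (X.obj ⦋m⦌ ⟶ E))
    (k : ℕ) : Prop :=
  IsCompatible (S := fun n => X.obj ⦋n⦌ ⟶ E) (faceAct X E) m z k

variable {X : CosimplicialObject C} {E : C}

lemma app_naturality {X Y : CosimplicialObject C} (f : X ⟶ Y) {a b : SimplexCategory}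
    (φ : a ⟶ b) : f.app a ≫ Y.map φ = X.map φ ≫ f.app b :=
  (f.naturality φ).symm

lemma faceAct_faceAct {n i j : ℕ} (hij : i < j) (hj : j < n + 3) (y : X.obj ⦋n + 2⦌ ⟶ E) :
    faceAct X E n i (faceAct X E (n + 1) j y) =
      faceAct X E n (j - 1) (faceAct X E (n + 1) i y) := by
  simp only [faceAct, ← Category.assoc, ← X.map_comp, cf_comp_cf hij hj]

/-- Compatible faces agree on all simplices which are faces of the standard simplex in several
ways. -/
lemma CompatibleFaces.map_comp_eq {m : ℕ} {z : ℕ → (X.obj ⦋m⦌ ⟶ E)}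
    (hz : CompatibleFaces X m z (m + 2)) {l : SimplexCategory} {i j : ℕ} (hi : i < m + 2)
    (hj : j < m + 2) {φ ψ : l ⟶ ⦋m⦌} (h : φ ≫ cf m i = ψ ≫ cf m j) :
    X.map φ ≫ z i = X.map ψ ≫ z j := by
  wlog hij : i ≤ j generalizing i j φ ψ
  · exact (this hj hi h.symm (by lia)).symm
  rcases hij.eq_or_lt with rfl | hij
  · rw [(cancel_mono _).1 h]
  cases m with
  | zero => exact absurd (eq_of_comp_cf_eq_zero hi hj h) hij.ne
  | succ m =>
    obtain ⟨χ, rfl, rfl⟩ := exists_of_comp_cf_eq hij hj h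
    have := hz i j hij hj
    simp only [X.map_comp, Category.assoc]
    exact congrArg (X.map χ ≫ ·) this.symm

end Compatible

section RelReedy

variable {M : Type u} [Category.{v} M] [ModelCategory M]

/-- Reedy cofibrations `X ⟶ Z`, expressed by lifting properties of the maps from `Z` to an object:
the relative latching maps, whose construction is avoided in this way, are cofibrations. -/
structure IsReedyCofibration {X Z : CosimplicialObject M} (f : X ⟶ Z) : Prop where
  zero : Cofibration (f.app ⦋0⦌)
  exists_filler : ∀ (m : ℕ) {E B : M} (p : E ⟶ B) [Fibration p] [WeakEquivalence p]
    (z : ℕ → (Z.obj ⦋m⦌ ⟶ E)) (x : X.obj ⦋m + 1⦌ ⟶ E) (b : Z.obj ⦋m + 1⦌ ⟶ B),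
    CompatibleFaces Z m z (m + 2) → (∀ i < m + 2, f.app ⦋m⦌ ≫ z i = X.map (cf m i) ≫ x) →
    (∀ i < m + 2, z i ≫ p = Z.map (cf m i) ≫ b) → x ≫ p = f.app ⦋m + 1⦌ ≫ b →
    ∃ y : Z.obj ⦋m + 1⦌ ⟶ E, (∀ i < m + 2, Z.map (cf m i) ≫ y = z i) ∧
      f.app ⦋m + 1⦌ ≫ y = x ∧ y ≫ p = b

lemma cofibration_of_lift {A B : M} (i : A ⟶ B)
    (h : ∀ {E F : M} (p : E ⟶ F) [Fibration p] [WeakEquivalence p] (a : A ⟶ E) (b : B ⟶ F),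
      a ≫ p = i ≫ b → ∃ y : B ⟶ E, i ≫ y = a ∧ y ≫ p = b) : Cofibration i := by
  rw [cofibration_iff, ← trivialFibrations_llp]
  intro E F p hp
  rw [mem_trivialFibrations_iff] at hp
  have := hp.1
  have := hp.2
  constructor
  intro a b sq
  obtain ⟨y, hy, hy'⟩ := h p a b sq.w
  exact ⟨⟨⟨y, hy, hy'⟩⟩⟩

lemma exists_lift_of_comm {A B E F : M} (i : A ⟶ B) (p : E ⟶ F) [Cofibration i] [Fibration p]
    [WeakEquivalence p] {a : A ⟶ E} {b : B ⟶ F} (w : a ≫ p = i ≫ b) :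
    ∃ y : B ⟶ E, i ≫ y = a ∧ y ≫ p = b := by
  have sq : CommSq a i p b := ⟨w⟩
  exact ⟨sq.lift, sq.fac_left, sq.fac_right⟩

/-- For Reedy cofibrations, initial parts of boundaries can be filled as well. -/
lemma IsReedyCofibration.exists_partial_filler {X Z : CosimplicialObject M} {f : X ⟶ Z}
    (hf : IsReedyCofibration f) (m k : ℕ) (hk : k ≤ m + 2) {E B : M} (p : E ⟶ B) [Fibration p]
    [WeakEquivalence p] (z : ℕ → (Z.obj ⦋m⦌ ⟶ E)) (x : X.obj ⦋m + 1⦌ ⟶ E)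
    (b : Z.obj ⦋m + 1⦌ ⟶ B) (hz : CompatibleFaces Z m z k)
    (hx : ∀ i < k, f.app ⦋m⦌ ≫ z i = X.map (cf m i) ≫ x)
    (hb : ∀ i < k, z i ≫ p = Z.map (cf m i) ≫ b) (hxb : x ≫ p = f.app ⦋m + 1⦌ ≫ b) :
    ∃ y : Z.obj ⦋m + 1⦌ ⟶ E, (∀ i < k, Z.map (cf m i) ≫ y = z i) ∧
      f.app ⦋m + 1⦌ ≫ y = x ∧ y ≫ p = b := by
  let L (n : ℕ) := {l : (X.obj ⦋n⦌ ⟶ E) × (Z.obj ⦋n⦌ ⟶ B) // l.1 ≫ p = f.app ⦋n⦌ ≫ l.2}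
  let d' (n i : ℕ) (l : L (n + 1)) : L n :=
    ⟨⟨faceAct X E n i l.1.1, faceAct Z B n i l.1.2⟩, by
      simp [faceAct, l.2, reassoc_of% app_naturality]⟩
  let q (n : ℕ) (y : Z.obj ⦋n⦌ ⟶ E) : L n := ⟨⟨f.app _ ≫ y, y ≫ p⟩, by simp⟩
  have hL {n : ℕ} {l l' : L n} (h1 : l.1.1 = l'.1.1) (h2 : l.1.2 = l'.1.2) : l = l' :=
    Subtype.ext (Prod.ext h1 h2)
  obtain ⟨y, hy, hy'⟩ := TruncatedResolution.exists_partial_filler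
    (S := fun n => Z.obj ⦋n⦌ ⟶ E) (L := L) 2 (faceAct Z E) d' q
    (fun n i j x hij hj => faceAct_faceAct hij (by lia) x)
    (fun n i j x hij hj => hL (faceAct_faceAct hij (by lia) _) (faceAct_faceAct hij (by lia) _))
    (fun n i x => hL (by simp [q, d', faceAct, reassoc_of% app_naturality])
      (by simp [q, d', faceAct]))
    (fun l => by
      have := hf.zero
      obtain ⟨y, hy, hy'⟩ := exists_lift_of_comm (f.app ⦋0⦌) p l.2
      exact ⟨y, hL hy hy'⟩) m
    (fun n hn z l hz hl => by
      obtain ⟨y, hy, hy', hy''⟩ := hf.exists_filler n p z l.1.1 l.1.2 hz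
        (fun i hi => congrArg (fun l : L _ => l.1.1) (hl i hi))
        (fun i hi => congrArg (fun l : L _ => l.1.2) (hl i hi)) l.2
      exact ⟨y, hy, hL hy' hy''⟩)
    k hk z ⟨⟨x, b⟩, hxb⟩ hz (fun i hi => hL (hx i hi) (hb i hi))
  exact ⟨y, hy, congrArg (fun l : L _ => l.1.1) hy', congrArg (fun l : L _ => l.1.2) hy'⟩

end RelReedy

section Reedy

open scoped ZeroObject

variable {M : Type u} [Category.{v} M] [ModelCategory M]

/-- The structure map `X^l ⟶ L^s X` of the latching object which belongs to `[l] ⟶ [s]`. -/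
def toLatching (X : CosimplicialObject M) {s : ℕ} {l : SimplexCategory} (φ : l ⟶ ⦋s⦌)
    (h : Mono φ ∧ ¬ IsIso φ) : X.obj l ⟶ latchingObj X s :=
  colimit.ι (latchingDiagram X s) ⟨Over.mk φ, h⟩

lemma toLatching_latchingMap (X : CosimplicialObject M) {s : ℕ} {l : SimplexCategory}
    (φ : l ⟶ ⦋s⦌) (h : Mono φ ∧ ¬ IsIso φ) : toLatching X φ h ≫ latchingMap X s = X.map φ :=
  colimit.ι_desc _ _

lemma map_toLatching (X : CosimplicialObject M) {s : ℕ} {l m : SimplexCategory}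
    (φ : l ⟶ m) (ψ : m ⟶ ⦋s⦌) (h : Mono ψ ∧ ¬ IsIso ψ) (h' : Mono (φ ≫ ψ) ∧ ¬ IsIso (φ ≫ ψ)) :
    X.map φ ≫ toLatching X ψ h = toLatching X (φ ≫ ψ) h' :=
  colimit.w (latchingDiagram X s) (j' := ⟨Over.mk (φ ≫ ψ), h'⟩) (j := ⟨Over.mk ψ, h⟩)
    (ObjectProperty.homMk (Over.homMk φ))

lemma latchingObj_hom_ext {X : CosimplicialObject M} {s : ℕ} {E : M} {f g : latchingObj X s ⟶ E}
    (H : ∀ (l : SimplexCategory) (φ : l ⟶ ⦋s⦌) (h : Mono φ ∧ ¬ IsIso φ),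
      toLatching X φ h ≫ f = toLatching X φ h ≫ g) : f = g :=
  colimit.hom_ext (fun j => H _ j.obj.hom j.property)

lemma exists_latchingDesc {X : CosimplicialObject M} {s : ℕ} {E : M}
    (a : ∀ (l : SimplexCategory) (φ : l ⟶ ⦋s⦌), Mono φ ∧ ¬ IsIso φ → (X.obj l ⟶ E))
    (ha : ∀ (l m : SimplexCategory) (φ : l ⟶ m) (ψ : m ⟶ ⦋s⦌) (h : Mono ψ ∧ ¬ IsIso ψ)
      (h' : Mono (φ ≫ ψ) ∧ ¬ IsIso (φ ≫ ψ)), X.map φ ≫ a m ψ h = a l (φ ≫ ψ) h') :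
    ∃ t : latchingObj X s ⟶ E, ∀ (l : SimplexCategory) (φ : l ⟶ ⦋s⦌) (h : Mono φ ∧ ¬ IsIso φ),
      toLatching X φ h ≫ t = a l φ h :=
  ⟨colimit.desc (latchingDiagram X s)
    { pt := E
      ι :=
        { app := fun φ => a _ φ.obj.hom φ.property
          naturality := fun φ ψ f => by
            have w : f.hom.left ≫ ψ.obj.hom = φ.obj.hom := Over.w f.hom
            have := ha _ _ f.hom.left ψ.obj.hom ψ.property (by rw [w]; exact φ.property)
            refine this.trans ?_
            simp only [w]
            exact (Category.comp_id _).symm } },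
    fun l φ h => colimit.ι_desc _ _⟩

lemma mono_and_not_isIso_cf (m i : ℕ) : Mono (cf m i) ∧ ¬ IsIso (cf m i) :=
  ⟨inferInstance, fun _ => by
    have := SimplexCategory.len_le_of_epi (cf m i)
    simp at this⟩

lemma mono_and_not_isIso_comp {l : SimplexCategory} {m : ℕ} (φ : l ⟶ ⦋m⦌) [Mono φ] (i : ℕ) :
    Mono (φ ≫ cf m i) ∧ ¬ IsIso (φ ≫ cf m i) :=
  ⟨mono_comp _ _, fun _ => by
    have h1 := SimplexCategory.len_le_of_epi (φ ≫ cf m i)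
    have h2 := SimplexCategory.len_le_of_mono φ
    simp at h1 h2
    lia⟩

lemma exists_comp_cf_of_mono {l : SimplexCategory} {m : ℕ} (φ : l ⟶ ⦋m + 1⦌)
    (h : Mono φ ∧ ¬ IsIso φ) :
    ∃ i < m + 2, ∃ θ : l ⟶ ⦋m⦌, Mono θ ∧ φ = θ ≫ cf m i := by
  have := h.1
  obtain ⟨i, hi, θ, rfl⟩ := exists_comp_cf_eq φ (fun _ => h.2 (isIso_of_mono_of_epi φ))
  exact ⟨i, hi, θ, mono_of_mono θ (cf m i), rfl⟩

lemma not_mono_and_not_isIso_zero {l : SimplexCategory} (φ : l ⟶ ⦋0⦌) :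
    ¬ (Mono φ ∧ ¬ IsIso φ) := by
  rintro ⟨_, h⟩
  have h1 := SimplexCategory.len_le_of_mono φ
  exact h (SimplexCategory.isIso_of_bijective
    ⟨(SimplexCategory.mono_iff_injective).1 inferInstance, fun x =>
      ⟨0, Subsingleton.elim (α := Fin 1) _ _⟩⟩)

variable [HasZeroObject M] [HasZeroMorphisms M]

/-- The map from the constant cosimplicial object at the zero object. -/
def fromZero (X : CosimplicialObject M) :
    ((Functor.const SimplexCategory).obj (0 : M) : CosimplicialObject M) ⟶ X where
  app _ := 0

/-- The latching object of `X` at `[m + 1]` represents the compatible families of maps out of the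
`m + 2` faces, since each non-surjective map to `[m + 1]` factors through a coface, uniquely up to
the simplicial identities. -/
theorem isReedyCofibrant_iff (X : CosimplicialObject M) :
    IsReedyCofibrant X ↔ IsReedyCofibration (fromZero X) := by
  constructor
  · intro h
    have hz {E : M} (x y : 0 ⟶ E) : x = y := (isZero_zero M).eq_of_src _ _
    refine ⟨?_, fun m E B p _ _ z x b hz' _ hb _ => ?_⟩
    · have := h 0
      refine cofibration_of_lift _ (fun p _ _ a b w => ?_)
      obtain ⟨t, ht⟩ := exists_latchingDesc (X := X) (s := 0)
        (fun l φ h => (not_mono_and_not_isIso_zero φ h).elim)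
        (fun l m φ ψ h => (not_mono_and_not_isIso_zero ψ h).elim)
      obtain ⟨y, -, hy⟩ := exists_lift_of_comm (latchingMap X 0) p (a := t) (b := b)
        (latchingObj_hom_ext (fun l φ h => (not_mono_and_not_isIso_zero φ h).elim))
      exact ⟨y, hz _ _, hy⟩
    · have := h (m + 1)
      choose i hi θ hθ hφ using fun (l : SimplexCategory) (φ : l ⟶ ⦋m + 1⦌)
        (h : Mono φ ∧ ¬ IsIso φ) => exists_comp_cf_of_mono φ h
      obtain ⟨t, ht⟩ := exists_latchingDesc (X := X) (fun l φ h => X.map (θ l φ h) ≫ z (i l φ h))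
        (fun l m φ ψ h h' => by
          rw [← Category.assoc, ← X.map_comp]
          refine hz'.map_comp_eq (hi _ _ _) (hi _ _ _) ?_
          rw [← hφ, Category.assoc, ← hφ])
      obtain ⟨y, hy, hy'⟩ := exists_lift_of_comm (latchingMap X (m + 1)) p (a := t) (b := b)
        (latchingObj_hom_ext (fun l φ h => by
          rw [reassoc_of% ht, reassoc_of% toLatching_latchingMap, hb _ (hi _ _ _), ← Category.assoc,
            ← X.map_comp, ← hφ]))
      refine ⟨y, fun j hj => ?_, hz _ _, hy'⟩
      rw [← toLatching_latchingMap X (cf m j) (mono_and_not_isIso_cf m j), Category.assoc, hy, ht]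
      refine (hz'.map_comp_eq (hi _ _ _) hj (ψ := 𝟙 _) ?_).trans ?_
      · rw [← hφ, Category.id_comp]
      · rw [X.map_id, Category.id_comp]
  · rintro h (_ | m)
    · refine cofibration_of_lift _ (fun p _ _ a b w => ?_)
      have := h.zero
      obtain ⟨y, -, hy⟩ := exists_lift_of_comm ((fromZero X).app ⦋0⦌) p (a := 0) (b := b)
        ((isZero_zero M).eq_of_src _ _)
      exact ⟨y, latchingObj_hom_ext (fun l φ h => (not_mono_and_not_isIso_zero φ h).elim), hy⟩
    · refine cofibration_of_lift _ (fun p _ _ a b w => ?_)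
      obtain ⟨y, hy, -, hy'⟩ := h.exists_filler m p
        (fun i => toLatching X (cf m i) (mono_and_not_isIso_cf m i) ≫ a) 0 b
        (by
          cases m with
          | zero => trivial
          | succ m =>
            intro i j hij hj
            simp only [faceAct, ← Category.assoc]
            rw [map_toLatching _ _ _ _ (mono_and_not_isIso_comp _ _),
              map_toLatching _ _ _ _ (mono_and_not_isIso_comp _ _)]
            simp only [cf_comp_cf hij hj])
        (fun i _ => (isZero_zero M).eq_of_src _ _)
        (fun i hi => by rw [Category.assoc, w, reassoc_of% toLatching_latchingMap])
        ((isZero_zero M).eq_of_src _ _)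
      refine ⟨y, latchingObj_hom_ext (fun l φ h => ?_), hy'⟩
      obtain ⟨i, hi, θ, hθ, rfl⟩ := exists_comp_cf_of_mono φ h
      rw [reassoc_of% toLatching_latchingMap, X.map_comp, Category.assoc, hy i hi,
        reassoc_of% map_toLatching]

end Reedy

/-! ### Quotients of a cosimplicial object by its first cofaces -/

section Quotient

open scoped ZeroObject

variable {M : Type u} [Category.{v} M] [HasZeroMorphisms M]

/-- A map out of `X^m` vanishes on the cofaces with numbers less than `k`. There are no cofaces
if `m = 0`. -/
def KillsFaces (X : CosimplicialObject M) (m k : ℕ) {E : M} (t : X.obj ⦋m⦌ ⟶ E) : Prop :=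
  match m, t with
  | 0, _ => True
  | m + 1, t => ∀ i < k, X.map (cf m i) ≫ t = 0

section

variable {X Y : CosimplicialObject M} {E F : M}

lemma KillsFaces.comp {m k : ℕ} {t : X.obj ⦋m⦌ ⟶ E} (h : KillsFaces X m k t) (g : E ⟶ F) :
    KillsFaces X m k (t ≫ g) := by
  cases m with
  | zero => trivial
  | succ m => intro i hi; rw [reassoc_of% (h i hi), zero_comp]

lemma KillsFaces.precomp {m k : ℕ} {t : Y.obj ⦋m⦌ ⟶ E} (h : KillsFaces Y m k t) (f : X ⟶ Y) :
    KillsFaces X m k (f.app ⦋m⦌ ≫ t) := by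
  cases m with
  | zero => trivial
  | succ m => intro i hi; rw [← reassoc_of% app_naturality, h i hi, comp_zero]

lemma KillsFaces.mono {m k k' : ℕ} (hk : k' ≤ k) {t : X.obj ⦋m⦌ ⟶ E} (h : KillsFaces X m k t) :
    KillsFaces X m k' t := by
  cases m with
  | zero => trivial
  | succ m => exact fun i hi => h i (by lia)

lemma KillsFaces.face {m k : ℕ} (hk : k ≤ m + 1) {t : X.obj ⦋m + 1⦌ ⟶ E}
    (h : KillsFaces X (m + 1) k t) : KillsFaces X m k (X.map (cf m k) ≫ t) := by
  cases m with
  | zero => trivial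
  | succ m =>
    intro i hi
    rw [← Category.assoc, ← X.map_comp, cf_comp_cf hi (by lia), X.map_comp, Category.assoc,
      h i hi, comp_zero]

lemma KillsFaces.degeneracy {m k : ℕ} (hk : k ≤ m) {t : X.obj ⦋m⦌ ⟶ E}
    (h : KillsFaces X m k t) : KillsFaces X (m + 1) k (X.map (cd m k) ≫ t) := by
  intro i hi
  obtain ⟨m, rfl⟩ := Nat.exists_eq_succ_of_ne_zero
    (Nat.ne_of_gt (Nat.zero_lt_of_lt (hi.trans_le hk)))
  rw [← Category.assoc, ← X.map_comp, cf_comp_cd_of_lt hi (by lia), X.map_comp, Category.assoc,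
    h i hi, comp_zero]

end

variable [ModelCategory M]

lemma exists_quotient (X : CosimplicialObject M) (m k : ℕ) :
    ∃ (Q : M) (q : X.obj ⦋m⦌ ⟶ Q), KillsFaces X m k q ∧
      ∀ {E : M} (t : X.obj ⦋m⦌ ⟶ E), KillsFaces X m k t → ∃! s : Q ⟶ E, q ≫ s = t := by
  cases m with
  | zero => exact ⟨_, 𝟙 _, trivial, fun t _ => ⟨t, Category.id_comp _, by simp⟩⟩
  | succ m =>
    let φ : (∐ fun _ : Fin k => X.obj ⦋m⦌) ⟶ X.obj ⦋m + 1⦌ :=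
      Sigma.desc (fun i : Fin k => X.map (cf m i))
    have hφ {E : M} (t : X.obj ⦋m + 1⦌ ⟶ E) : φ ≫ t = 0 ↔ KillsFaces X (m + 1) k t := by
      constructor
      · intro h i hi
        have := Sigma.ι (fun _ : Fin k => X.obj ⦋m⦌) ⟨i, hi⟩ ≫= h
        rw [comp_zero, Sigma.ι_desc_assoc] at this
        exact this
      · intro h
        refine Sigma.hom_ext _ _ (fun i => ?_)
        rw [Sigma.ι_desc_assoc, h i i.2, comp_zero]
    refine ⟨cokernel φ, cokernel.π φ, (hφ _).1 (cokernel.condition φ), fun t ht =>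
      ⟨cokernel.desc φ t ((hφ t).2 ht), cokernel.π_desc _ _ _, fun s hs => ?_⟩⟩
    rw [← cancel_epi (cokernel.π φ), cokernel.π_desc]
    exact hs

/-- The quotient of `X^m` by the cofaces with numbers less than `k`. -/
def Qt (X : CosimplicialObject M) (m k : ℕ) : M := (exists_quotient X m k).choose

/-- The projection `X^m ⟶ Qt X m k`. -/
def qπ (X : CosimplicialObject M) (m k : ℕ) : X.obj ⦋m⦌ ⟶ Qt X m k :=
  (exists_quotient X m k).choose_spec.choose

section

variable (X Y : CosimplicialObject M) {E : M}

lemma killsFaces_qπ (m k : ℕ) : KillsFaces X m k (qπ X m k) :=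
  (exists_quotient X m k).choose_spec.choose_spec.1

instance (m k : ℕ) : Epi (qπ X m k) where
  left_cancellation a b h := by
    obtain ⟨s, -, hs⟩ := (exists_quotient X m k).choose_spec.choose_spec.2 _
      ((killsFaces_qπ X m k).comp a)
    rw [hs a rfl, hs b h.symm]

variable {X} in
lemma KillsFaces.exists_desc {m k : ℕ} {t : X.obj ⦋m⦌ ⟶ E} (h : KillsFaces X m k t) :
    ∃ s, qπ X m k ≫ s = t :=
  ((exists_quotient X m k).choose_spec.choose_spec.2 t h).exists

variable {X} in
/-- The map induced on the quotient. -/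
def KillsFaces.desc {m k : ℕ} {t : X.obj ⦋m⦌ ⟶ E} (h : KillsFaces X m k t) : Qt X m k ⟶ E :=
  h.exists_desc.choose

variable {X} in
lemma KillsFaces.qπ_desc {m k : ℕ} {t : X.obj ⦋m⦌ ⟶ E} (h : KillsFaces X m k t) :
    qπ X m k ≫ h.desc = t :=
  h.exists_desc.choose_spec

/-- The map between quotients induced by the coface with number `k`. -/
def qδ (m k : ℕ) (hk : k ≤ m + 1) : Qt X m k ⟶ Qt X (m + 1) k :=
  ((killsFaces_qπ X (m + 1) k).face hk).desc

lemma qπ_qδ (m k : ℕ) (hk : k ≤ m + 1) :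
    qπ X m k ≫ qδ X m k hk = X.map (cf m k) ≫ qπ X (m + 1) k :=
  KillsFaces.qπ_desc _

/-- The map between quotients induced by the codegeneracy with number `k`. -/
def qσ (m k : ℕ) (hk : k ≤ m) : Qt X (m + 1) k ⟶ Qt X m k :=
  ((killsFaces_qπ X m k).degeneracy hk).desc

lemma qπ_qσ (m k : ℕ) (hk : k ≤ m) :
    qπ X (m + 1) k ≫ qσ X m k hk = X.map (cd m k) ≫ qπ X m k :=
  KillsFaces.qπ_desc _

lemma qδ_qσ (m k : ℕ) (hk : k ≤ m) : qδ X m k (by lia) ≫ qσ X m k hk = 𝟙 _ := by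
  rw [← cancel_epi (qπ X m k), reassoc_of% qπ_qδ, qπ_qσ, ← Category.assoc, ← X.map_comp,
    cf_comp_cd_self (by lia), X.map_id, Category.id_comp, Category.comp_id]

/-- The projection between quotients. -/
def qι (m k : ℕ) : Qt X m k ⟶ Qt X m (k + 1) :=
  ((killsFaces_qπ X m (k + 1)).mono (Nat.le_succ k)).desc

lemma qπ_qι (m k : ℕ) : qπ X m k ≫ qι X m k = qπ X m (k + 1) := KillsFaces.qπ_desc _

variable {X Y}

/-- The functoriality of the quotients. -/
def qmap (f : X ⟶ Y) (m k : ℕ) : Qt X m k ⟶ Qt Y m k :=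
  ((killsFaces_qπ Y m k).precomp f).desc

lemma qπ_qmap (f : X ⟶ Y) (m k : ℕ) : qπ X m k ≫ qmap f m k = f.app ⦋m⦌ ≫ qπ Y m k :=
  KillsFaces.qπ_desc _

lemma qδ_qmap (f : X ⟶ Y) (m k : ℕ) (hk : k ≤ m + 1) :
    qδ X m k hk ≫ qmap f (m + 1) k = qmap f m k ≫ qδ Y m k hk := by
  rw [← cancel_epi (qπ X m k), reassoc_of% qπ_qδ, qπ_qmap, reassoc_of% qπ_qmap, qπ_qδ,
    reassoc_of% app_naturality]

lemma qι_qmap (f : X ⟶ Y) (m k : ℕ) :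
    qι X m k ≫ qmap f m (k + 1) = qmap f m k ≫ qι Y m k := by
  rw [← cancel_epi (qπ X m k), reassoc_of% qπ_qι, qπ_qmap, reassoc_of% qπ_qmap, qπ_qι]

end

variable [HasZeroObject M] {X Y : CosimplicialObject M} (hX : IsReedyCofibration (fromZero X))
include hX

/-- The lifting property of a Reedy cofibrant object. -/
lemma exists_filler_of_cofibrant (m k : ℕ) (hk : k ≤ m + 2) {E B : M} (p : E ⟶ B) [Fibration p]
    [WeakEquivalence p] (z : ℕ → (X.obj ⦋m⦌ ⟶ E)) (b : X.obj ⦋m + 1⦌ ⟶ B)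
    (hz : CompatibleFaces X m z k) (hb : ∀ i < k, z i ≫ p = X.map (cf m i) ≫ b) :
    ∃ y : X.obj ⦋m + 1⦌ ⟶ E, (∀ i < k, X.map (cf m i) ≫ y = z i) ∧ y ≫ p = b := by
  obtain ⟨y, hy, -, hy'⟩ := hX.exists_partial_filler m k hk p z 0 b hz
    (fun i _ => (isZero_zero M).eq_of_src _ _) hb ((isZero_zero M).eq_of_src _ _)
  exact ⟨y, hy, hy'⟩

lemma isCofibrant_Qt (m k : ℕ) (hk : k ≤ m + 1) : IsCofibrant (Qt X m k) := by
  rw [isCofibrant_iff_of_isInitial (0 : (0 : M) ⟶ Qt X m k) HasZeroObject.zeroIsInitial]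
  refine cofibration_of_lift _ (fun {E F} p _ _ a b w => ?_)
  have : ∃ y : X.obj ⦋m⦌ ⟶ E, KillsFaces X m k y ∧ y ≫ p = qπ X m k ≫ b := by
    cases m with
    | zero =>
      have := hX.zero
      obtain ⟨y, -, hy⟩ := exists_lift_of_comm ((fromZero X).app ⦋0⦌) p (a := 0)
        (b := qπ X 0 k ≫ b) ((isZero_zero M).eq_of_src _ _)
      exact ⟨y, trivial, hy⟩
    | succ m =>
      exact exists_filler_of_cofibrant hX m k hk p (fun _ => 0) _ (by
        cases m with
        | zero => trivial
        | succ m => intro i j _ _; simp [faceAct])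
        (fun i hi => by
          rw [zero_comp, ← Category.assoc, killsFaces_qπ X (m + 1) k i hi, zero_comp])
  obtain ⟨y, hy, hy'⟩ := this
  refine ⟨hy.desc, (isZero_zero M).eq_of_src _ _, ?_⟩
  rw [← cancel_epi (qπ X m k), reassoc_of% hy.qπ_desc, hy']

lemma cofibration_qδ (m k : ℕ) (hk : k ≤ m + 1) : Cofibration (qδ X m k hk) := by
  refine cofibration_of_lift _ (fun {E F} p _ _ a b w => ?_)
  obtain ⟨y, hy, hy'⟩ := exists_filler_of_cofibrant hX m (k + 1) (by lia) p
    (fun i => if i = k then qπ X m k ≫ a else 0) (qπ X (m + 1) k ≫ b) (by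
      cases m with
      | zero => trivial
      | succ m =>
        intro i j hij hj
        beta_reduce
        rw [if_neg (by lia : i ≠ k)]
        split_ifs with h
        · subst h
          have := killsFaces_qπ X (m + 1) j i hij
          simp only [faceAct, reassoc_of% this, zero_comp, comp_zero]
        · simp [faceAct])
    (fun i hi => by
      split_ifs with h
      · subst h
        rw [Category.assoc, w, reassoc_of% qπ_qδ]
      · rw [zero_comp, ← Category.assoc, killsFaces_qπ X (m + 1) k i (by lia), zero_comp])
  have hk' : KillsFaces X (m + 1) k y := fun i hi => by
    rw [hy i (by lia), if_neg (by lia)]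
  refine ⟨hk'.desc, ?_, ?_⟩
  · rw [← cancel_epi (qπ X m k), reassoc_of% qπ_qδ, hk'.qπ_desc, hy k (by lia), if_pos rfl]
  · rw [← cancel_epi (qπ X (m + 1) k), reassoc_of% hk'.qπ_desc, hy']

lemma isCofiberSequence_qδ_qι (m k : ℕ) (hk : k ≤ m + 1) :
    IsCofiberSequence (qδ X m k hk) (qι X (m + 1) k) := by
  have := cofibration_qδ hX m k hk
  refine IsCofiberSequence.of_existsUnique ?_ (fun t ht => ?_)
  · rw [← cancel_epi (qπ X m k), reassoc_of% qπ_qδ, qπ_qι,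
      killsFaces_qπ X (m + 1) (k + 1) k (by lia), comp_zero]
  · have h : KillsFaces X (m + 1) (k + 1) (qπ X (m + 1) k ≫ t) := by
      intro i hi
      rcases (Nat.lt_succ_iff_lt_or_eq.1 hi) with hi | rfl
      · rw [← Category.assoc, killsFaces_qπ X (m + 1) k i hi, zero_comp]
      · rw [← reassoc_of% qπ_qδ X m i hk, ht, comp_zero]
    refine ⟨h.desc, ?_, fun s hs => ?_⟩
    · beta_reduce
      rw [← cancel_epi (qπ X (m + 1) k), reassoc_of% qπ_qι, h.qπ_desc]
    · rw [← cancel_epi (qπ X (m + 1) (k + 1)), h.qπ_desc, ← reassoc_of% qπ_qι, hs]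

/-- The tower of a Reedy cofibrant object: its objects in the degrees `s + 2` are the quotients
of `X^s` by all cofaces and by all but the last coface, respectively. -/
def tower : Tower M where
  Z k := match k with
    | 0 => 0
    | 1 => 0
    | s + 2 => Qt X s (s + 1)
  N k := match k with
    | 0 => 0
    | 1 => 0
    | s + 2 => Qt X s s
  isCofibrant_Z k := match k with
    | 0 => HoGroup.isCofibrant_zero
    | 1 => HoGroup.isCofibrant_zero
    | s + 2 => isCofibrant_Qt hX _ _ (by lia)
  isCofibrant_N k := match k with
    | 0 => HoGroup.isCofibrant_zero
    | 1 => HoGroup.isCofibrant_zero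
    | s + 2 => isCofibrant_Qt hX _ _ (by lia)
  ζ k := match k with
    | 0 => 0
    | 1 => 0
    | s + 2 => qδ X s (s + 1) (by lia)
  π k := match k with
    | 0 => 0
    | 1 => 0
    | s + 2 => qι X s s
  seq k := match k with
    | 0 => by
      have : Cofibration (0 : (0 : M) ⟶ 0) := by
        rw [(isZero_zero M).eq_of_src 0 (𝟙 _)]; infer_instance
      exact IsCofiberSequence.of_existsUnique (i := (0 : (0 : M) ⟶ 0)) (p := (0 : (0 : M) ⟶ 0))
        (by simp) (fun t ht => ⟨0, (isZero_zero M).eq_of_src _ _,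
          fun s _ => (isZero_zero M).eq_of_src _ _⟩)
    | 1 => by
      have := (isCofibrant_iff_of_isInitial (0 : (0 : M) ⟶ Qt X 0 0)
        HasZeroObject.zeroIsInitial).1 (isCofibrant_Qt hX 0 0 (by lia))
      refine IsCofiberSequence.of_existsUnique (i := (0 : (0 : M) ⟶ Qt X 0 0)) (p := qι X 0 0)
        (by simp) (fun t _ => ?_)
      have h : KillsFaces X 0 1 (qπ X 0 0 ≫ t) := trivial
      refine ⟨h.desc, ?_, fun s hs => ?_⟩
      · beta_reduce
        rw [← cancel_epi (qπ X 0 0), reassoc_of% qπ_qι, h.qπ_desc]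
      · rw [← cancel_epi (qπ X 0 1), h.qπ_desc, ← hs, reassoc_of% qπ_qι]
    | s + 2 => isCofiberSequence_qδ_qι hX _ _ _
  isZero_Z_zero := isZero_zero M
  isZero_Z_one := isZero_zero M

/-- The functoriality of the tower of a Reedy cofibrant object. -/
def towerMap (hY : IsReedyCofibration (fromZero Y)) (f : X ⟶ Y) :
    Tower.Hom (tower hX) (tower hY) where
  onZ k := match k with
    | 0 => 𝟙 _
    | 1 => 𝟙 _
    | s + 2 => qmap f s (s + 1)
  onN k := match k with
    | 0 => 𝟙 _
    | 1 => 𝟙 _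
    | s + 2 => qmap f s s
  comm_ζ k := match k with
    | 0 => (isZero_zero M).eq_of_src _ _
    | 1 => (isZero_zero M).eq_of_src _ _
    | s + 2 => qδ_qmap f s (s + 1) (by lia)
  comm_π k := match k with
    | 0 => (isZero_zero M).eq_of_src _ _
    | 1 => (isZero_zero M).eq_of_src _ _
    | s + 2 => qι_qmap f _ _

end Quotient

/-! ### Homotopy groups in terms of simplices -/

section SimplicialSet

variable {K L : SSet.{w}} {x : K _⦋0⦌} {y : L _⦋0⦌}

/-- The degenerate simplex at a vertex. -/
def basept (x : K _⦋0⦌) (n : ℕ) : K _⦋n⦌ := SSet.yonedaEquiv (SSet.const x : Δ[n] ⟶ K)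

lemma basept_eq (x : K _⦋0⦌) (n : ℕ) :
    basept x n = K.map (SimplexCategory.const ⦋n⦌ ⦋0⦌ 0).op x := by
  rw [← SSet.yonedaEquiv_const x, SSet.yonedaEquiv_naturality, SSet.comp_const,
    SSet.yonedaEquiv_const, basept]

/-- The simplex which underlies a pointed simplex. -/
def simplexOf {s : ℕ} (f : K.PtSimplex s x) : K _⦋s⦌ := SSet.yonedaEquiv f.map

/-- All faces of a simplex are constant. -/
def HasConstFaces (x : K _⦋0⦌) (s : ℕ) (a : K _⦋s⦌) : Prop :=
  match s, a with
  | 0, _ => True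
  | s + 1, a => ∀ i, K.δ i a = basept x s

lemma δ_yonedaEquiv {n : ℕ} (h : Δ[n + 1] ⟶ K) (i : Fin (n + 2)) :
    K.δ i (SSet.yonedaEquiv h) = SSet.yonedaEquiv (SSet.stdSimplex.δ i ≫ h) :=
  (SSet.stdSimplex.yonedaEquiv_δ_comp _ _).symm

lemma hasConstFaces_simplexOf {s : ℕ} (f : K.PtSimplex s x) :
    HasConstFaces x s (simplexOf f) := by
  cases s with
  | zero => trivial
  | succ s =>
    intro i
    rw [simplexOf, δ_yonedaEquiv, SSet.PtSimplex.δ_map, basept]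

lemma exists_simplexOf_eq {s : ℕ} {a : K _⦋s⦌} (h : HasConstFaces x s a) :
    ∃ f : K.PtSimplex s x, simplexOf f = a := by
  refine ⟨⟨SSet.yonedaEquiv.symm a, ?_⟩, SSet.yonedaEquiv.apply_symm_apply a⟩
  cases s with
  | zero => exact SSet.boundary.hom_ext₀
  | succ s =>
    refine SSet.boundary.hom_ext (fun i => ?_)
    have := h i
    rw [← SSet.yonedaEquiv.apply_symm_apply a, δ_yonedaEquiv] at this
    simp [SSet.yonedaEquiv.injective this]

lemma simplexOf_injective {s : ℕ} {f g : K.PtSimplex s x} (h : simplexOf f = simplexOf g) :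
    f = g :=
  SSet.RelativeMorphism.ext (SSet.yonedaEquiv.injective h)

lemma simplexOf_mapPtSimplex {s : ℕ} (φ : K ⟶ L) (h : φ.app _ x = y) (f : K.PtSimplex s x) :
    simplexOf (mapPtSimplex φ h f) = φ.app _ (simplexOf f) := by
  simp [simplexOf, mapPtSimplex, SSet.yonedaEquiv_comp]

lemma nonempty_relStruct_iff {s : ℕ} (f g : K.PtSimplex s x) :
    Nonempty (f.RelStruct g (Fin.last s)) ↔ ∃ H : K _⦋s + 1⦌,
      K.δ (Fin.last s).castSucc H = simplexOf f ∧ K.δ (Fin.last (s + 1)) H = simplexOf g ∧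
        ∀ i < (Fin.last s).castSucc, K.δ i H = basept x s := by
  constructor
  · rintro ⟨r⟩
    refine ⟨SSet.yonedaEquiv r.map, ?_, ?_, fun i hi => ?_⟩
    · rw [δ_yonedaEquiv, r.δ_castSucc_map, simplexOf]
    · rw [δ_yonedaEquiv, ← Fin.succ_last, r.δ_succ_map, simplexOf]
    · rw [δ_yonedaEquiv, r.δ_map_of_lt i hi, basept]
  · rintro ⟨H, h₁, h₂, h₃⟩
    rw [← SSet.yonedaEquiv.apply_symm_apply H] at h₁ h₂ h₃
    refine ⟨⟨SSet.yonedaEquiv.symm H, ?_, ?_, fun j hj => ?_, fun j hj => ?_⟩⟩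
    · rw [δ_yonedaEquiv] at h₁
      exact SSet.yonedaEquiv.injective h₁
    · rw [δ_yonedaEquiv] at h₂
      exact SSet.yonedaEquiv.injective h₂
    · have := h₃ j hj
      rw [δ_yonedaEquiv] at this
      exact SSet.yonedaEquiv.injective this
    · rw [Fin.succ_last] at hj
      exact absurd hj (Fin.le_last j).not_gt

/-- If the relation on pointed simplices is given by the cosets of a subgroup, then this relation
describes the equality in the homotopy group. -/
lemma homotopyGroup_mk_eq_iff {s : ℕ} {A : Type*} [Group A] (e : K.PtSimplex s x → A)
    (B : Subgroup A) (hB : ∀ f g : K.PtSimplex s x,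
      Nonempty (f.RelStruct g (Fin.last s)) ↔ e g * (e f)⁻¹ ∈ B) (f g : K.PtSimplex s x) :
    (Quot.mk _ f : homotopyGroup s K x) = Quot.mk _ g ↔ e g * (e f)⁻¹ ∈ B := by
  constructor
  · intro h
    have := Quot.eqvGen_exact h
    clear h
    induction this with
    | rel _ _ h => exact (hB _ _).1 h
    | refl _ => simp
    | symm _ _ _ ih => simpa using B.inv_mem ih
    | trans _ _ _ _ _ ih1 ih2 => simpa using B.mul_mem ih2 ih1
  · intro h
    exact Quot.sound ((hB _ _).2 h)

/-- If the homotopy groups are given by cosets of subgroups, then the bijectivity of the map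
between them can be tested in the groups. -/
lemma homotopyGroupMap_bijective_iff {s : ℕ} (φ : K ⟶ L) (h : φ.app _ x = y)
    {A A' : Type*} [Group A] [Group A'] (F : A →* A') (e : K.PtSimplex s x → A)
    (e' : L.PtSimplex s y → A') (hF : ∀ f, e' (mapPtSimplex φ h f) = F (e f))
    (B : Subgroup A) (B' : Subgroup A')
    (hB : ∀ f g : K.PtSimplex s x,
      Nonempty (f.RelStruct g (Fin.last s)) ↔ e g * (e f)⁻¹ ∈ B)
    (hB' : ∀ f g : L.PtSimplex s y,
      Nonempty (f.RelStruct g (Fin.last s)) ↔ e' g * (e' f)⁻¹ ∈ B')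
    (C : Subgroup A) (C' : Subgroup A') (hC : Set.range e = C) (hC' : Set.range e' = C') :
    Function.Bijective (homotopyGroupMap s φ h) ↔
      (∀ a ∈ C, F a ∈ B' → a ∈ B) ∧ ∀ a' ∈ C', ∃ b ∈ B', ∃ a ∈ C, a' = b * F a := by
  constructor
  · rintro ⟨hi, hs⟩
    refine ⟨fun a ha hb => ?_, fun a' ha' => ?_⟩
    · obtain ⟨f, rfl⟩ : a ∈ Set.range e := by rw [hC]; exact ha
      obtain ⟨g, hg⟩ : (1 : A) ∈ Set.range e := by rw [hC]; exact C.one_mem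
      have := (homotopyGroup_mk_eq_iff e B hB g f).1
        (hi ((homotopyGroup_mk_eq_iff e' B' hB' _ _).2 (by
        rw [hF, hF, hg]; simpa using hb)))
      simpa [hg] using this
    · obtain ⟨g, rfl⟩ : a' ∈ Set.range e' := by rw [hC']; exact ha'
      obtain ⟨⟨f⟩, hf⟩ := hs (Quot.mk _ g)
      have := (homotopyGroup_mk_eq_iff e' B' hB' _ _).1 hf
      rw [hF] at this
      exact ⟨_, this, e f, by rw [← SetLike.mem_coe, ← hC]; exact ⟨f, rfl⟩, by simp⟩
  · rintro ⟨hi, hs⟩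
    refine ⟨?_, ?_⟩
    · rintro ⟨f⟩ ⟨g⟩ hfg
      have := (homotopyGroup_mk_eq_iff e' B' hB' _ _).1 hfg
      rw [hF, hF, ← map_inv, ← map_mul] at this
      have hmem (f) : e f ∈ C := by rw [← SetLike.mem_coe, ← hC]; exact ⟨f, rfl⟩
      exact (homotopyGroup_mk_eq_iff e B hB f g).2
        (hi _ (C.mul_mem (hmem _) (C.inv_mem (hmem _))) this)
    · rintro ⟨g⟩
      obtain ⟨b, hb, a, ha, hab⟩ := hs (e' g) (by rw [← SetLike.mem_coe, ← hC']; exact ⟨g, rfl⟩)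
      obtain ⟨f, rfl⟩ : a ∈ Set.range e := by rw [hC]; exact ha
      exact ⟨Quot.mk _ f,
        (homotopyGroup_mk_eq_iff e' B' hB' _ _).2 (by rw [hF, hab]; simpa using hb)⟩

end SimplicialSet

/-! ### Natural homotopy groups as cosets -/

section Relation

open scoped ZeroObject

variable {M : Type u} [Category.{v} M] [ModelCategory M] [HasZeroObject M] [HasZeroMorphisms M]

/-- The projection of a split cofibre sequence induces injections on homotopy classes. -/
lemma Connecting.res_injective {G H : M} {𝔤 : HoGroup G} {𝔥 : HoGroup H} (c : Connecting 𝔤 𝔥)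
    {A B C : M} [IsCofibrant A] [IsCofibrant B] [IsCofibrant C] {i : A ⟶ B} {p : B ⟶ C}
    (h : IsCofiberSequence i p) (r : B ⟶ A) (hr : i ≫ r = 𝟙 A) :
    Function.Injective (𝔤.res p) := by
  rw [injective_iff_map_eq_one]
  intro y hy
  obtain ⟨t, rfl⟩ := (c.exact_target h y).1 hy
  rw [c.exact_source h]
  exact ⟨𝔥.res r t, by rw [𝔥.res_res, hr, 𝔥.res_id]⟩

/-- Given a cofibre sequence `A ⟶ N ⟶ Z` and an object `C` with two copies of `N` glued along
`A`, both of which are retracts of `C` by means of the same map, two maps `Z ⟶ G` extend over `C`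
if and only if the quotient of their classes comes from the cokernel `N'` of one of the copies. -/
lemma exists_extension_iff {G H : M} [IsFibrant G] {𝔤 : HoGroup G} {𝔥 : HoGroup H}
    (c : Connecting 𝔤 𝔥) {A N Z L C N' : M} [IsCofibrant A] [IsCofibrant N] [IsCofibrant Z]
    [IsCofibrant C] [IsCofibrant N'] {i : A ⟶ N} {q : N ⟶ Z} (h : IsCofiberSequence i q)
    {l₀ l₁ : N ⟶ L} (sq : IsPushout i i l₀ l₁) (κ : L ⟶ C) [Cofibration κ] (σ : C ⟶ N)
    (hσ₀ : l₀ ≫ κ ≫ σ = 𝟙 N) (hσ₁ : l₁ ≫ κ ≫ σ = 𝟙 N) {π : C ⟶ N'}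
    (h' : IsCofiberSequence (l₀ ≫ κ) π) {d : Z ⟶ N'} (hd : q ≫ d = (l₁ ≫ κ) ≫ π) (f g : Z ⟶ G) :
    (∃ t : C ⟶ G, (l₀ ≫ κ) ≫ t = q ≫ f ∧ (l₁ ≫ κ) ≫ t = q ≫ g) ↔
      𝔤.cls g * (𝔤.cls f)⁻¹ ∈ (𝔤.res d).range := by
  have hi := h.cofibration
  have hl₀ : Cofibration l₀ := by
    rw [cofibration_iff]
    exact MorphismProperty.of_isPushout sq hi.mem
  have hL : IsCofibrant L := isCofibrant_of_cofibration l₀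
  -- the two quotients of the double `L`, and its map to the coproduct
  obtain ⟨r₀, hr₀₀, hr₀₁⟩ : ∃ r : L ⟶ Z, l₀ ≫ r = q ∧ l₁ ≫ r = 0 :=
    ⟨sq.desc q 0 (by rw [h.w, comp_zero]), sq.inl_desc _ _ _, sq.inr_desc _ _ _⟩
  obtain ⟨r₁, hr₁₀, hr₁₁⟩ : ∃ r : L ⟶ Z, l₀ ≫ r = 0 ∧ l₁ ≫ r = q :=
    ⟨sq.desc 0 q (by rw [h.w, comp_zero]), sq.inl_desc _ _ _, sq.inr_desc _ _ _⟩
  obtain ⟨ω, hω₀, hω₁⟩ : ∃ ω : L ⟶ Z ⨿ Z, l₀ ≫ ω = q ≫ coprod.inl ∧ l₁ ≫ ω = q ≫ coprod.inr :=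
    ⟨sq.desc (q ≫ coprod.inl) (q ≫ coprod.inr) (by rw [reassoc_of% h.w, reassoc_of% h.w,
      zero_comp, zero_comp]), sq.inl_desc _ _ _, sq.inr_desc _ _ _⟩
  have hω₂ : ω ≫ coprod.desc (𝟙 Z) 0 = r₀ := sq.hom_ext
    (by rw [reassoc_of% hω₀, coprod.inl_desc, hr₀₀, Category.comp_id])
    (by rw [reassoc_of% hω₁, coprod.inr_desc, hr₀₁, comp_zero])
  have hω₃ : ω ≫ coprod.desc 0 (𝟙 Z) = r₁ := sq.hom_ext
    (by rw [reassoc_of% hω₀, coprod.inl_desc, hr₁₀, comp_zero])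
    (by rw [reassoc_of% hω₁, coprod.inr_desc, hr₁₁, Category.comp_id])
  have hcomm (x y : 𝔤.Cls Z) : Commute (𝔤.res r₀ x) (𝔤.res r₁ y) := by
    have := (𝔤.commute_coprod x y).map (𝔤.res ω)
    rwa [𝔤.res_res, 𝔤.res_res, hω₂, hω₃] at this
  have hdesc (a b : Z ⟶ G) (t : L ⟶ G) (h₀ : l₀ ≫ t = q ≫ a) (h₁ : l₁ ≫ t = q ≫ b) :
      𝔤.cls t = 𝔤.res r₀ (𝔤.cls a) * 𝔤.res r₁ (𝔤.cls b) := by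
    have : t = ω ≫ coprod.desc a b := sq.hom_ext
      (by rw [h₀, reassoc_of% hω₀, coprod.inl_desc])
      (by rw [h₁, reassoc_of% hω₁, coprod.inr_desc])
    rw [this, ← 𝔤.res_cls, 𝔤.cls_coprod_desc, map_mul, 𝔤.res_res, 𝔤.res_res, hω₂, hω₃]
  have hfold : 𝔤.res κ (𝔤.res σ (𝔤.res q (𝔤.cls f))) =
      𝔤.res r₀ (𝔤.cls f) * 𝔤.res r₁ (𝔤.cls f) := by
    rw [𝔤.res_cls, 𝔤.res_cls, 𝔤.res_cls]
    exact hdesc f f _ (by rw [reassoc_of% hσ₀]) (by rw [reassoc_of% hσ₁])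
  have hr₁ : IsCofiberSequence l₀ r₁ := .of_existsUnique hr₁₀ (fun t ht => by
    have hi' : i ≫ l₁ ≫ t = 0 := by rw [← reassoc_of% sq.w, ht, comp_zero]
    obtain ⟨s, hs⟩ := h.exists_desc (l₁ ≫ t) hi'
    refine ⟨s, sq.hom_ext (by rw [reassoc_of% hr₁₀, ht, zero_comp])
      (by rw [reassoc_of% hr₁₁, hs]), fun s' hs' => ?_⟩
    have := h.epi
    rw [← cancel_epi q, hs, ← hs', reassoc_of% hr₁₁])
  have hπ (x : 𝔤.Cls N') : 𝔤.res κ (𝔤.res π x) = 𝔤.res r₁ (𝔤.res d x) := by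
    refine 𝔤.res_comm (sq.hom_ext ?_ ?_) x
    · rw [← Category.assoc, h'.w, reassoc_of% hr₁₀, zero_comp]
    · rw [← Category.assoc, ← hd, reassoc_of% hr₁₁]
  constructor
  · rintro ⟨t, ht₀, ht₁⟩
    -- correct the class of `t` so that it vanishes on the first copy of `N`
    obtain ⟨x, hx⟩ := (h'.exact 𝔤 (𝔤.cls t * (𝔤.res σ (𝔤.res q (𝔤.cls f)))⁻¹)).1 (by
      rw [map_mul, map_inv, 𝔤.res_res (l₀ ≫ κ), Category.assoc, hσ₀, 𝔤.res_id, 𝔤.res_cls,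
        𝔤.res_cls, ht₀, mul_inv_cancel])
    refine ⟨x, c.res_injective hr₁ (κ ≫ σ) hσ₀ ?_⟩
    rw [← hπ, hx, map_mul, map_inv, hfold, 𝔤.res_cls,
      hdesc f g (κ ≫ t) (by rw [← Category.assoc, ht₀]) (by rw [← Category.assoc, ht₁]),
      map_mul, map_inv, mul_inv_rev, ← mul_assoc, mul_assoc (𝔤.res r₀ _), ← map_inv, ← map_mul,
      (hcomm _ _).eq, mul_inv_cancel_right]
  · rintro ⟨x, hx⟩
    obtain ⟨u, hu⟩ := 𝔤.cls_surjective (𝔤.res π x * 𝔤.res σ (𝔤.res q (𝔤.cls f)))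
    obtain ⟨t, ht⟩ := sq.exists_desc (q ≫ f) (q ≫ g)
      (by rw [reassoc_of% h.w, reassoc_of% h.w, zero_comp, zero_comp])
    obtain ⟨u', hu', -⟩ := 𝔤.exists_extension κ u t (by
      rw [← 𝔤.res_cls, hu, map_mul, hπ, hx, hfold, hdesc f g t ht.1 ht.2, map_mul, map_inv,
        (hcomm _ _).eq, mul_assoc, (hcomm _ _).eq, inv_mul_cancel_left])
    exact ⟨u', by rw [Category.assoc, hu', ht.1], by rw [Category.assoc, hu', ht.2]⟩

end Relation

section Natural

open scoped ZeroObject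

variable {M : Type u} [Category.{v} M] [HasZeroMorphisms M] {X Y : CosimplicialObject M} {G H : M}

lemma basept_homSSet (n : ℕ) :
    basept (K := homSSet X G) (0 : X.obj ⦋0⦌ ⟶ G) n = (0 : X.obj ⦋n⦌ ⟶ G) := by
  rw [basept_eq]
  exact comp_zero

/-- The map `X^s ⟶ G` which underlies a pointed simplex of `Hom(X, G)`. -/
def mapOf {s : ℕ} (f : (homSSet X G).PtSimplex s (0 : X.obj ⦋0⦌ ⟶ G)) : X.obj ⦋s⦌ ⟶ G :=
  simplexOf f

lemma hasConstFaces_homSSet_iff {s : ℕ} (a : X.obj ⦋s⦌ ⟶ G) :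
    HasConstFaces (K := homSSet X G) (0 : X.obj ⦋0⦌ ⟶ G) s a ↔ KillsFaces X s (s + 1) a := by
  cases s with
  | zero => rfl
  | succ s =>
    change (∀ i, X.map (SimplexCategory.δ i) ≫ a = basept (K := homSSet X G) _ _) ↔ _
    simp only [basept_homSSet, δ_eq_cf]
    exact ⟨fun h i hi => h ⟨i, hi⟩, fun h i => h i i.2⟩

lemma killsFaces_mapOf {s : ℕ} (f : (homSSet X G).PtSimplex s (0 : X.obj ⦋0⦌ ⟶ G)) :
    KillsFaces X s (s + 1) (mapOf f) :=
  (hasConstFaces_homSSet_iff _).1 (hasConstFaces_simplexOf f)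

lemma nonempty_relStruct_homSSet_iff {s : ℕ}
    (f g : (homSSet X G).PtSimplex s (0 : X.obj ⦋0⦌ ⟶ G)) :
    Nonempty (f.RelStruct g (Fin.last s)) ↔ ∃ t : X.obj ⦋s + 1⦌ ⟶ G,
      X.map (cf s s) ≫ t = mapOf f ∧ X.map (cf s (s + 1)) ≫ t = mapOf g ∧
        KillsFaces X (s + 1) s t := by
  rw [nonempty_relStruct_iff]
  refine exists_congr (fun (t : X.obj ⦋s + 1⦌ ⟶ G) => ?_)
  change (X.map (SimplexCategory.δ _) ≫ t = mapOf f ∧ X.map (SimplexCategory.δ _) ≫ t = mapOf g ∧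
    ∀ i < _, X.map (SimplexCategory.δ i) ≫ t = basept (K := homSSet X G) _ _) ↔ _
  simp only [basept_homSSet, δ_eq_cf]
  refine and_congr Iff.rfl (and_congr Iff.rfl ⟨fun h i hi => ?_, fun h i hi => h i ?_⟩)
  · exact h ⟨i, by lia⟩ hi
  · exact hi

lemma KillsFaces.lastFace {s : ℕ} {t : X.obj ⦋s + 1⦌ ⟶ G} (h : KillsFaces X (s + 1) s t) :
    KillsFaces X s s (X.map (cf s (s + 1)) ≫ t) := by
  cases s with
  | zero => trivial
  | succ s =>
    intro i hi
    rw [← Category.assoc, ← X.map_comp, cf_comp_cf (by lia) (by lia), X.map_comp,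
      Category.assoc, h i hi, comp_zero]

variable [ModelCategory M]

variable (X) in
/-- The map between quotients induced by the last coface, with number `s + 1`. -/
def qlast (s : ℕ) : Qt X s s ⟶ Qt X (s + 1) s := (killsFaces_qπ X (s + 1) s).lastFace.desc

variable (X) in
lemma qπ_qlast (s : ℕ) : qπ X s s ≫ qlast X s = X.map (cf s (s + 1)) ≫ qπ X (s + 1) s :=
  KillsFaces.qπ_desc _

variable (X) in
lemma qlast_qσ (s : ℕ) : qlast X s ≫ qσ X s s le_rfl = 𝟙 _ := by
  rw [← cancel_epi (qπ X s s), reassoc_of% qπ_qlast, qπ_qσ, ← Category.assoc, ← X.map_comp,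
    cf_succ_comp_cd (by lia), X.map_id, Category.id_comp, Category.comp_id]

variable (X) in
lemma qlast_qι (s : ℕ) :
    qι X s s ≫ qδ X s (s + 1) (by lia) = qlast X s ≫ qι X (s + 1) s := by
  rw [← cancel_epi (qπ X s s), reassoc_of% qπ_qι, qπ_qδ, reassoc_of% qπ_qlast, qπ_qι]

variable [HasZeroObject M]
variable (hX : IsReedyCofibration (fromZero X)) (hY : IsReedyCofibration (fromZero Y))

include hX in
/-- The previous term `A` of the tower, with the property that two maps out of `Qt X s s` which
agree on `A` are the last two faces of a potential map out of `X^{s + 1}`. -/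
lemma exists_previous (s : ℕ) : ∃ (A : M) (i : A ⟶ Qt X s s), IsCofibrant A ∧
    IsCofiberSequence i (qι X s s) ∧ i ≫ qδ X s s (by lia) = i ≫ qlast X s ∧
      ∀ {E : M} (u v : Qt X s s ⟶ E), i ≫ u = i ≫ v → CompatibleFaces X s
        (fun i => if i < s then 0 else if i = s then qπ X s s ≫ u else qπ X s s ≫ v) (s + 2) := by
  refine ⟨_, _, (tower hX).isCofibrant_Z (s + 1), (tower hX).seq (s + 1), ?_, ?_⟩
  · cases s with
    | zero => exact (isZero_zero M).eq_of_src _ _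
    | succ s =>
      change qδ X s (s + 1) (by lia) ≫ _ = qδ X s (s + 1) (by lia) ≫ _
      rw [← cancel_epi (qπ X s (s + 1)), reassoc_of% qπ_qδ, reassoc_of% qπ_qδ, qπ_qδ,
        qπ_qlast, ← Category.assoc, ← Category.assoc, ← X.map_comp, ← X.map_comp,
        cf_comp_cf (i := s + 1) (j := s + 1 + 1) (by lia) (by lia), Nat.add_sub_cancel]
  · intro E u v w
    cases s with
    | zero => trivial
    | succ s =>
      have w' : qδ X s (s + 1) (by lia) ≫ u = qδ X s (s + 1) (by lia) ≫ v := w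
      intro i j hij hj
      have h0 (i : ℕ) (hi : i < s + 1) {T : M} (t : Qt X (s + 1) (s + 1) ⟶ T) :
          X.map (cf s i) ≫ qπ X (s + 1) (s + 1) ≫ t = 0 := by
        rw [← Category.assoc, killsFaces_qπ X (s + 1) (s + 1) i hi, zero_comp]
      rcases Nat.lt_trichotomy j (s + 1) with h | rfl | h
      · simp [faceAct, h, hij.trans h]
      · simp [faceAct, hij, h0 i hij]
      · obtain rfl : j = s + 2 := by lia
        rcases Nat.lt_or_ge i (s + 1) with hi | hi
        · simp [faceAct, hi, h0 i hi]
        · obtain rfl : i = s + 1 := by lia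
          simp [faceAct, ← reassoc_of% qπ_qδ X s (s + 1) (by lia), w']

include hX in
/-- The last two faces of `X^{s + 1}` make the double of `Qt X s s` along the previous term
of the tower a subobject of the quotient of `X^{s + 1}` by the remaining faces. -/
lemma cofibration_double {s : ℕ} {A L : M} {i : A ⟶ Qt X s s} {l₀ l₁ : Qt X s s ⟶ L}
    (hi : ∀ {E : M} (u v : Qt X s s ⟶ E), i ≫ u = i ≫ v → CompatibleFaces X s
        (fun i => if i < s then 0 else if i = s then qπ X s s ≫ u else qπ X s s ≫ v) (s + 2))
    (sq : IsPushout i i l₀ l₁) (κ : L ⟶ Qt X (s + 1) s) (hκ₀ : l₀ ≫ κ = qδ X s s (by lia))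
    (hκ₁ : l₁ ≫ κ = qlast X s) : Cofibration κ := by
  refine cofibration_of_lift _ (fun {E F} p _ _ a b w => ?_)
  obtain ⟨y, hy, hy'⟩ := exists_filler_of_cofibrant hX s (s + 2) le_rfl p _ (qπ X (s + 1) s ≫ b)
    (hi (l₀ ≫ a) (l₁ ≫ a) (by rw [reassoc_of% sq.w]))
    (fun i hi => by
      rcases Nat.lt_trichotomy i s with h | rfl | h
      · rw [if_pos h, zero_comp, ← Category.assoc, killsFaces_qπ X (s + 1) s i h, zero_comp]
      · rw [if_neg (by lia), if_pos rfl, Category.assoc, Category.assoc, w, reassoc_of% hκ₀,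
          reassoc_of% qπ_qδ]
      · obtain rfl : i = s + 1 := by lia
        rw [if_neg (by lia), if_neg (by lia), Category.assoc, Category.assoc, w,
          reassoc_of% hκ₁, reassoc_of% qπ_qlast])
  have hk : KillsFaces X (s + 1) s y := fun i hi => by rw [hy i (by lia), if_pos hi]
  refine ⟨hk.desc, sq.hom_ext ?_ ?_, ?_⟩
  · rw [← cancel_epi (qπ X s s), reassoc_of% hκ₀, reassoc_of% qπ_qδ, hk.qπ_desc,
      hy s (by lia), if_neg (by lia), if_pos rfl]
  · rw [← cancel_epi (qπ X s s), reassoc_of% hκ₁, reassoc_of% qπ_qlast, hk.qπ_desc,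
      hy (s + 1) (by lia), if_neg (by lia), if_neg (by lia)]
  · rw [← cancel_epi (qπ X (s + 1) s), reassoc_of% hk.qπ_desc, hy']

/-- The class in `[Z, G]` of a pointed simplex of `Hom(X, G)`. -/
def classOf (𝔤 : HoGroup G) {s : ℕ} (f : (homSSet X G).PtSimplex s (0 : X.obj ⦋0⦌ ⟶ G)) :
    𝔤.Cls ((tower hX).Z (s + 2)) :=
  𝔤.cls (A := (tower hX).Z (s + 2)) (killsFaces_mapOf f).desc

lemma nonempty_relStruct_iff_mem_range [IsFibrant G] {𝔤 : HoGroup G} {𝔥 : HoGroup H}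
    (c : Connecting 𝔤 𝔥) {s : ℕ} (f g : (homSSet X G).PtSimplex s (0 : X.obj ⦋0⦌ ⟶ G)) :
    Nonempty (f.RelStruct g (Fin.last s)) ↔
      classOf hX 𝔤 g * (classOf hX 𝔤 f)⁻¹ ∈ ((tower hX).d 𝔤 (s + 2)).range := by
  obtain ⟨A, i, _, hi, hid, hi'⟩ := exists_previous hX s
  have := isCofibrant_Qt hX s s (by lia)
  have := isCofibrant_Qt hX (s + 1) s (by lia)
  have := isCofibrant_Qt hX s (s + 1) (by lia)
  have := isCofibrant_Qt hX (s + 1) (s + 1) (by lia)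
  obtain ⟨L, l₀, l₁, sq⟩ : ∃ (L : M) (l₀ l₁ : Qt X s s ⟶ L), IsPushout i i l₀ l₁ :=
    ⟨_, _, _, IsPushout.of_hasPushout _ _⟩
  obtain ⟨κ, hκ₀, hκ₁⟩ := sq.exists_desc _ _ hid
  have := cofibration_double hX hi' sq κ hκ₀ hκ₁
  have key := exists_extension_iff c hi sq κ (qσ X s s le_rfl)
    (by rw [reassoc_of% hκ₀, qδ_qσ]) (by rw [reassoc_of% hκ₁, qlast_qσ])
    (π := qι X (s + 1) s) (by rw [hκ₀]; exact isCofiberSequence_qδ_qι hX s s (by lia))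
    (d := qδ X s (s + 1) (by lia)) (by rw [hκ₁, qlast_qι])
    (killsFaces_mapOf f).desc (killsFaces_mapOf g).desc
  refine Iff.trans ?_ key
  rw [nonempty_relStruct_homSSet_iff, hκ₀, hκ₁]
  have e (t : Qt X (s + 1) s ⟶ G) :
      (qδ X s s (by lia) ≫ t = qι X s s ≫ (killsFaces_mapOf f).desc ∧
        qlast X s ≫ t = qι X s s ≫ (killsFaces_mapOf g).desc) ↔
      (X.map (cf s s) ≫ qπ X (s + 1) s ≫ t = mapOf f ∧
        X.map (cf s (s + 1)) ≫ qπ X (s + 1) s ≫ t = mapOf g) := by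
    rw [← cancel_epi (qπ X s s), ← cancel_epi (qπ X s s) (h := qι X s s ≫ _),
      reassoc_of% qπ_qlast, reassoc_of% qπ_qδ, reassoc_of% qπ_qι, reassoc_of% qπ_qι,
      KillsFaces.qπ_desc, KillsFaces.qπ_desc]
  constructor
  · rintro ⟨t, h₁, h₂, h₃⟩
    exact ⟨h₃.desc, (e _).2 ⟨by rw [h₃.qπ_desc, h₁], by rw [h₃.qπ_desc, h₂]⟩⟩
  · rintro ⟨t, ht⟩
    exact ⟨qπ X (s + 1) s ≫ t, ((e t).1 ht).1, ((e t).1 ht).2, (killsFaces_qπ X _ _).comp t⟩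

/-- The natural homotopy groups are the cosets of `[N, G]` in `[Z, G]`. -/
lemma naturalPiMap_bijective_iff [IsFibrant G] {𝔤 : HoGroup G} {𝔥 : HoGroup H}
    (c : Connecting 𝔤 𝔥) (f : X ⟶ Y) (s : ℕ) :
    Function.Bijective (naturalPiMap s f G) ↔
      (towerMap hX hY f).InjZ 𝔤 (s + 2) ∧ (towerMap hX hY f).SurjZ 𝔤 (s + 2) := by
  have hrange {X : CosimplicialObject M} (hX : IsReedyCofibration (fromZero X)) :
      Set.range (classOf hX 𝔤 (s := s)) =
        ((⊤ : Subgroup (𝔤.Cls ((tower hX).Z (s + 2)))) : Set _) := by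
    refine Set.eq_univ_of_forall (fun x => ?_)
    obtain ⟨u, rfl⟩ := 𝔤.cls_surjective x
    change Qt X s (s + 1) ⟶ G at u
    have hu : KillsFaces X s (s + 1) (qπ X s (s + 1) ≫ u) := (killsFaces_qπ X _ _).comp u
    obtain ⟨f, hf⟩ := exists_simplexOf_eq ((hasConstFaces_homSSet_iff _).2 hu)
    refine ⟨f, congrArg 𝔤.cls ?_⟩
    change (killsFaces_mapOf f).desc = u
    rw [← cancel_epi (qπ X s (s + 1)), KillsFaces.qπ_desc]
    exact hf
  refine (homotopyGroupMap_bijective_iff (K := homSSet Y G) (L := homSSet X G) (homSSetMap f G) _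
    ((towerMap hX hY f).z 𝔤 (s + 2))
    (classOf hY 𝔤) (classOf hX 𝔤) (fun a => ?_) ((tower hY).d 𝔤 (s + 2)).range
    ((tower hX).d 𝔤 (s + 2)).range (nonempty_relStruct_iff_mem_range hY c)
    (nonempty_relStruct_iff_mem_range hX c) ⊤ ⊤ (hrange hY) (hrange hX)).trans ?_
  · refine Eq.trans (congrArg 𝔤.cls ?_) (𝔤.res_cls _ _).symm
    change (killsFaces_mapOf _).desc = qmap f s (s + 1) ≫ (killsFaces_mapOf a).desc
    rw [← cancel_epi (qπ X s (s + 1)), reassoc_of% qπ_qmap, KillsFaces.qπ_desc,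
      KillsFaces.qπ_desc]
    exact simplexOf_mapPtSimplex _ _ _
  · refine and_congr ⟨fun h y hy => h y trivial hy, fun h y _ hy => h y hy⟩
      ⟨fun h x => ?_, fun h x _ => ?_⟩
    · obtain ⟨_, ⟨w, rfl⟩, y, -, h⟩ := h x trivial
      exact ⟨w, y, h⟩
    · obtain ⟨w, y, h⟩ := h x
      exact ⟨_, ⟨w, rfl⟩, y, trivial, h⟩

end Natural

/-! ### The homotopy groups of `[X, G]` as homology groups -/

section Normalized

open scoped ZeroObject

variable {M : Type u} [Category.{v} M] [ModelCategory M] [HasZeroObject M] [HasZeroMorphisms M]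
  {X Y : CosimplicialObject M} {G H : M}

lemma isCofibrant_obj (hX : IsReedyCofibration (fromZero X)) (m : ℕ) :
    IsCofibrant (X.obj ⦋m⦌) := by
  rw [isCofibrant_iff_of_isInitial (0 : (0 : M) ⟶ X.obj ⦋m⦌) HasZeroObject.zeroIsInitial]
  have := isCofibrant_Qt hX m 0 (by lia)
  have := (isCofibrant_iff_of_isInitial (0 : (0 : M) ⟶ Qt X m 0) HasZeroObject.zeroIsInitial).1 this
  have h : KillsFaces X m 0 (𝟙 (X.obj ⦋m⦌)) := by
    cases m with
    | zero => trivial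
    | succ m => exact fun i hi => absurd hi (Nat.not_lt_zero i)
  refine cofibration_of_lift _ (fun {E F} p _ _ a b w => ?_)
  obtain ⟨y, -, hy⟩ := exists_lift_of_comm (0 : (0 : M) ⟶ Qt X m 0) p (a := a) (b := h.desc ≫ b)
    ((isZero_zero M).eq_of_src _ _)
  exact ⟨qπ X m 0 ≫ y, (isZero_zero M).eq_of_src _ _, by
    rw [Category.assoc, hy, reassoc_of% h.qπ_desc]⟩

/-- The restrictions of a class in `[X^m, G]` to the faces with numbers less than `k` are
trivial. -/
def HasTrivialFaces (X : CosimplicialObject M) [∀ m, IsCofibrant (X.obj ⦋m⦌)] (𝔤 : HoGroup G)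
    (m k : ℕ) (y : 𝔤.Cls (X.obj ⦋m⦌)) : Prop :=
  match m, y with
  | 0, _ => True
  | m + 1, y => ∀ i < k, 𝔤.res (X.map (cf m i)) y = 1

variable [∀ m, IsCofibrant (X.obj ⦋m⦌)] [IsFibrant G] {𝔤 : HoGroup G} {𝔥 : HoGroup H}

lemma hasTrivialFaces_res_qπ {m k : ℕ} [IsCofibrant (Qt X m k)] (x : 𝔤.Cls (Qt X m k)) :
    HasTrivialFaces X 𝔤 m k (𝔤.res (qπ X m k) x) := by
  cases m with
  | zero => trivial
  | succ m =>
    intro i hi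
    rw [𝔤.res_res, killsFaces_qπ X (m + 1) k i hi, 𝔤.res_zero]

omit [HasZeroObject M] [IsFibrant G] in
lemma bijective_res_qπ_zero {m : ℕ} [IsCofibrant (Qt X m 0)] :
    Function.Bijective (𝔤.res (qπ X m 0)) := by
  have h : KillsFaces X m 0 (𝟙 (X.obj ⦋m⦌)) := by
    cases m with
    | zero => trivial
    | succ m => exact fun i hi => absurd hi (Nat.not_lt_zero i)
  have h' : h.desc ≫ qπ X m 0 = 𝟙 _ := by
    rw [← cancel_epi (qπ X m 0), reassoc_of% h.qπ_desc, Category.comp_id]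
  refine ⟨Function.LeftInverse.injective (g := 𝔤.res h.desc) (fun x => ?_),
    Function.RightInverse.surjective (g := 𝔤.res h.desc) (fun x => ?_)⟩
  · rw [𝔤.res_res, h', 𝔤.res_id]
  · rw [𝔤.res_res, h.qπ_desc, 𝔤.res_id]

variable (hX : IsReedyCofibration (fromZero X)) (c : Connecting 𝔤 𝔥)
include hX c

/-- As long as the cofaces which are divided out have a common retraction, the classes of maps on
the quotient are the classes with trivial faces. -/
lemma res_qπ_injective_and_range (k : ℕ) : ∀ (m : ℕ) (_ : k ≤ m) [IsCofibrant (Qt X m k)],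
    Function.Injective (𝔤.res (qπ X m k)) ∧
      ∀ y, HasTrivialFaces X 𝔤 m k y → ∃ x, 𝔤.res (qπ X m k) x = y := by
  induction k with
  | zero =>
    intro m _ _
    exact ⟨bijective_res_qπ_zero.1, fun y _ => bijective_res_qπ_zero.2 y⟩
  | succ k ih =>
    intro m hk _
    obtain ⟨m, rfl⟩ := Nat.exists_eq_succ_of_ne_zero (Nat.ne_of_gt (Nat.zero_lt_of_lt hk))
    have hk' : k ≤ m := by lia
    have := isCofibrant_Qt hX m k (by lia)
    have := isCofibrant_Qt hX (m + 1) k (by lia)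
    have hs := isCofiberSequence_qδ_qι hX m k (by lia)
    have e (x : 𝔤.Cls (Qt X (m + 1) (k + 1))) :
        𝔤.res (qπ X (m + 1) (k + 1)) x = 𝔤.res (qπ X (m + 1) k) (𝔤.res (qι X (m + 1) k) x) := by
      rw [𝔤.res_res, qπ_qι]
    refine ⟨fun x y hxy => ?_, fun y hy => ?_⟩
    · refine c.res_injective hs (qσ X m k hk') (qδ_qσ X m k hk') ((ih (m + 1) (by lia)).1 ?_)
      rw [← e, ← e]
      exact hxy
    · obtain ⟨z, rfl⟩ := (ih (m + 1) (by lia)).2 y (fun i hi => hy i (by lia))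
      obtain ⟨x, rfl⟩ := (hs.exact 𝔤 z).1 ((ih m hk').1 (by
        rw [map_one, ← hy k (by lia)]
        exact 𝔤.res_comm (qπ_qδ X m k (by lia)) z))
      exact ⟨x, e x⟩

end Normalized

section Normalized

open scoped ZeroObject

variable {M : Type u} [Category.{v} M] [ModelCategory M] [HasZeroObject M] [HasZeroMorphisms M]
  {X Y : CosimplicialObject M} {G H : M} [∀ m, IsCofibrant (X.obj ⦋m⦌)]
  [∀ m, IsCofibrant (Y.obj ⦋m⦌)] [IsFibrant G] {𝔤 : HoGroup G} {𝔥 : HoGroup H}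

/-- The simplicial set `[X, G]`. -/
abbrev hoSSet (X : CosimplicialObject M) (G : M) : SSet :=
  homSSet (((CosimplicialObject.whiskering _ _).obj (toHo M)).obj X) ((toHo M).obj G)

/-- The base point of `[X, G]`. -/
abbrev hoPoint (X : CosimplicialObject M) (G : M) : (hoSSet X G) _⦋0⦌ :=
  (toHo M).map (0 : X.obj ⦋0⦌ ⟶ G)

variable (𝔤) in
/-- The class in `[X^s, G]` which underlies a pointed simplex of `[X, G]`. -/
def clsOf {s : ℕ} (f : (hoSSet X G).PtSimplex s (hoPoint X G)) : 𝔤.Cls (X.obj ⦋s⦌) :=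
  simplexOf f

lemma basept_hoSSet (n : ℕ) :
    basept (hoPoint X G) n = (1 : 𝔤.Cls (X.obj ⦋n⦌)) := by
  rw [basept_eq, ← 𝔤.cls_zero]
  change (toHo M).map (X.map _) ≫ (toHo M).map 0 = (toHo M).map 0
  rw [← Functor.map_comp, comp_zero]

lemma hasConstFaces_hoSSet_iff {s : ℕ} (a : 𝔤.Cls (X.obj ⦋s⦌)) :
    HasConstFaces (hoPoint X G) s a ↔ HasTrivialFaces X 𝔤 s (s + 1) a := by
  cases s with
  | zero => rfl
  | succ s =>
    change (∀ i, 𝔤.res (X.map (SimplexCategory.δ i)) a = basept (hoPoint X G) s) ↔ _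
    simp only [basept_hoSSet (𝔤 := 𝔤), δ_eq_cf]
    exact ⟨fun h i hi => h ⟨i, hi⟩, fun h i => h i i.2⟩

lemma hasTrivialFaces_clsOf {s : ℕ} (f : (hoSSet X G).PtSimplex s (hoPoint X G)) :
    HasTrivialFaces X 𝔤 s (s + 1) (clsOf 𝔤 f) :=
  (hasConstFaces_hoSSet_iff _).1 (hasConstFaces_simplexOf f)

omit [HasZeroObject M] [HasZeroMorphisms M] [IsFibrant G] in
lemma HasTrivialFaces.mono {m k k' : ℕ} (hk : k' ≤ k) {y : 𝔤.Cls (X.obj ⦋m⦌)}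
    (h : HasTrivialFaces X 𝔤 m k y) : HasTrivialFaces X 𝔤 m k' y := by
  cases m with
  | zero => trivial
  | succ m => exact fun i hi => h i (by lia)

omit [HasZeroObject M] [HasZeroMorphisms M] [IsFibrant G] in
lemma HasTrivialFaces.degeneracy {s : ℕ} {y : 𝔤.Cls (X.obj ⦋s⦌)}
    (h : HasTrivialFaces X 𝔤 s s y) :
    HasTrivialFaces X 𝔤 (s + 1) s (𝔤.res (X.map (cd s s)) y) := by
  cases s with
  | zero => exact fun i hi => absurd hi (Nat.not_lt_zero i)
  | succ s =>
    intro i hi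
    rw [𝔤.res_res, ← X.map_comp, cf_comp_cd_of_lt hi (by lia), X.map_comp, ← 𝔤.res_res, h i hi,
      map_one]

lemma nonempty_relStruct_hoSSet_iff {s : ℕ} (f g : (hoSSet X G).PtSimplex s (hoPoint X G)) :
    Nonempty (f.RelStruct g (Fin.last s)) ↔ ∃ t : 𝔤.Cls (X.obj ⦋s + 1⦌),
      𝔤.res (X.map (cf s s)) t = clsOf 𝔤 f ∧ 𝔤.res (X.map (cf s (s + 1))) t = clsOf 𝔤 g ∧
        HasTrivialFaces X 𝔤 (s + 1) s t := by
  rw [nonempty_relStruct_iff]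
  refine exists_congr (fun (t : 𝔤.Cls (X.obj ⦋s + 1⦌)) => ?_)
  change (𝔤.res (X.map (SimplexCategory.δ _)) t = clsOf 𝔤 f ∧
    𝔤.res (X.map (SimplexCategory.δ _)) t = clsOf 𝔤 g ∧
    ∀ i < _, 𝔤.res (X.map (SimplexCategory.δ i)) t = basept (hoPoint X G) s) ↔ _
  simp only [basept_hoSSet (𝔤 := 𝔤), δ_eq_cf]
  refine and_congr Iff.rfl (and_congr Iff.rfl ⟨fun h i hi => ?_, fun h i hi => h i ?_⟩)
  · exact h ⟨i, by lia⟩ hi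
  · exact hi

variable (hX : IsReedyCofibration (fromZero X)) (hY : IsReedyCofibration (fromZero Y))
  (c : Connecting 𝔤 𝔥)

section

variable {s : ℕ} [IsCofibrant (Qt X s s)] [IsCofibrant (Qt X (s + 1) (s + 1))]

omit [HasZeroObject M] [IsFibrant G] in
/-- The differential of the normalized complex is the restriction to the last face. -/
lemma res_qπ_differential (x : 𝔤.Cls (Qt X (s + 1) (s + 1))) :
    𝔤.res (qπ X s s) (𝔤.res (qlast X s ≫ qι X (s + 1) s) x) =
      𝔤.res (X.map (cf s (s + 1))) (𝔤.res (qπ X (s + 1) (s + 1)) x) :=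
  𝔤.res_comm (by rw [reassoc_of% qπ_qlast, qπ_qι]) x

include hX c

lemma hasTrivialFaces_res_qπ_iff (x : 𝔤.Cls (Qt X (s + 1) (s + 1))) :
    HasTrivialFaces X 𝔤 (s + 1) (s + 2) (𝔤.res (qπ X (s + 1) (s + 1)) x) ↔
      𝔤.res (qlast X s ≫ qι X (s + 1) s) x = 1 := by
  rw [← (injective_iff_map_eq_one' _).1 (res_qπ_injective_and_range hX c s s le_rfl).1,
    res_qπ_differential]
  refine ⟨fun h => h _ (by lia), fun h i hi => ?_⟩
  rcases Nat.lt_succ_iff_lt_or_eq.1 hi with hi | rfl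
  · exact hasTrivialFaces_res_qπ x i hi
  · exact h

/-- Homotopies of pointed simplices of `[X, G]` are witnessed by boundaries. -/
lemma nonempty_relStruct_hoSSet_iff_exists {f g : (hoSSet X G).PtSimplex s (hoPoint X G)}
    {x y : 𝔤.Cls (Qt X s s)} (hx : 𝔤.res (qπ X s s) x = clsOf 𝔤 f)
    (hy : 𝔤.res (qπ X s s) y = clsOf 𝔤 g) :
    Nonempty (f.RelStruct g (Fin.last s)) ↔
      ∃ w, 𝔤.res (qlast X s ≫ qι X (s + 1) s) w = y * x⁻¹ := by
  rw [nonempty_relStruct_hoSSet_iff (𝔤 := 𝔤)]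
  have h₀ : 𝔤.res (X.map (cf s s)) (𝔤.res (X.map (cd s s)) (clsOf 𝔤 f)) = clsOf 𝔤 f := by
    rw [𝔤.res_res, ← X.map_comp, cf_comp_cd_self (by lia), X.map_id, 𝔤.res_id]
  have h₁ : 𝔤.res (X.map (cf s (s + 1))) (𝔤.res (X.map (cd s s)) (clsOf 𝔤 f)) = clsOf 𝔤 f := by
    rw [𝔤.res_res, ← X.map_comp, cf_succ_comp_cd (by lia), X.map_id, 𝔤.res_id]
  have h₂ := ((hasTrivialFaces_clsOf (𝔤 := 𝔤) f).mono (Nat.le_succ s)).degeneracy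
  constructor
  · rintro ⟨t, ht₁, ht₂, ht₃⟩
    obtain ⟨w, hw⟩ := (res_qπ_injective_and_range hX c (s + 1) (s + 1) le_rfl).2
      (t * (𝔤.res (X.map (cd s s)) (clsOf 𝔤 f))⁻¹) (fun i hi => by
        rw [map_mul, map_inv]
        rcases Nat.lt_succ_iff_lt_or_eq.1 hi with hi | rfl
        · rw [ht₃ i hi, h₂ i hi, inv_one, mul_one]
        · rw [ht₁, h₀, mul_inv_cancel])
    refine ⟨w, (res_qπ_injective_and_range hX c s s le_rfl).1 ?_⟩
    rw [res_qπ_differential, hw, map_mul, map_inv, ht₂, h₁, map_mul, map_inv, hx, hy]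
  · rintro ⟨w, hw⟩
    refine ⟨𝔤.res (qπ X (s + 1) (s + 1)) w * 𝔤.res (X.map (cd s s)) (clsOf 𝔤 f), ?_, ?_,
      fun i hi => ?_⟩
    · rw [map_mul, h₀, hasTrivialFaces_res_qπ w s (by lia), one_mul]
    · rw [map_mul, h₁, ← res_qπ_differential, hw, map_mul, map_inv, hx, hy, inv_mul_cancel_right]
    · rw [map_mul, hasTrivialFaces_res_qπ w i (by lia), h₂ i hi, one_mul]

end

include c

lemma exists_classOf_hoSSet (s : ℕ) :
    ∃ e : (hoSSet X G).PtSimplex s (hoPoint X G) → 𝔤.Cls ((tower hX).N (s + 2)),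
      (∀ f, 𝔤.res (A := X.obj ⦋s⦌) (B := (tower hX).N (s + 2)) (qπ X s s) (e f) = clsOf 𝔤 f) ∧
      (∀ f g, Nonempty (f.RelStruct g (Fin.last s)) ↔
        e g * (e f)⁻¹ ∈ (((tower hX).j 𝔤 (s + 2)).comp ((tower hX).d 𝔤 (s + 2))).range) ∧
      Set.range e = (((tower hX).j 𝔤 (s + 1)).comp ((tower hX).d 𝔤 (s + 1))).ker := by
  have := isCofibrant_Qt hX s s (by lia)
  have := isCofibrant_Qt hX (s + 1) (s + 1) (by lia)
  have := isCofibrant_Qt hX s (s + 1) (by lia)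
  obtain ⟨hinj, hrange⟩ := res_qπ_injective_and_range hX c s s le_rfl
  choose e he using fun f : (hoSSet X G).PtSimplex s (hoPoint X G) =>
    hrange (clsOf 𝔤 f) ((hasTrivialFaces_clsOf f).mono (Nat.le_succ s))
  refine ⟨e, he, fun f g => ?_, ?_⟩
  · refine (nonempty_relStruct_hoSSet_iff_exists hX c (he f) (he g)).trans ?_
    refine exists_congr (fun w => ?_)
    change _ ↔ 𝔤.res (qι X s s) (𝔤.res (qδ X s (s + 1) (by lia)) w) = _
    rw [𝔤.res_res, qlast_qι]
    exact Iff.rfl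
  · have key (x : 𝔤.Cls (Qt X s s)) : HasTrivialFaces X 𝔤 s (s + 1) (𝔤.res (qπ X s s) x) ↔
        (tower hX).j 𝔤 (s + 1) ((tower hX).d 𝔤 (s + 1) x) = 1 := by
      cases s with
      | zero =>
        have := 𝔤.subsingleton_cls_of_isZero (Z := (tower hX).N 1) (isZero_zero M)
        exact ⟨fun _ => Subsingleton.elim _ _, fun _ => trivial⟩
      | succ s =>
        have := isCofibrant_Qt hX s s (by lia)
        have := isCofibrant_Qt hX s (s + 1) (by lia)
        rw [hasTrivialFaces_res_qπ_iff hX c]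
        change _ ↔ 𝔤.res (qι X s s) (𝔤.res (qδ X s (s + 1) (by lia)) x) = 1
        rw [𝔤.res_res, qlast_qι]
    ext x
    refine Iff.trans ?_ (key x)
    constructor
    · rintro ⟨f, rfl⟩
      rw [he]
      exact hasTrivialFaces_clsOf f
    · intro hx
      obtain ⟨f, hf⟩ := exists_simplexOf_eq ((hasConstFaces_hoSSet_iff _).2 hx)
      exact ⟨f, hinj ((he f).trans hf)⟩

/-- The homotopy groups of `[X, G]` are the homology groups of the normalized complex. -/
lemma hoPiMap_bijective_iff (f : X ⟶ Y) (s : ℕ) :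
    Function.Bijective (hoPiMap s f G) ↔
      (towerMap hX hY f).InjN 𝔤 (s + 1) ∧ (towerMap hX hY f).SurjN 𝔤 (s + 1) := by
  obtain ⟨e, he, hB, hC⟩ := exists_classOf_hoSSet hX c s
  obtain ⟨e', he', hB', hC'⟩ := exists_classOf_hoSSet hY c s
  have := isCofibrant_Qt hX s s (by lia)
  have := isCofibrant_Qt hY s s (by lia)
  refine (homotopyGroupMap_bijective_iff (K := hoSSet Y G) (L := hoSSet X G)
    (homSSetMap (((CosimplicialObject.whiskering _ _).obj (toHo M)).map f) ((toHo M).obj G)) _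
    ((towerMap hX hY f).n 𝔤 (s + 2)) e' e (fun a => ?_) _ _ hB' hB _ _ hC' hC).trans ?_
  · refine (res_qπ_injective_and_range hX c s s le_rfl).1 ((he _).trans ?_)
    refine (simplexOf_mapPtSimplex _ _ _).trans ?_
    change 𝔤.res (f.app ⦋s⦌) (clsOf 𝔤 a) = 𝔤.res (qπ X s s) (𝔤.res (qmap f s s) (e' a))
    rw [← he' a]
    exact 𝔤.res_comm (qπ_qmap f s s).symm (e' a)
  · refine and_congr ⟨fun h y hy hw => h y hy hw, fun h y hy hw => h y hy hw⟩
      ⟨fun h x hx => ?_, fun h x hx => ?_⟩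
    · obtain ⟨_, ⟨w, rfl⟩, y, hy, h⟩ := h x hx
      exact ⟨w, y, hy, h⟩
    · obtain ⟨w, y, hy, h⟩ := h x hx
      exact ⟨_, ⟨w, rfl⟩, y, hy, h⟩

end Normalized

section Comparison

open scoped ZeroObject

variable {M : Type u} [Category.{v} M] [ModelCategory M] [HasZeroObject M] [HasZeroMorphisms M]

/-- For maps between Reedy cofibrant objects, the natural homotopy groups detect
`𝒢`-equivalences. -/
theorem isGEquivalence_iff_naturalPiMap_bijective [IsLeftProper M] {𝒢 : ObjectProperty M}
    (h𝒢 : IsClassOfInjectiveModels 𝒢) {X Y : CosimplicialObject M}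
    (hX : IsReedyCofibration (fromZero X)) (hY : IsReedyCofibration (fromZero Y)) (f : X ⟶ Y) :
    IsGEquivalence 𝒢 f ↔ ∀ G : M, 𝒢 G → ∀ s, Function.Bijective (naturalPiMap s f G) := by
  have := isCofibrant_obj hX
  have := isCofibrant_obj hY
  have key := (towerMap hX hY f).bijective_iff h𝒢
  constructor
  · intro h G hG s
    obtain ⟨𝔤⟩ := h𝒢.nonempty_hoGroup hG
    obtain ⟨_, _, _, ⟨c⟩⟩ := h𝒢.exists_connecting hG 𝔤
    have := h𝒢.isFibrant G hG
    rw [naturalPiMap_bijective_iff hX hY c]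
    refine key.1 (fun G hG 𝔤 k => ?_) G hG 𝔤 s
    obtain ⟨_, _, _, ⟨c⟩⟩ := h𝒢.exists_connecting hG 𝔤
    have := h𝒢.isFibrant G hG
    exact (hoPiMap_bijective_iff hX hY c f k).1 (h G hG k)
  · intro h G hG s
    obtain ⟨𝔤⟩ := h𝒢.nonempty_hoGroup hG
    obtain ⟨_, _, _, ⟨c⟩⟩ := h𝒢.exists_connecting hG 𝔤
    have := h𝒢.isFibrant G hG
    rw [hoPiMap_bijective_iff hX hY c]
    refine key.2 (fun G hG 𝔤 k => ?_) G hG 𝔤 s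
    obtain ⟨_, _, _, ⟨c⟩⟩ := h𝒢.exists_connecting hG 𝔤
    have := h𝒢.isFibrant G hG
    exact (naturalPiMap_bijective_iff hX hY c f k).1 (h G hG k)

end Comparison

/-! ### Conditions in a single degree -/

section Degreewise

variable {C : Type u} [Category.{v} C]

lemma CompatibleFaces.comp {X : CosimplicialObject C} {E F : C} {m k : ℕ}
    {z : ℕ → (X.obj ⦋m⦌ ⟶ E)} (h : CompatibleFaces X m z k) (g : E ⟶ F) :
    CompatibleFaces X m (fun i => z i ≫ g) k := by
  cases m with
  | zero => trivial
  | succ m =>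
    intro i j hij hj
    have := h i j hij hj
    simp only [faceAct] at this ⊢
    rw [reassoc_of% this]

lemma CompatibleFaces.precomp {X Y : CosimplicialObject C} {E : C} {m k : ℕ}
    {z : ℕ → (Y.obj ⦋m⦌ ⟶ E)} (h : CompatibleFaces Y m z k) (f : X ⟶ Y) :
    CompatibleFaces X m (fun i => f.app ⦋m⦌ ≫ z i) k := by
  cases m with
  | zero => trivial
  | succ m =>
    intro i j hij hj
    have := h i j hij hj
    simp only [faceAct] at this ⊢
    rw [← reassoc_of% app_naturality, ← reassoc_of% app_naturality, this]

/-- The map from the object in degree `m` to the system which it inherits from `f : X ⟶ Z` and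
its lower degrees is an isomorphism: the maps out of `Z^m` are the compatible pairs of a map out
of `X^m` and a family of faces. -/
def HasUniqueFillers {X Z : CosimplicialObject C} (f : X ⟶ Z) (m : ℕ) : Prop :=
  match m with
  | 0 => ∀ ⦃E : C⦄ (x : X.obj ⦋0⦌ ⟶ E), ∃! y, f.app ⦋0⦌ ≫ y = x
  | m + 1 => ∀ ⦃E : C⦄ (z : ℕ → (Z.obj ⦋m⦌ ⟶ E)) (x : X.obj ⦋m + 1⦌ ⟶ E),
    CompatibleFaces Z m z (m + 2) → (∀ i < m + 2, f.app ⦋m⦌ ≫ z i = X.map (cf m i) ≫ x) →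
    ∃! y : Z.obj ⦋m + 1⦌ ⟶ E, (∀ i < m + 2, Z.map (cf m i) ≫ y = z i) ∧ f.app ⦋m + 1⦌ ≫ y = x

variable [ModelCategory C]

/-- The condition on a Reedy cofibration in degree `m`. -/
def IsReedyCofibrationAt {X Z : CosimplicialObject C} (f : X ⟶ Z) (m : ℕ) : Prop :=
  match m with
  | 0 => Cofibration (f.app ⦋0⦌)
  | m + 1 => ∀ ⦃E B : C⦄ (p : E ⟶ B) [Fibration p] [WeakEquivalence p]
    (z : ℕ → (Z.obj ⦋m⦌ ⟶ E)) (x : X.obj ⦋m + 1⦌ ⟶ E) (b : Z.obj ⦋m + 1⦌ ⟶ B),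
    CompatibleFaces Z m z (m + 2) → (∀ i < m + 2, f.app ⦋m⦌ ≫ z i = X.map (cf m i) ≫ x) →
    (∀ i < m + 2, z i ≫ p = Z.map (cf m i) ≫ b) → x ≫ p = f.app ⦋m + 1⦌ ≫ b →
    ∃ y : Z.obj ⦋m + 1⦌ ⟶ E, (∀ i < m + 2, Z.map (cf m i) ≫ y = z i) ∧
      f.app ⦋m + 1⦌ ≫ y = x ∧ y ≫ p = b

lemma isReedyCofibration_iff_forall {X Z : CosimplicialObject C} (f : X ⟶ Z) :
    IsReedyCofibration f ↔ ∀ m, IsReedyCofibrationAt f m := by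
  constructor
  · intro h m
    cases m with
    | zero => exact h.zero
    | succ m => exact fun _ _ => h.exists_filler m
  · exact fun h => ⟨h 0, fun m E B p => by exact h (m + 1) p⟩

/-- If the map from the latching object is an isomorphism, it is a cofibration. -/
lemma HasUniqueFillers.isReedyCofibrationAt_succ {X Z : CosimplicialObject C} {f : X ⟶ Z} {m : ℕ}
    (h : HasUniqueFillers f (m + 1)) : IsReedyCofibrationAt f (m + 1) := by
  intro E B p _ _ z x b hz hx hb hxb
  obtain ⟨y, ⟨hy, hy'⟩, -⟩ := h z x hz hx
  refine ⟨y, hy, hy', (h (fun i => z i ≫ p) (x ≫ p) (hz.comp p) ?_).unique ⟨?_, ?_⟩ ⟨?_, ?_⟩⟩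
  · intro i hi
    rw [reassoc_of% (hx i hi)]
  · intro i hi
    rw [reassoc_of% (hy i hi)]
  · rw [reassoc_of% hy']
  · intro i hi
    rw [hb i hi]
  · exact hxb.symm

/-- The condition in degree `m` depends on the target in degrees up to `m` only. -/
lemma IsReedyCofibrationAt.of_iso {X Z Z' : CosimplicialObject C} {f : X ⟶ Z} {f' : X ⟶ Z'}
    {m : ℕ} (h : IsReedyCofibrationAt f m) (e : ∀ l ≤ m, Z.obj ⦋l⦌ ≅ Z'.obj ⦋l⦌)
    (he : ∀ l (hl : l + 1 ≤ m) i, Z.map (cf l i) ≫ (e (l + 1) hl).hom =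
      (e l (by lia)).hom ≫ Z'.map (cf l i))
    (hf : ∀ l (hl : l ≤ m), f.app ⦋l⦌ ≫ (e l hl).hom = f'.app ⦋l⦌) :
    IsReedyCofibrationAt f' m := by
  cases m with
  | zero =>
    change Cofibration _
    have : Cofibration (f.app ⦋0⦌) := h
    rw [← hf 0 le_rfl]
    infer_instance
  | succ m =>
    intro E B p _ _ z x b hz hx hb hxb
    obtain ⟨y, hy, hy', hy''⟩ := h p (fun i => (e m (by lia)).hom ≫ z i) x
      ((e (m + 1) le_rfl).hom ≫ b)
      (by
        cases m with
        | zero => trivial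
        | succ m =>
          intro i j hij hj
          have := hz i j hij hj
          simp only [faceAct] at this ⊢
          rw [reassoc_of% he, reassoc_of% he, this])
      (fun i hi => by rw [reassoc_of% hf, hx i hi])
      (fun i hi => by rw [Category.assoc, hb i hi, reassoc_of% he])
      (by rw [hxb, reassoc_of% hf])
    refine ⟨(e (m + 1) le_rfl).inv ≫ y, fun i hi => ?_, ?_, ?_⟩
    · rw [← cancel_epi (e m (by lia)).hom, ← hy i hi, ← reassoc_of% he _ le_rfl,
        Iso.hom_inv_id_assoc]
    · rw [← hf _ le_rfl, Category.assoc, Iso.hom_inv_id_assoc, hy']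
    · rw [Category.assoc, hy'', Iso.inv_hom_id_assoc]

/-- The condition in degree `m` passes along maps which are isomorphisms in degrees up to `m`. -/
lemma IsReedyCofibrationAt.comp_iff {X Z Z' : CosimplicialObject C} (f : X ⟶ Z) (j : Z ⟶ Z')
    {f' : X ⟶ Z'} (w : f ≫ j = f') {m : ℕ} (hj : ∀ l ≤ m, IsIso (j.app ⦋l⦌)) :
    IsReedyCofibrationAt f' m ↔ IsReedyCofibrationAt f m := by
  subst w
  have e (l : ℕ) (hl : l ≤ m) : ∃ e : Z.obj ⦋l⦌ ≅ Z'.obj ⦋l⦌, e.hom = j.app ⦋l⦌ :=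
    have := hj l hl
    ⟨asIso (j.app ⦋l⦌), rfl⟩
  choose e he using e
  constructor
  · intro h
    refine h.of_iso (fun l hl => (e l hl).symm) (fun l hl i => ?_) (fun l hl => ?_)
    · rw [Iso.symm_hom, Iso.symm_hom, Iso.comp_inv_eq, Category.assoc, Iso.eq_inv_comp, he, he,
        app_naturality]
    · rw [Iso.symm_hom, Iso.comp_inv_eq, he]
      rfl
  · intro h
    refine h.of_iso e (fun l hl i => ?_) (fun l hl => ?_)
    · rw [he, he, app_naturality]
    · rw [he]
      rfl

end Degreewise

/-! ### Skeleta -/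

section KanExtension

variable {A : Type*} {D : Type*} {H : Type*} [Category* A] [Category* D] [Category* H]
  (L : A ⥤ D) [L.Full] [L.Faithful] [∀ F : A ⥤ H, L.HasPointwiseLeftKanExtension F]
  [∀ F : A ⥤ H, L.HasLeftKanExtension F]

lemma isIso_lanAdjunction_counit_app_app (G : D ⥤ H) (a : A) :
    IsIso (((L.lanAdjunction H).counit.app G).app (L.obj a)) := by
  have h := L.lanUnit_app_app_lanAdjunction_counit_app_app (H := H) G a
  have : IsIso ((L.lanUnit.app (L ⋙ G)).app a) := inferInstance
  exact IsIso.of_isIso_fac_left h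

/-- A left Kan extension `W` along a full subcategory is the left Kan extension of its
restriction. -/
lemma existsUnique_lan_desc (F : A ⥤ H) (m : D) {E : H}
    (u : ∀ a : A, (L.obj a ⟶ m) → ((L.lan.obj F).obj (L.obj a) ⟶ E))
    (hu : ∀ (a b : A) (χ : a ⟶ b) (φ : L.obj b ⟶ m),
      (L.lan.obj F).map (L.map χ) ≫ u b φ = u a (L.map χ ≫ φ)) :
    ∃! y : (L.lan.obj F).obj m ⟶ E, ∀ a φ, (L.lan.obj F).map φ ≫ y = u a φ := by
  let η : F ⟶ L ⋙ L.lan.obj F := L.lanUnit.app F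
  have hη (a : A) : IsIso (η.app a) := inferInstanceAs (IsIso ((L.lanUnit.app F).app a))
  have hL : ((Functor.LeftExtension.mk _ η).IsPointwiseLeftKanExtension) :=
    L.isPointwiseLeftKanExtensionLeftKanExtensionUnit F
  let c : Cocone (CostructuredArrow.proj L m ⋙ F) :=
    { pt := E
      ι :=
        { app := fun φ => η.app φ.left ≫ u φ.left φ.hom
          naturality := fun φ ψ f => by
            have h1 := hu _ _ f.left ψ.hom
            rw [CostructuredArrow.w f] at h1
            change F.map f.left ≫ η.app ψ.left ≫ _ = (η.app φ.left ≫ _) ≫ 𝟙 E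
            rw [Category.comp_id, ← h1]
            exact η.naturality_assoc f.left _ } }
  have hc (y : (L.lan.obj F).obj m ⟶ E) :
      (∀ a φ, (L.lan.obj F).map φ ≫ y = u a φ) ↔
      ∀ j, ((Functor.LeftExtension.mk _ η).coconeAt m).ι.app j ≫ y = c.ι.app j := by
    constructor
    · intro h j
      change (η.app j.left ≫ (L.lan.obj F).map j.hom) ≫ y = η.app j.left ≫ _
      rw [Category.assoc, ← h]
    · intro h a φ
      have h' : (η.app a ≫ (L.lan.obj F).map φ) ≫ y = η.app a ≫ u a φ :=
        h (CostructuredArrow.mk φ)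
      rw [Category.assoc] at h'
      exact (cancel_epi (η.app a)).1 h'
  refine ⟨(hL m).desc c, (hc _).2 ((hL m).fac c), fun y hy => (hL m).hom_ext (fun j => ?_)⟩
  rw [(hL m).fac]
  exact (hc y).1 hy j

end KanExtension

section Skeleton

open SimplexCategory.Truncated

variable {C : Type u} [Category.{v} C] [HasFiniteColimits C] (N : ℕ) (X : CosimplicialObject C)

/-- The map from the skeleton of `X` to `X`. -/
def skCounit : (sk C N).obj X ⟶ X :=
  ((inclusion N).lanAdjunction C).counit.app X

lemma skCounit_naturality {X Y : CosimplicialObject C} (f : X ⟶ Y) :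
    (sk C N).map f ≫ skCounit N Y = skCounit N X ≫ f :=
  ((inclusion N).lanAdjunction C).counit.naturality f

/-- In degrees up to `N`, the `N`-skeleton of `X` agrees with `X`. -/
lemma isIso_skCounit_app {a : ℕ} (ha : a ≤ N) : IsIso ((skCounit N X).app ⦋a⦌) :=
  isIso_lanAdjunction_counit_app_app (inclusion N) X ⟨⦋a⦌, ha⟩

/-- The cosimplicial object `W` is the left Kan extension of its restriction to degrees up
to `N`. -/
def IsSkeletal (W : CosimplicialObject C) : Prop :=
  ∀ (m : SimplexCategory) {E : C} (u : ∀ a : SimplexCategory, a.len ≤ N → (a ⟶ m) → (W.obj a ⟶ E)),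
    (∀ (a b : SimplexCategory) (ha : a.len ≤ N) (hb : b.len ≤ N) (χ : a ⟶ b) (φ : b ⟶ m),
      W.map χ ≫ u b hb φ = u a ha (χ ≫ φ)) →
    ∃! y : W.obj m ⟶ E, ∀ a (ha : a.len ≤ N) (φ : a ⟶ m), W.map φ ≫ y = u a ha φ

lemma isSkeletal_sk : IsSkeletal N ((sk C N).obj X) := by
  intro m E u hu
  obtain ⟨y, hy, hy'⟩ := existsUnique_lan_desc (inclusion N)
    ((CosimplicialObject.truncation N).obj X) m (fun a φ => u a.obj a.property φ)
    (fun a b χ φ => hu a.obj b.obj a.property b.property χ.hom φ)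
  exact ⟨y, fun a ha φ => hy ⟨a, ha⟩ φ, fun y h => hy' y (fun a φ => h a.obj a.property φ)⟩

variable {N X} {W : CosimplicialObject C}

omit [HasFiniteColimits C] in
/-- Above degree `N`, an `N`-skeletal object is determined by its faces. -/
lemma IsSkeletal.existsUnique_filler (hW : IsSkeletal N W) {m : ℕ} (hm : N ≤ m) {E : C}
    {z : ℕ → (W.obj ⦋m⦌ ⟶ E)} (hz : CompatibleFaces W m z (m + 2)) :
    ∃! y : W.obj ⦋m + 1⦌ ⟶ E, ∀ i < m + 2, W.map (cf m i) ≫ y = z i := by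
  have hφ (a : SimplexCategory) (ha : a.len ≤ N) (φ : a ⟶ ⦋m + 1⦌) : ¬ Epi φ := fun _ => by
    have := SimplexCategory.len_le_of_epi φ
    simp at this
    lia
  choose i hi θ hθ using fun a (ha : a.len ≤ N) (φ : a ⟶ ⦋m + 1⦌) =>
    exists_comp_cf_eq φ (hφ a ha φ)
  obtain ⟨y, hy, hy'⟩ := hW ⦋m + 1⦌ (fun a ha φ => W.map (θ a ha φ) ≫ z (i a ha φ))
    (fun a b ha hb χ φ => by
      rw [← Category.assoc, ← W.map_comp]
      refine hz.map_comp_eq (hi _ _ _) (hi _ _ _) ?_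
      rw [← hθ, Category.assoc, ← hθ])
  refine ⟨y, fun j hj => ?_, fun y' h => hy' y' (fun a ha φ => ?_)⟩
  · refine (hW ⦋m⦌ (fun a ha φ => W.map φ ≫ z j)
      (fun a b ha hb χ φ => ?_)).unique (fun a ha φ => ?_) (fun a ha φ => rfl)
    · rw [← Category.assoc, ← W.map_comp]
    · rw [← Category.assoc, ← W.map_comp, hy _ ha]
      exact hz.map_comp_eq (hi _ _ _) hj (hθ _ _ _).symm
  · conv_lhs => rw [hθ a ha φ]
    rw [W.map_comp, Category.assoc, h _ (hi _ _ _)]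

end Skeleton

section Skeleton

open scoped ZeroObject

variable {M : Type u} [Category.{v} M] [HasZeroMorphisms M]

lemma naturalPiMap_comp {X Y Z : CosimplicialObject M} (f : X ⟶ Y) (g : Y ⟶ Z) (s : ℕ) (G : M) :
    naturalPiMap s (f ≫ g) G = naturalPiMap s f G ∘ naturalPiMap s g G := by
  funext x
  induction x using Quot.ind with
  | mk a =>
    refine congrArg (Quot.mk _) (simplexOf_injective ?_)
    rw [simplexOf_mapPtSimplex, simplexOf_mapPtSimplex, simplexOf_mapPtSimplex]
    exact Category.assoc _ _ _

lemma mapOf_mapPtSimplex {X Y : CosimplicialObject M} (f : X ⟶ Y) {s : ℕ} {G : M} (h)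
    (a : (homSSet Y G).PtSimplex s (0 : Y.obj ⦋0⦌ ⟶ G)) :
    mapOf (mapPtSimplex (y := (0 : X.obj ⦋0⦌ ⟶ G)) (homSSetMap f G) h a) = f.app ⦋s⦌ ≫ mapOf a :=
  simplexOf_mapPtSimplex _ _ _

lemma quotMap_bijective {A B : Type*} {r : A → A → Prop} {r' : B → B → Prop} {f : A → B}
    (h : ∀ a b, r a b → r' (f a) (f b)) (hf : Function.Bijective f)
    (hr : ∀ a b, r' (f a) (f b) → r a b) : Function.Bijective (Quot.map f h) := by
  let e := Equiv.ofBijective f hf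
  exact (Quot.congr (ra := r) (rb := r') e (fun a b => ⟨h a b, hr a b⟩)).bijective

/-- The natural homotopy group in degree `s` depends on degrees up to `s + 1` only. -/
lemma naturalPiMap_bijective_of_isIso {X Y : CosimplicialObject M} (f : X ⟶ Y) {s : ℕ}
    (hf : ∀ l ≤ s + 1, IsIso (f.app ⦋l⦌)) (G : M) : Function.Bijective (naturalPiMap s f G) := by
  have h0 := hf s (by lia)
  have h1 := hf (s + 1) le_rfl
  have e (i : ℕ) : Y.map (cf s i) ≫ inv (f.app ⦋s + 1⦌) = inv (f.app ⦋s⦌) ≫ X.map (cf s i) := by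
    rw [IsIso.comp_inv_eq, Category.assoc, IsIso.eq_inv_comp, app_naturality]
  have hk {t : ℕ} (ht : t ≤ s + 1) {k : ℕ} {E : M} (x : X.obj ⦋t⦌ ⟶ E) (y : Y.obj ⦋t⦌ ⟶ E)
      (hxy : f.app _ ≫ y = x) (h : KillsFaces X t k x) : KillsFaces Y t k y := by
    cases t with
    | zero => trivial
    | succ t =>
      intro i hi
      have := hf t (by lia)
      rw [← cancel_epi (f.app ⦋t⦌), comp_zero, reassoc_of% app_naturality, hxy, h i hi]
  refine quotMap_bijective (f := mapPtSimplex (y := (0 : X.obj ⦋0⦌ ⟶ G)) (homSSetMap f G) (by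
    exact comp_zero)) (fun a b => ?_) ⟨fun a b hab => ?_, fun a => ?_⟩ (fun a b => ?_)
  · rw [nonempty_relStruct_homSSet_iff, nonempty_relStruct_homSSet_iff]
    rintro ⟨t, h₁, h₂, h₃⟩
    rw [mapOf_mapPtSimplex, mapOf_mapPtSimplex]
    refine ⟨f.app ⦋s + 1⦌ ≫ t, ?_, ?_, h₃.precomp f⟩
    · rw [← reassoc_of% app_naturality, h₁]
    · rw [← reassoc_of% app_naturality, h₂]
  · refine simplexOf_injective ?_
    have h := congrArg mapOf hab
    rw [mapOf_mapPtSimplex, mapOf_mapPtSimplex] at h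
    exact (cancel_epi (f.app ⦋s⦌)).1 h
  · obtain ⟨b, hb⟩ := exists_simplexOf_eq ((hasConstFaces_homSSet_iff _).2
      (hk (by lia) (mapOf a) (inv (f.app ⦋s⦌) ≫ mapOf a) (by simp) (killsFaces_mapOf a)))
    refine ⟨b, simplexOf_injective ?_⟩
    refine (mapOf_mapPtSimplex f _ b).trans ?_
    change _ ≫ simplexOf b = _
    rw [hb]
    exact IsIso.hom_inv_id_assoc _ _
  · rw [nonempty_relStruct_homSSet_iff, nonempty_relStruct_homSSet_iff]
    rintro ⟨t, h₁, h₂, h₃⟩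
    rw [mapOf_mapPtSimplex] at h₁ h₂
    refine ⟨inv (f.app ⦋s + 1⦌) ≫ t, ?_, ?_, hk le_rfl t _ (by simp) h₃⟩
    · rw [reassoc_of% e, h₁, IsIso.inv_hom_id_assoc]
    · rw [reassoc_of% e, h₂, IsIso.inv_hom_id_assoc]

/-- Any two pointed simplices of dimension `s ≥ N` are the last faces of a boundary with trivial
first faces, which can be filled in an `N`-skeletal object. -/
lemma IsSkeletal.subsingleton_naturalPi {N : ℕ} {W : CosimplicialObject M} (hW : IsSkeletal N W)
    {s : ℕ} (hs : N ≤ s) (G : M) : Subsingleton (naturalPi s W G) := by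
  refine ⟨fun a b => ?_⟩
  induction a using Quot.ind with
  | mk a =>
  induction b using Quot.ind with
  | mk b =>
  refine Quot.sound ((nonempty_relStruct_homSSet_iff a b).2 ?_)
  obtain ⟨t, ht, -⟩ := hW.existsUnique_filler hs
    (z := fun i => if i < s then 0 else if i = s then mapOf a else mapOf b) (by
      have ha := killsFaces_mapOf a
      have hb := killsFaces_mapOf b
      generalize mapOf a = x, mapOf b = y at ha hb
      cases s with
      | zero => trivial
      | succ s =>
        have hz (k : ℕ) (hk : k < s + 2) (i : ℕ) :
            W.map (cf s k) ≫ (if i < s + 1 then 0 else if i = s + 1 then x else y) = 0 := by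
          split_ifs
          exacts [comp_zero, ha k hk, hb k hk]
        intro i j hij hj
        exact (hz _ (by lia) _).trans (hz _ (by lia) _).symm)
  refine ⟨t, ?_, ?_, ?_⟩
  · simpa using ht s (by lia)
  · simpa using ht (s + 1) (by lia)
  · cases s with
    | zero => exact fun i hi => absurd hi (Nat.not_lt_zero i)
    | succ s =>
      intro i hi
      rw [ht i (by lia), if_pos hi]

instance nonempty_naturalPi (s : ℕ) (X : CosimplicialObject M) (G : M) :
    Nonempty (naturalPi s X G) := by
  obtain ⟨f, -⟩ := exists_simplexOf_eq ((hasConstFaces_homSSet_iff (s := s)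
    (0 : X.obj ⦋s⦌ ⟶ G)).2 (by
      cases s with
      | zero => trivial
      | succ s => exact fun i _ => comp_zero))
  exact ⟨Quot.mk _ f⟩

variable [HasZeroObject M]

omit [HasZeroMorphisms M] in
lemma fromZero_hom_ext {X : CosimplicialObject M}
    (f g : ((Functor.const SimplexCategory).obj (0 : M) : CosimplicialObject M) ⟶ X) : f = g := by
  ext
  exact (isZero_zero M).eq_of_src _ _

variable [ModelCategory M]

lemma isReedyCofibration_sk {X : CosimplicialObject M} (hX : IsReedyCofibration (fromZero X))
    (N : ℕ) : IsReedyCofibration (fromZero ((sk M N).obj X)) := by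
  refine (isReedyCofibration_iff_forall (fromZero ((sk M N).obj X))).2 (fun m => ?_)
  have hX := (isReedyCofibration_iff_forall (fromZero X)).1 hX
  by_cases hm : m ≤ N
  · exact (IsReedyCofibrationAt.comp_iff _ (skCounit N X) (fromZero_hom_ext _ _)
      (fun l hl => isIso_skCounit_app N X (hl.trans hm))).1 (hX m)
  · obtain ⟨m, rfl⟩ := Nat.exists_eq_succ_of_ne_zero (show m ≠ 0 by lia)
    refine HasUniqueFillers.isReedyCofibrationAt_succ (fun E z x hz _ => ?_)
    obtain ⟨y, hy, hy'⟩ := (isSkeletal_sk N X).existsUnique_filler (by lia) hz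
    exact ⟨y, ⟨hy, (isZero_zero M).eq_of_src _ _⟩, fun y' h => hy' y' h.1⟩

/-- The skeleton of dimension `n + 1` keeps the natural homotopy groups in degrees up to `n` and
discards the other ones. -/
theorem isGEquivalence_sk_iff [IsLeftProper M] {𝒢 : ObjectProperty M}
    (h𝒢 : IsClassOfInjectiveModels 𝒢) {X Y : CosimplicialObject M}
    (hX : IsReedyCofibration (fromZero X)) (hY : IsReedyCofibration (fromZero Y)) (f : X ⟶ Y)
    (n : ℕ) : IsGEquivalence 𝒢 ((sk M (n + 1)).map f) ↔
      ∀ G : M, 𝒢 G → ∀ s ≤ n, Function.Bijective (naturalPiMap s f G) := by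
  rw [isGEquivalence_iff_naturalPiMap_bijective h𝒢 (isReedyCofibration_sk hX _)
    (isReedyCofibration_sk hY _)]
  refine forall_congr' (fun G => forall_congr' (fun _ => ?_))
  have h (s : ℕ) (hs : s ≤ n) : Function.Bijective (naturalPiMap s ((sk M (n + 1)).map f) G) ↔
      Function.Bijective (naturalPiMap s f G) := by
    have hX' := naturalPiMap_bijective_of_isIso (skCounit (n + 1) X) (s := s)
      (fun l hl => isIso_skCounit_app _ _ (by lia)) G
    have hY' := naturalPiMap_bijective_of_isIso (skCounit (n + 1) Y) (s := s)
      (fun l hl => isIso_skCounit_app _ _ (by lia)) G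
    rw [← hY'.of_comp_iff, ← naturalPiMap_comp, skCounit_naturality, naturalPiMap_comp,
      hX'.of_comp_iff']
  refine ⟨fun H s hs => (h s hs).1 (H s), fun H s => ?_⟩
  rcases Nat.lt_or_ge n s with hs | hs
  · have := (isSkeletal_sk (n + 1) X).subsingleton_naturalPi hs G
    have := (isSkeletal_sk (n + 1) Y).subsingleton_naturalPi hs G
    exact ⟨fun a b _ => Subsingleton.elim _ _, fun b =>
      ⟨(nonempty_naturalPi s _ G).some, Subsingleton.elim _ _⟩⟩
  · exact (h s hs).2 (H s hs)

end Skeleton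

/-! ### Attaching cells to cosimplicial objects -/

section Cell

variable {C : Type u} [Category.{v} C]

/-- The data for replacing `Z^k` by an object `B` under it, without changing lower degrees: since
the codegeneracies of the new object end in lower degrees, they have to be given on `B`. They are
encoded as the action on `B` of all maps out of `[k]` which are not injective. -/
structure CellData (Z : CosimplicialObject C) (k : ℕ) (B : C) where
  /-- the map which enlarges `Z^k` -/
  i : Z.obj ⦋k⦌ ⟶ B
  /-- the action of the non-injective maps -/
  β {m : SimplexCategory} (θ : ⦋k⦌ ⟶ m) (h : ¬ Mono θ) : B ⟶ Z.obj m
  i_β {m : SimplexCategory} (θ : ⦋k⦌ ⟶ m) (h : ¬ Mono θ) : i ≫ β θ h = Z.map θ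
  β_map {m n : SimplexCategory} (θ : ⦋k⦌ ⟶ m) (h : ¬ Mono θ) (α : m ⟶ n) (h' : ¬ Mono (θ ≫ α)) :
    β θ h ≫ Z.map α = β (θ ≫ α) h'

/-- The cosimplicial object `Z'` is obtained from `Z` by freely adjoining the images of `B` under
the injective maps out of `[k]`. -/
structure IsCellAttachment {Z : CosimplicialObject C} {k : ℕ} {B : C} (D : CellData Z k B)
    {Z' : CosimplicialObject C} (j : Z ⟶ Z') (b : B ⟶ Z'.obj ⦋k⦌) : Prop where
  i_b : D.i ≫ b = j.app ⦋k⦌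
  β_app {m : SimplexCategory} (θ : ⦋k⦌ ⟶ m) (h : ¬ Mono θ) : D.β θ h ≫ j.app m = b ≫ Z'.map θ
  exists_desc {m : SimplexCategory} {E : C} (u : Z.obj m ⟶ E)
    (v : ∀ θ : ⦋k⦌ ⟶ m, Mono θ → (B ⟶ E)) (huv : ∀ θ h, D.i ≫ v θ h = Z.map θ ≫ u) :
    ∃ y : Z'.obj m ⟶ E, j.app m ≫ y = u ∧ ∀ θ h, b ≫ Z'.map θ ≫ y = v θ h
  hom_ext {m : SimplexCategory} {E : C} {y y' : Z'.obj m ⟶ E} (h₁ : j.app m ≫ y = j.app m ≫ y')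
    (h₂ : ∀ θ : ⦋k⦌ ⟶ m, Mono θ → b ≫ Z'.map θ ≫ y = b ≫ Z'.map θ ≫ y') : y = y'

variable {Z : CosimplicialObject C} {k : ℕ} {B : C} (D : CellData Z k B)

/-- The objects of the attachment are pushouts of copies of `i`, one for each injective map. -/
lemma CellData.exists_obj [HasFiniteColimits C] (m : SimplexCategory) :
    ∃ (P : C) (j : Z.obj m ⟶ P) (c : ∀ θ : ⦋k⦌ ⟶ m, Mono θ → (B ⟶ P)),
      (∀ θ h, D.i ≫ c θ h = Z.map θ ≫ j) ∧
      (∀ {E : C} (u : Z.obj m ⟶ E) (v : ∀ θ : ⦋k⦌ ⟶ m, Mono θ → (B ⟶ E)),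
        (∀ θ h, D.i ≫ v θ h = Z.map θ ≫ u) → ∃ y, j ≫ y = u ∧ ∀ θ h, c θ h ≫ y = v θ h) ∧
      ∀ {E : C} {y y' : P ⟶ E}, j ≫ y = j ≫ y' → (∀ θ h, c θ h ≫ y = c θ h ≫ y') → y = y' := by
  let J := {θ : ⦋k⦌ ⟶ m // Mono θ}
  let p : (∐ fun _ : J => Z.obj ⦋k⦌) ⟶ Z.obj m := Sigma.desc (fun θ => Z.map θ.1)
  let q : (∐ fun _ : J => Z.obj ⦋k⦌) ⟶ ∐ fun _ : J => B := Limits.Sigma.map (fun _ => D.i)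
  obtain ⟨P, j, c, sq⟩ : ∃ (P : C) (j : Z.obj m ⟶ P) (c : (∐ fun _ : J => B) ⟶ P),
    IsPushout p q j c := ⟨_, _, _, IsPushout.of_hasPushout _ _⟩
  refine ⟨P, j, fun θ h => Sigma.ι (fun _ : J => B) ⟨θ, h⟩ ≫ c, fun θ h => ?_, fun u v huv => ?_,
    fun h₁ h₂ => sq.hom_ext h₁ (Sigma.hom_ext _ _ (fun θ => ?_))⟩
  · have h := Sigma.ι (fun _ : J => Z.obj ⦋k⦌) ⟨θ, h⟩ ≫= sq.w
    rw [Sigma.ι_desc_assoc, Sigma.ι_map_assoc] at h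
    exact h.symm
  · obtain ⟨y, hy, hy'⟩ := sq.exists_desc u (Sigma.desc (fun θ : J => v θ.1 θ.2))
      (Sigma.hom_ext _ _ (fun θ => by
        rw [Sigma.ι_desc_assoc, Sigma.ι_map_assoc, Sigma.ι_desc]
        exact (huv _ _).symm))
    exact ⟨y, hy, fun θ h => by rw [Category.assoc, hy', Sigma.ι_desc]⟩
  · have := h₂ θ.1 θ.2
    rwa [Category.assoc, Category.assoc] at this

open Classical in
lemma CellData.exists_isCellAttachment [HasFiniteColimits C] :
    ∃ (Z' : CosimplicialObject C) (j : Z ⟶ Z') (b : B ⟶ Z'.obj ⦋k⦌), IsCellAttachment D j b := by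
  choose P j c hc hd he using D.exists_obj
  -- the action on the cell of arbitrary maps out of `[k]`
  let c' {m : SimplexCategory} (θ : ⦋k⦌ ⟶ m) : B ⟶ P m :=
    if h : Mono θ then c m θ h else D.β θ h ≫ j m
  have c'_mono {m : SimplexCategory} (θ : ⦋k⦌ ⟶ m) (h : Mono θ) : c' θ = c m θ h := dif_pos h
  have c'_not {m : SimplexCategory} (θ : ⦋k⦌ ⟶ m) (h : ¬ Mono θ) : c' θ = D.β θ h ≫ j m :=
    dif_neg h
  have hc' {m : SimplexCategory} (θ : ⦋k⦌ ⟶ m) : D.i ≫ c' θ = Z.map θ ≫ j m := by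
    by_cases h : Mono θ
    · rw [c'_mono θ h, hc]
    · rw [c'_not θ h, reassoc_of% D.i_β]
  choose a ha ha' using fun {m n : SimplexCategory} (α : m ⟶ n) =>
    hd m (Z.map α ≫ j n) (fun θ _ => c' (θ ≫ α)) (fun θ h => by
      rw [hc', Z.map_comp, Category.assoc])
  have hca {m n : SimplexCategory} (α : m ⟶ n) (θ : ⦋k⦌ ⟶ m) : c' θ ≫ a α = c' (θ ≫ α) := by
    by_cases h : Mono θ
    · rw [c'_mono θ h, ha']
    · have h' : ¬ Mono (θ ≫ α) := fun _ => h (mono_of_mono θ α)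
      rw [c'_not θ h, c'_not _ h', Category.assoc, ha, reassoc_of% (D.β_map θ h α h')]
  let Z' : CosimplicialObject C :=
    { obj := P
      map := a
      map_id m := he m
        (by rw [ha, Z.map_id, Category.id_comp, Category.comp_id])
        (fun θ h => by rw [ha', Category.comp_id, Category.comp_id, c'_mono θ h])
      map_comp α β := he _
        (by rw [ha, reassoc_of% ha, ha, Z.map_comp, Category.assoc])
        (fun θ h => by rw [ha', reassoc_of% ha', hca, Category.assoc]) }
  have hb {m : SimplexCategory} (θ : ⦋k⦌ ⟶ m) : c' (𝟙 _) ≫ Z'.map θ = c' θ := by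
    change c' _ ≫ a θ = _
    rw [hca, Category.id_comp]
  refine ⟨Z', { app := j, naturality := fun m n α => (ha α).symm }, c' (𝟙 _), ?_, ?_, ?_, ?_⟩
  · change _ = j _
    rw [hc', Z.map_id, Category.id_comp]
  · intro m θ h
    rw [hb, c'_not θ h]
  · intro m E u v huv
    obtain ⟨y, hy, hy'⟩ := hd m u v huv
    exact ⟨y, hy, fun θ h => by rw [reassoc_of% hb, c'_mono θ h, hy']⟩
  · intro m E y y' h₁ h₂
    refine he m h₁ (fun θ h => ?_)
    have := h₂ θ h
    rwa [reassoc_of% hb, reassoc_of% hb, c'_mono θ h] at this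

namespace IsCellAttachment

variable {D} {Z' : CosimplicialObject C} {j : Z ⟶ Z'} {b : B ⟶ Z'.obj ⦋k⦌}
  (H : IsCellAttachment D j b)
include H

/-- There are no injective maps from `[k]` to lower degrees. -/
lemma isIso_app {l : ℕ} (hl : l < k) : IsIso (j.app ⦋l⦌) := by
  have hθ (θ : ⦋k⦌ ⟶ ⦋l⦌) : ¬ Mono θ := fun _ => by
    have := SimplexCategory.len_le_of_mono θ
    simp at this
    lia
  obtain ⟨y, hy, -⟩ := H.exists_desc (𝟙 (Z.obj ⦋l⦌)) (fun θ h => (hθ θ h).elim)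
    (fun θ h => (hθ θ h).elim)
  exact ⟨y, hy, H.hom_ext (by rw [reassoc_of% hy, Category.comp_id]) (fun θ h => (hθ θ h).elim)⟩

/-- The identity is the only injective map from `[k]` to `[k]`. -/
lemma isIso_cell : IsIso b := by
  have hθ (θ : ⦋k⦌ ⟶ ⦋k⦌) (h : Mono θ) : θ = 𝟙 _ := SimplexCategory.eq_id_of_mono θ
  obtain ⟨y, hy, hy'⟩ := H.exists_desc D.i (fun _ _ => 𝟙 B) (fun θ h => by
    rw [hθ θ h, Z.map_id, Category.id_comp, Category.comp_id])
  have hb : b ≫ y = 𝟙 B := by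
    have := hy' (𝟙 _) inferInstance
    rwa [Z'.map_id, Category.id_comp] at this
  refine ⟨y, hb, H.hom_ext ?_ (fun θ h => ?_)⟩
  · rw [reassoc_of% hy, H.i_b, Category.comp_id]
  · rw [hθ θ h, Z'.map_id, Category.id_comp, Category.id_comp, reassoc_of% hb, Category.comp_id]

/-- Maps of cosimplicial objects out of an attachment. -/
lemma exists_hom {Y : CosimplicialObject C} (q : Z ⟶ Y) (r : B ⟶ Y.obj ⦋k⦌)
    (hi : D.i ≫ r = q.app ⦋k⦌)
    (hβ : ∀ {m : SimplexCategory} (θ : ⦋k⦌ ⟶ m) h, D.β θ h ≫ q.app m = r ≫ Y.map θ) :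
    ∃ q' : Z' ⟶ Y, j ≫ q' = q ∧ b ≫ q'.app ⦋k⦌ = r := by
  choose y hy hy' using fun m : SimplexCategory =>
    H.exists_desc (q.app m) (fun θ _ => r ≫ Y.map θ) (fun θ _ => by
      rw [reassoc_of% hi, app_naturality])
  have hby {m : SimplexCategory} (θ : ⦋k⦌ ⟶ m) : b ≫ Z'.map θ ≫ y m = r ≫ Y.map θ := by
    by_cases h : Mono θ
    · exact hy' m θ h
    · rw [← reassoc_of% (H.β_app θ h), hy, hβ]
  refine ⟨{ app := y, naturality := fun m n α => H.hom_ext ?_ (fun θ h => ?_) }, ?_, ?_⟩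
  · rw [reassoc_of% app_naturality, hy, reassoc_of% hy, app_naturality]
  · rw [← Category.assoc (Z'.map θ), ← Z'.map_comp, hby, ← Category.assoc (Z'.map θ),
      ← Category.assoc b, hby, Y.map_comp, Category.assoc]
  · ext m
    exact hy m
  · have := hby (𝟙 _)
    rwa [Z'.map_id, Category.id_comp, Y.map_id, Category.comp_id] at this

variable {X : CosimplicialObject C} {f : X ⟶ Z}

/-- Above degree `k`, an attachment is determined by its faces as far as `Z` is. -/
lemma hasUniqueFillers {m : ℕ} (hm : k ≤ m) (h : HasUniqueFillers f (m + 1)) :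
    HasUniqueFillers (f ≫ j) (m + 1) := by
  intro E z x hz hx
  have hfj (l : ℕ) : (f ≫ j).app ⦋l⦌ = f.app ⦋l⦌ ≫ j.app ⦋l⦌ := rfl
  obtain ⟨t, ⟨ht, ht'⟩, ht''⟩ := h (fun i => j.app ⦋m⦌ ≫ z i) x (hz.precomp j)
    (fun i hi => by rw [← hx i hi, hfj, Category.assoc])
  have hθ (θ : ⦋k⦌ ⟶ ⦋m + 1⦌) : ¬ Epi θ := fun _ => by
    have := SimplexCategory.len_le_of_epi θ
    simp at this
    lia
  choose i hi θ' hθ' using fun θ : ⦋k⦌ ⟶ ⦋m + 1⦌ => exists_comp_cf_eq θ (hθ θ)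
  obtain ⟨y, hy, hy'⟩ := H.exists_desc t (fun θ _ => b ≫ Z'.map (θ' θ) ≫ z (i θ)) (fun θ _ => by
    conv_rhs => rw [hθ' θ]
    rw [reassoc_of% H.i_b, reassoc_of% app_naturality, Z.map_comp, Category.assoc, ht _ (hi θ)])
  refine ⟨y, ⟨fun l hl => H.hom_ext ?_ (fun θ h => ?_), ?_⟩, ?_⟩
  · rw [reassoc_of% app_naturality, hy, ht l hl]
  · have := h
    rw [← Category.assoc (Z'.map θ), ← Z'.map_comp, hy' _ (mono_comp _ _)]
    exact congrArg (b ≫ ·) (hz.map_comp_eq (hi _) hl (hθ' _).symm)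
  · rw [hfj, Category.assoc, hy, ht']
  · rintro y' ⟨h₁, h₂⟩
    refine H.hom_ext ?_ (fun θ h => ?_)
    · rw [hy]
      refine ht'' _ ⟨fun l hl => ?_, ?_⟩
      · rw [← reassoc_of% app_naturality, h₁ l hl]
      · rw [← h₂, hfj, Category.assoc]
    · rw [hy' θ h]
      conv_lhs => rw [hθ' θ]
      rw [Z'.map_comp, Category.assoc, h₁ _ (hi θ)]

end IsCellAttachment

end Cell

/-! ### Trivial fibrations relative to codegeneracies -/

section Codegeneracies

variable {C : Type u} [Category.{v} C]

/-- The action of the codegeneracies of `Z` on the maps from an object `T` to `Z`. -/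
abbrev degeneracyAct (Z : CosimplicialObject C) (T : C) (n i : ℕ) (y : T ⟶ Z.obj ⦋n + 1⦌) :
    T ⟶ Z.obj ⦋n⦌ := y ≫ Z.map (cd n i)

/-- Maps `z 0, …, z (k - 1)` which satisfy the identities between the codegeneracies of a map
to `Z^{m + 1}`. -/
abbrev CompatibleDegeneracies (Z : CosimplicialObject C) {T : C} (m : ℕ)
    (z : ℕ → (T ⟶ Z.obj ⦋m⦌)) (k : ℕ) : Prop :=
  IsCompatible (S := fun n => T ⟶ Z.obj ⦋n⦌) (degeneracyAct Z T) m z k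

lemma degeneracyAct_degeneracyAct {Z : CosimplicialObject C} {T : C} {n i j : ℕ} (hij : i < j)
    (hj : j < n + 2) (y : T ⟶ Z.obj ⦋n + 2⦌) :
    degeneracyAct Z T n i (degeneracyAct Z T (n + 1) j y) =
      degeneracyAct Z T n (j - 1) (degeneracyAct Z T (n + 1) i y) := by
  simp only [degeneracyAct, Category.assoc, ← Z.map_comp, cd_comp_cd hij hj]

lemma CompatibleDegeneracies.comp {Z : CosimplicialObject C} {T T' : C} {m k : ℕ}
    {z : ℕ → (T ⟶ Z.obj ⦋m⦌)} (h : CompatibleDegeneracies Z m z k) (t : T' ⟶ T) :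
    CompatibleDegeneracies Z m (fun i => t ≫ z i) k := by
  cases m with
  | zero => trivial
  | succ m =>
    intro i j hij hj
    have := h i j hij hj
    simp only [degeneracyAct, Category.assoc] at this ⊢
    rw [this]

/-- Compatible codegeneracies agree on all maps which factor in several ways. -/
lemma CompatibleDegeneracies.comp_map_eq {Z : CosimplicialObject C} {T : C} {m : ℕ}
    {z : ℕ → (T ⟶ Z.obj ⦋m⦌)} (hz : CompatibleDegeneracies Z m z (m + 1)) {l : SimplexCategory}
    {i j : ℕ} (hi : i < m + 1) (hj : j < m + 1) {φ ψ : ⦋m⦌ ⟶ l}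
    (h : cd m i ≫ φ = cd m j ≫ ψ) : z i ≫ Z.map φ = z j ≫ Z.map ψ := by
  wlog hij : i ≤ j generalizing i j φ ψ
  · exact (this hj hi h.symm (by lia)).symm
  rcases hij.eq_or_lt with rfl | hij
  · have := congrArg (cf m i ≫ ·) h
    simp only [reassoc_of% cf_comp_cd_self hi] at this
    rw [this]
  cases m with
  | zero => lia
  | succ m =>
    obtain ⟨χ, rfl, rfl⟩ := exists_of_cd_comp_eq hij hj h
    have := hz i j hij hj
    simp only [degeneracyAct] at this
    rw [Z.map_comp, Z.map_comp, reassoc_of% this]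

lemma exists_joint_equalizer [HasFiniteLimits C] {A E : C} {ι : Type} [Finite ι]
    (a b : ι → (A ⟶ E)) : ∃ (P : C) (p : P ⟶ A), Mono p ∧ (∀ r, p ≫ a r = p ≫ b r) ∧
      ∀ {T : C} (t : T ⟶ A), (∀ r, t ≫ a r = t ≫ b r) → ∃ s, s ≫ p = t := by
  refine ⟨_, equalizer.ι (Pi.lift a) (Pi.lift b), inferInstance, fun r => ?_, fun t ht =>
    ⟨equalizer.lift t (Pi.hom_ext _ _ (fun r => by simpa using ht r)), equalizer.lift_ι _ _⟩⟩
  have := equalizer.condition (Pi.lift a) (Pi.lift b) =≫ Pi.π (fun _ => E) r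
  simpa using this

/-- The relative matching object `P` of `q` in degree `m + 1`, built as a finite limit: the maps
`T ⟶ P` are the pairs of a map `T ⟶ Y^{m + 1}` and a compatible family of codegeneracies above
it. -/
lemma exists_matching [HasFiniteLimits C] {Z Y : CosimplicialObject C} (q : Z ⟶ Y) (m : ℕ) :
    ∃ (P : C) (p : ℕ → (P ⟶ Z.obj ⦋m⦌)) (pY : P ⟶ Y.obj ⦋m + 1⦌),
      CompatibleDegeneracies Z m p (m + 1) ∧
      (∀ i < m + 1, p i ≫ q.app ⦋m⦌ = pY ≫ Y.map (cd m i)) ∧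
      (∀ {T : C} (z : ℕ → (T ⟶ Z.obj ⦋m⦌)) (y : T ⟶ Y.obj ⦋m + 1⦌),
        CompatibleDegeneracies Z m z (m + 1) →
        (∀ i < m + 1, z i ≫ q.app ⦋m⦌ = y ≫ Y.map (cd m i)) →
        ∃ t : T ⟶ P, (∀ i < m + 1, t ≫ p i = z i) ∧ t ≫ pY = y) ∧
      ∀ {T : C} {t t' : T ⟶ P}, (∀ i < m + 1, t ≫ p i = t' ≫ p i) → t ≫ pY = t' ≫ pY →
        t = t' := by
  let F := ∏ᶜ fun _ : Fin (m + 1) => Z.obj ⦋m⦌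
  let π (i : ℕ) : F ⟶ Z.obj ⦋m⦌ := Pi.π (fun _ : Fin (m + 1) => Z.obj ⦋m⦌) (Fin.ofNat (m + 1) i)
  have hF {T : C} (z : ℕ → (T ⟶ Z.obj ⦋m⦌)) : ∃ t : T ⟶ F, ∀ i < m + 1, t ≫ π i = z i := by
    refine ⟨Pi.lift (fun i => z i), fun i hi => ?_⟩
    rw [limit.lift_π]
    simp [Nat.mod_eq_of_lt hi]
  have hF' {T : C} {t t' : T ⟶ F} (h : ∀ i < m + 1, t ≫ π i = t' ≫ π i) : t = t' :=
    Pi.hom_ext _ _ (fun i => by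
      have := h i i.2
      simpa [π] using this)
  -- the compatible families
  obtain ⟨G, g, _, hg, hg'⟩ : ∃ (G : C) (g : G ⟶ F), Mono g ∧
      CompatibleDegeneracies Z m (fun i => g ≫ π i) (m + 1) ∧
      ∀ {T : C} (t : T ⟶ F), CompatibleDegeneracies Z m (fun i => t ≫ π i) (m + 1) →
        ∃ s, s ≫ g = t := by
    cases m with
    | zero => exact ⟨F, 𝟙 F, inferInstance, trivial, fun t _ => ⟨t, Category.comp_id t⟩⟩
    | succ m =>
      obtain ⟨G, g, hg, hg', hg''⟩ := exists_joint_equalizer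
        (ι := {r : Fin (m + 2) × Fin (m + 2) // r.1 < r.2}) (A := F) (E := Z.obj ⦋m⦌)
        (fun r => π r.1.2 ≫ Z.map (cd m r.1.1)) (fun r => π r.1.1 ≫ Z.map (cd m (r.1.2 - 1 : ℕ)))
      refine ⟨G, g, hg, fun i j hij hj => ?_, fun t ht => hg'' t (fun r => ?_)⟩
      · have := hg' ⟨⟨⟨i, by lia⟩, ⟨j, hj⟩⟩, hij⟩
        simpa only [degeneracyAct, Category.assoc] using this
      · have := ht r.1.1 r.1.2 r.2 r.1.2.2
        simpa only [degeneracyAct, Category.assoc] using this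
  obtain ⟨P, p, _, hp, hp'⟩ := exists_joint_equalizer (ι := Fin (m + 1))
    (A := G ⨯ Y.obj ⦋m + 1⦌) (E := Y.obj ⦋m⦌)
    (fun i => prod.fst ≫ g ≫ π i ≫ q.app _) (fun i => prod.snd ≫ Y.map (cd m i))
  refine ⟨P, fun i => (p ≫ prod.fst) ≫ g ≫ π i, p ≫ prod.snd, hg.comp _, fun i hi => ?_,
    fun z y hz hy => ?_, fun {T t t'} h h' => ?_⟩
  · have := hp ⟨i, hi⟩
    simpa only [Category.assoc] using this
  · obtain ⟨t, ht⟩ := hF z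
    obtain ⟨s, hs⟩ := hg' t (by
      cases m with
      | zero => trivial
      | succ m =>
        intro i j hij hj
        simp only [ht i (hij.trans hj), ht j hj]
        exact hz i j hij hj)
    obtain ⟨r, hr⟩ := hp' (prod.lift s y) (fun i => by
      rw [prod.lift_fst_assoc, prod.lift_snd_assoc, reassoc_of% hs, reassoc_of% (ht i i.2),
        hy i i.2])
    refine ⟨r, fun i hi => ?_, ?_⟩
    · simp only [Category.assoc]
      rw [reassoc_of% hr, prod.lift_fst_assoc, reassoc_of% hs, ht i hi]
    · rw [← Category.assoc, hr, prod.lift_snd]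
  · rw [← cancel_mono p]
    refine Limits.prod.hom_ext ?_ (by simpa using h')
    rw [← cancel_mono g]
    refine hF' (fun i hi => ?_)
    have := h i hi
    simpa only [Category.assoc] using this

end Codegeneracies

section TrivialFibration

variable {C : Type u} [Category.{v} C] [ModelCategory C]

/-- The map `q : Z ⟶ Y` has, in degree `m`, the lifting property of a trivial Reedy fibration. -/
def IsTrivialFibrationAt {Z Y : CosimplicialObject C} (q : Z ⟶ Y) (m : ℕ) : Prop :=
  match m with
  | 0 => ∀ ⦃S T : C⦄ (s : S ⟶ T) [Cofibration s] (x : S ⟶ Z.obj ⦋0⦌) (y : T ⟶ Y.obj ⦋0⦌),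
    x ≫ q.app ⦋0⦌ = s ≫ y → ∃ t, s ≫ t = x ∧ t ≫ q.app ⦋0⦌ = y
  | m + 1 => ∀ ⦃S T : C⦄ (s : S ⟶ T) [Cofibration s] (z : ℕ → (T ⟶ Z.obj ⦋m⦌))
    (x : S ⟶ Z.obj ⦋m + 1⦌) (y : T ⟶ Y.obj ⦋m + 1⦌), CompatibleDegeneracies Z m z (m + 1) →
    (∀ i < m + 1, s ≫ z i = x ≫ Z.map (cd m i)) →
    (∀ i < m + 1, z i ≫ q.app ⦋m⦌ = y ≫ Y.map (cd m i)) → x ≫ q.app ⦋m + 1⦌ = s ≫ y →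
    ∃ t, (∀ i < m + 1, t ≫ Z.map (cd m i) = z i) ∧ s ≫ t = x ∧ t ≫ q.app ⦋m + 1⦌ = y

/-- The lifting property in degree `m` depends on the source in degrees up to `m` only. -/
lemma IsTrivialFibrationAt.of_isIso {Z Z' Y : CosimplicialObject C} {q : Z ⟶ Y} {q' : Z' ⟶ Y}
    {m : ℕ} (h : IsTrivialFibrationAt q m) (j : Z ⟶ Z') (w : j ≫ q' = q)
    (hj : ∀ l ≤ m, IsIso (j.app ⦋l⦌)) : IsTrivialFibrationAt q' m := by
  subst w
  have hj₀ (l : ℕ) : (j ≫ q').app ⦋l⦌ = j.app ⦋l⦌ ≫ q'.app ⦋l⦌ := rfl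
  cases m with
  | zero =>
    have := hj 0 le_rfl
    intro S T s _ x y hxy
    obtain ⟨t, ht, ht'⟩ := h s (x ≫ inv (j.app ⦋0⦌)) y (by simpa [hj₀] using hxy)
    refine ⟨t ≫ j.app ⦋0⦌, by rw [reassoc_of% ht, IsIso.inv_hom_id, Category.comp_id], ?_⟩
    rw [Category.assoc, ← hj₀, ht']
  | succ m =>
    have := hj m (by lia)
    have := hj (m + 1) le_rfl
    intro S T s _ z x y hz hsx hzy hxy
    obtain ⟨t, ht, ht', ht''⟩ := h s (fun i => z i ≫ inv (j.app ⦋m⦌)) (x ≫ inv (j.app ⦋m + 1⦌)) y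
      (by
        cases m with
        | zero => trivial
        | succ m =>
          have := hj m (by lia)
          intro i i' hij hi'
          have := hz i i' hij hi'
          simp only [degeneracyAct, Category.assoc] at this ⊢
          rw [← cancel_mono (j.app ⦋m⦌)]
          simpa only [Category.assoc, ← app_naturality, IsIso.inv_hom_id_assoc] using this)
      (fun i hi => by
        rw [← cancel_mono (j.app ⦋m⦌)]
        simp only [Category.assoc, ← app_naturality, IsIso.inv_hom_id_assoc, IsIso.inv_hom_id,
          Category.comp_id]
        exact hsx i hi)
      (fun i hi => by rw [hj₀, Category.assoc, IsIso.inv_hom_id_assoc, hzy i hi])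
      (by rw [hj₀, Category.assoc, IsIso.inv_hom_id_assoc, hxy])
    refine ⟨t ≫ j.app ⦋m + 1⦌, fun i hi => ?_, ?_, ?_⟩
    · rw [Category.assoc, app_naturality, reassoc_of% (ht i hi), IsIso.inv_hom_id, Category.comp_id]
    · rw [reassoc_of% ht', IsIso.inv_hom_id, Category.comp_id]
    · rw [Category.assoc, ← hj₀, ht'']

lemma trivialFibration_of_lift {E F : C} (p : E ⟶ F)
    (h : ∀ {S T : C} (s : S ⟶ T) [Cofibration s] (a : S ⟶ E) (b : T ⟶ F),
      a ≫ p = s ≫ b → ∃ y : T ⟶ E, s ≫ y = a ∧ y ≫ p = b) : Fibration p ∧ WeakEquivalence p := by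
  rw [← mem_trivialFibrations_iff, ← cofibrations_rlp]
  intro S T s hs
  have : Cofibration s := (cofibration_iff s).2 hs
  constructor
  intro a b sq
  obtain ⟨y, hy, hy'⟩ := h s a b sq.w
  exact ⟨⟨⟨y, hy, hy'⟩⟩⟩

/-- Trivial Reedy fibrations are trivial fibrations in each degree: the missing codegeneracies of a
lift are constructed one after another. -/
lemma weakEquivalence_of_isTrivialFibrationAt {Z Y : CosimplicialObject C} {q : Z ⟶ Y}
    (h : ∀ m, IsTrivialFibrationAt q m) (m : ℕ) : WeakEquivalence (q.app ⦋m⦌) := by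
  refine (trivialFibration_of_lift _ (fun {S T} s _ => ?_)).2
  induction m with
  | zero => exact h 0 s
  | succ m ih =>
    intro a b w
    obtain ⟨t₀, -⟩ := ih (a ≫ Z.map (cd m 0)) (b ≫ Y.map (cd m 0)) (by
      rw [Category.assoc, ← app_naturality, reassoc_of% w])
    let L (n : ℕ) := {l : (S ⟶ Z.obj ⦋n⦌) × (T ⟶ Y.obj ⦋n⦌) // l.1 ≫ q.app ⦋n⦌ = s ≫ l.2}
    let d' (n i : ℕ) (l : L (n + 1)) : L n :=
      ⟨⟨degeneracyAct Z S n i l.1.1, degeneracyAct Y T n i l.1.2⟩, by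
        simp only [degeneracyAct, Category.assoc]
        rw [← app_naturality, reassoc_of% l.2]⟩
    let g (n : ℕ) (y : T ⟶ Z.obj ⦋n⦌) : L n := ⟨⟨s ≫ y, y ≫ q.app _⟩, by simp⟩
    have hL {n : ℕ} {l l' : L n} (h1 : l.1.1 = l'.1.1) (h2 : l.1.2 = l'.1.2) : l = l' :=
      Subtype.ext (Prod.ext h1 h2)
    obtain ⟨y, -, hy⟩ := exists_partial_filler
      (S := fun n => T ⟶ Z.obj ⦋n⦌) (L := L) 1 (degeneracyAct Z T) d' g
      (fun n i j x hij hj => degeneracyAct_degeneracyAct hij (by lia) x)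
      (fun n i j x hij hj => hL (degeneracyAct_degeneracyAct hij (by lia) _)
        (degeneracyAct_degeneracyAct hij (by lia) _))
      (fun n i x => hL (by simp [g, d', degeneracyAct])
        (by simp [g, d', degeneracyAct, app_naturality]))
      (fun l => by
        obtain ⟨y, hy, hy'⟩ := h 0 s l.1.1 l.1.2 l.2
        exact ⟨y, hL hy hy'⟩) m
      (fun n hn z l hz hl => by
        obtain ⟨y, hy, hy', hy''⟩ := h (n + 1) s z l.1.1 l.1.2 hz
          (fun i hi => congrArg (fun l : L _ => l.1.1) (hl i hi))
          (fun i hi => congrArg (fun l : L _ => l.1.2) (hl i hi)) l.2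
        exact ⟨y, hy, hL hy' hy''⟩)
      0 (by lia) (fun _ => t₀) ⟨⟨a, b⟩, w⟩ (by
        cases m with
        | zero => trivial
        | succ m => exact fun i j _ hj => absurd hj (Nat.not_lt_zero j))
      (fun i hi => absurd hi (Nat.not_lt_zero i))
    exact ⟨y, congrArg (fun l : L _ => l.1.1) hy, congrArg (fun l : L _ => l.1.2) hy⟩

end TrivialFibration

/-! ### The inductive step of the Reedy factorization -/

section Step

variable {C : Type u} [Category.{v} C] [ModelCategory C] {X Z Z' Y : CosimplicialObject C}

/-- The maps `f : X ⟶ Z` and `q : Z ⟶ Y` factor `f ≫ q` as a Reedy cofibration followed by a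
trivial Reedy fibration in degrees less than `k`, and nothing has been added to `X` in the other
degrees except what is generated by the lower degrees of `Z`. -/
structure IsPartialFactorization (f : X ⟶ Z) (q : Z ⟶ Y) (k : ℕ) : Prop where
  cofibration : ∀ l < k, IsReedyCofibrationAt f l
  hasUniqueFillers : ∀ l, k ≤ l → HasUniqueFillers f l
  trivialFibration : ∀ l < k, IsTrivialFibrationAt q l

/-- With nothing attached yet, all of `X` is generated by `X` itself. -/
lemma isPartialFactorization_zero (q : X ⟶ Y) : IsPartialFactorization (𝟙 X) q 0 where
  cofibration l hl := absurd hl (Nat.not_lt_zero l)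
  trivialFibration l hl := absurd hl (Nat.not_lt_zero l)
  hasUniqueFillers l _ := by
    have h (l : ℕ) {E : C} (y : X.obj ⦋l⦌ ⟶ E) : (𝟙 X : X ⟶ X).app ⦋l⦌ ≫ y = y :=
      Category.id_comp y
    cases l with
    | zero => exact fun E x => ⟨x, h 0 x, fun y hy => by rw [← hy]; exact (h 0 y).symm⟩
    | succ l =>
      intro E z x hz hx
      refine ⟨x, ⟨fun i hi => ?_, h _ x⟩, fun y hy => ?_⟩
      · rw [← hx i hi]
        exact h _ _
      · rw [← hy.2]
        exact (h _ y).symm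

namespace IsCellAttachment

variable {k : ℕ} {B : C} {D : CellData Z k B} {f : X ⟶ Z} {j : Z ⟶ Z'} {b : B ⟶ Z'.obj ⦋k⦌}
  (H : IsCellAttachment D j b)
include H

/-- If the cell is attached along a cofibration, the attachment is a Reedy cofibration in the
degree of the cell. -/
lemma isReedyCofibrationAt [Cofibration D.i] (h : HasUniqueFillers f k) :
    IsReedyCofibrationAt (f ≫ j) k := by
  have hfj (l : ℕ) : (f ≫ j).app ⦋l⦌ = f.app ⦋l⦌ ≫ j.app ⦋l⦌ := rfl
  have := H.isIso_cell
  cases k with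
  | zero =>
    refine cofibration_of_lift _ (fun {E F} p _ _ x y w => ?_)
    obtain ⟨g, hg, -⟩ := h x
    rw [hfj, Category.assoc] at w
    obtain ⟨t, ht, ht'⟩ := exists_lift_of_comm D.i p (a := g) (b := b ≫ y) (by
      rw [reassoc_of% H.i_b]
      exact (h (x ≫ p)).unique (by rw [reassoc_of% hg]) w.symm)
    refine ⟨inv b ≫ t, ?_, by rw [Category.assoc, ht', IsIso.inv_hom_id_assoc]⟩
    rw [hfj, ← H.i_b, Category.assoc, Category.assoc, IsIso.hom_inv_id_assoc, ht, hg]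
  | succ m =>
    have := H.isIso_app (Nat.lt_succ_self m)
    intro E F p _ _ z x y hz hx hy hxy
    obtain ⟨g, ⟨hg, hg'⟩, -⟩ := h _ x (hz.precomp j)
      (fun i hi => by rw [← hx i hi, hfj, Category.assoc])
    obtain ⟨t, ht, ht'⟩ := exists_lift_of_comm D.i p (a := g) (b := b ≫ y) (by
      rw [reassoc_of% H.i_b]
      refine (h _ (x ≫ p) ((hz.precomp j).comp p) (fun i hi => ?_)).unique
        ⟨fun i hi => ?_, ?_⟩ ⟨fun i hi => ?_, ?_⟩
      · rw [← reassoc_of% (hx i hi), hfj, Category.assoc, Category.assoc]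
      · rw [reassoc_of% (hg i hi), Category.assoc]
      · rw [reassoc_of% hg']
      · rw [Category.assoc, hy i hi, reassoc_of% app_naturality]
      · rw [hxy, hfj, Category.assoc])
    have hjt : j.app ⦋m + 1⦌ ≫ inv b ≫ t = g := by
      rw [← H.i_b, Category.assoc, IsIso.hom_inv_id_assoc, ht]
    refine ⟨inv b ≫ t, fun i hi => ?_, ?_, ?_⟩
    · rw [← cancel_epi (j.app ⦋m⦌), reassoc_of% app_naturality, hjt, hg i hi]
    · rw [hfj, Category.assoc, hjt, hg']
    · rw [Category.assoc, ht', IsIso.inv_hom_id_assoc]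

end IsCellAttachment

lemma exists_cofibration_trivialFibration {A E : C} (f : A ⟶ E) :
    ∃ (B : C) (i : A ⟶ B) (r : B ⟶ E), Cofibration i ∧ Fibration r ∧ WeakEquivalence r ∧
      i ≫ r = f := by
  let h := MorphismProperty.factorizationData (cofibrations C) (trivialFibrations C) f
  have := (mem_trivialFibrations_iff _).1 h.hp
  exact ⟨h.Z, h.i, h.p, (cofibration_iff _).2 h.hi, this.1, this.2, h.fac⟩

/-- The object in degree zero can be enlarged to make `q` a trivial fibration. -/
lemma exists_cellData_zero (q : Z ⟶ Y) :
    ∃ (B : C) (D : CellData Z 0 B) (r : B ⟶ Y.obj ⦋0⦌), Cofibration D.i ∧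
      D.i ≫ r = q.app ⦋0⦌ ∧
      (∀ {m : SimplexCategory} (θ : ⦋0⦌ ⟶ m) h, D.β θ h ≫ q.app m = r ≫ Y.map θ) ∧
      ∀ {Z' : CosimplicialObject C} {j : Z ⟶ Z'} {b : B ⟶ Z'.obj ⦋0⦌} {q' : Z' ⟶ Y},
        IsCellAttachment D j b → j ≫ q' = q → b ≫ q'.app ⦋0⦌ = r → IsTrivialFibrationAt q' 0 := by
  obtain ⟨B, i, r, hi, hr, hr', fac⟩ := exists_cofibration_trivialFibration (q.app ⦋0⦌)
  have hθ {m : SimplexCategory} (θ : ⦋0⦌ ⟶ m) : Mono θ := by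
    rw [SimplexCategory.mono_iff_injective]
    exact fun x y _ => Subsingleton.elim (α := Fin 1) x y
  refine ⟨B, ⟨i, fun θ h => (h (hθ θ)).elim, fun θ h => (h (hθ θ)).elim,
    fun θ h => (h (hθ θ)).elim⟩, r, hi, fac, fun θ h => (h (hθ θ)).elim, ?_⟩
  intro Z' j b q' H _ hb S T s _ x y hxy
  have := H.isIso_cell
  obtain ⟨t, ht, ht'⟩ := exists_lift_of_comm s r (a := x ≫ inv b) (b := y) (by
    rw [Category.assoc, ← hb, IsIso.inv_hom_id_assoc, hxy])
  exact ⟨t ≫ b, by rw [reassoc_of% ht, IsIso.inv_hom_id, Category.comp_id],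
    by rw [Category.assoc, hb, ht']⟩

/-- The object in degree `m + 1` can be enlarged to make the map to the relative matching object
a trivial fibration. -/
lemma exists_cellData_succ (q : Z ⟶ Y) (m : ℕ) :
    ∃ (B : C) (D : CellData Z (m + 1) B) (r : B ⟶ Y.obj ⦋m + 1⦌), Cofibration D.i ∧
      D.i ≫ r = q.app ⦋m + 1⦌ ∧
      (∀ {l : SimplexCategory} (θ : ⦋m + 1⦌ ⟶ l) h, D.β θ h ≫ q.app l = r ≫ Y.map θ) ∧
      ∀ {Z' : CosimplicialObject C} {j : Z ⟶ Z'} {b : B ⟶ Z'.obj ⦋m + 1⦌} {q' : Z' ⟶ Y},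
        IsCellAttachment D j b → j ≫ q' = q → b ≫ q'.app ⦋m + 1⦌ = r →
          IsTrivialFibrationAt q' (m + 1) := by
  obtain ⟨P, p, pY, hp, hpY, hP, hP'⟩ := exists_matching q m
  obtain ⟨c, hc, hcY⟩ := hP (fun i => Z.map (cd m i)) (q.app ⦋m + 1⦌)
    (by
      cases m with
      | zero => trivial
      | succ m =>
        intro i j hij hj
        simp only [degeneracyAct, ← Z.map_comp, cd_comp_cd hij hj])
    (fun i hi => (app_naturality q _).symm)
  obtain ⟨B, i, r, hi, hr, hr', fac⟩ := exists_cofibration_trivialFibration c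
  choose n hn θ' hθ' using fun (l : SimplexCategory) (θ : ⦋m + 1⦌ ⟶ l) (h : ¬ Mono θ) =>
    exists_cd_comp_eq θ h
  -- a non-injective map `cd i ≫ θ'` acts on `B` through the `i`-th component of the matching object
  let D : CellData Z (m + 1) B :=
    { i := i
      β θ h := r ≫ p (n _ θ h) ≫ Z.map (θ' _ θ h)
      i_β θ h := by
        rw [reassoc_of% fac, reassoc_of% (hc _ (hn _ θ h)), ← Z.map_comp, ← hθ']
      β_map θ h α h' := by
        rw [Category.assoc, Category.assoc, ← Z.map_comp]
        refine congrArg (r ≫ ·) (hp.comp_map_eq (hn _ _ _) (hn _ _ _) ?_)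
        rw [← hθ', ← Category.assoc, ← hθ'] }
  have hcd (l : ℕ) (hl : l < m + 1) : ¬ Mono (cd m l) := fun _ => by
    have := SimplexCategory.len_le_of_mono (cd m l)
    simp at this
  have hD (l : ℕ) (hl : l < m + 1) : D.β (cd m l) (hcd l hl) = r ≫ p l := by
    refine congrArg (r ≫ ·) ((hp.comp_map_eq (hn _ _ _) hl (ψ := 𝟙 _) ?_).trans ?_)
    · rw [← hθ', Category.comp_id]
    · rw [Z.map_id, Category.comp_id]
  refine ⟨B, D, r ≫ pY, hi, by rw [← hcY, ← fac, Category.assoc], fun θ h => ?_, ?_⟩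
  · change (r ≫ p _ ≫ Z.map _) ≫ _ = _
    rw [Category.assoc, Category.assoc, Category.assoc, ← app_naturality,
      reassoc_of% (hpY _ (hn _ θ h)), ← Y.map_comp, ← hθ']
  intro Z' j b q' H hj hb S T s _ z x y hz hsx hzy hxy
  have := H.isIso_cell
  have hm := H.isIso_app (Nat.lt_succ_self m)
  have hbcd (l : ℕ) (hl : l < m + 1) : b ≫ Z'.map (cd m l) = r ≫ p l ≫ j.app ⦋m⦌ := by
    rw [← H.β_app _ (hcd l hl), hD l hl, Category.assoc]
  have hj' (l : ℕ) : j.app ⦋l⦌ ≫ q'.app ⦋l⦌ = q.app ⦋l⦌ := by rw [← hj]; rfl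
  obtain ⟨τ, hτ, hτY⟩ := hP (fun i => z i ≫ inv (j.app ⦋m⦌)) y
    (by
      cases m with
      | zero => trivial
      | succ m =>
        have := H.isIso_app (show m < m + 2 by lia)
        intro i i' hij hi'
        have := hz i i' hij hi'
        simp only [degeneracyAct, Category.assoc] at this ⊢
        rw [← cancel_mono (j.app ⦋m⦌)]
        simpa only [Category.assoc, ← app_naturality, IsIso.inv_hom_id_assoc] using this)
    (fun i hi => by rw [Category.assoc, ← hj', IsIso.inv_hom_id_assoc, hzy i hi])
  obtain ⟨t, ht, ht'⟩ := exists_lift_of_comm s r (a := x ≫ inv b) (b := τ) (by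
    refine hP' (fun l hl => ?_) ?_
    · rw [← cancel_mono (j.app ⦋m⦌)]
      simp only [Category.assoc]
      rw [← hbcd l hl, IsIso.inv_hom_id_assoc, reassoc_of% (hτ l hl), IsIso.inv_hom_id,
        Category.comp_id, hsx l hl]
    · rw [Category.assoc, Category.assoc, ← hb, IsIso.inv_hom_id_assoc, Category.assoc, hτY, hxy])
  refine ⟨t ≫ b, fun l hl => ?_, ?_, ?_⟩
  · rw [Category.assoc, hbcd l hl, reassoc_of% ht', reassoc_of% (hτ l hl), IsIso.inv_hom_id,
      Category.comp_id]
  · rw [reassoc_of% ht, IsIso.inv_hom_id, Category.comp_id]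
  · rw [Category.assoc, hb, reassoc_of% ht', hτY]

/-- Attaching a cell in degree `k`, chosen to make the relative matching map in this degree
a trivial fibration, does not disturb what has been achieved in lower degrees. -/
lemma IsPartialFactorization.exists_succ {f : X ⟶ Z} {q : Z ⟶ Y} {k : ℕ}
    (h : IsPartialFactorization f q k) :
    ∃ (Z' : CosimplicialObject C) (j : Z ⟶ Z') (q' : Z' ⟶ Y), j ≫ q' = q ∧
      (∀ l < k, IsIso (j.app ⦋l⦌)) ∧ IsPartialFactorization (f ≫ j) q' (k + 1) := by
  obtain ⟨B, D, r, hi, hir, hβ, hfib⟩ : ∃ (B : C) (D : CellData Z k B) (r : B ⟶ Y.obj ⦋k⦌),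
      Cofibration D.i ∧ D.i ≫ r = q.app ⦋k⦌ ∧
      (∀ {m : SimplexCategory} (θ : ⦋k⦌ ⟶ m) h, D.β θ h ≫ q.app m = r ≫ Y.map θ) ∧
      ∀ {Z' : CosimplicialObject C} {j : Z ⟶ Z'} {b : B ⟶ Z'.obj ⦋k⦌} {q' : Z' ⟶ Y},
        IsCellAttachment D j b → j ≫ q' = q → b ≫ q'.app ⦋k⦌ = r →
          IsTrivialFibrationAt q' k := by
    cases k with
    | zero => exact exists_cellData_zero q
    | succ m => exact exists_cellData_succ q m
  obtain ⟨Z', j, b, H⟩ := D.exists_isCellAttachment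
  obtain ⟨q', hq', hb⟩ := H.exists_hom q r hir hβ
  refine ⟨Z', j, q', hq', fun l hl => H.isIso_app hl, fun l hl => ?_, fun l hl => ?_,
    fun l hl => ?_⟩
  · rcases Nat.lt_succ_iff_lt_or_eq.1 hl with hl | rfl
    · exact (IsReedyCofibrationAt.comp_iff f j rfl (fun l' hl' => H.isIso_app (by lia))).2
        (h.cofibration l hl)
    · exact H.isReedyCofibrationAt (h.hasUniqueFillers l le_rfl)
  · obtain ⟨l, rfl⟩ := Nat.exists_eq_succ_of_ne_zero (show l ≠ 0 by lia)
    exact H.hasUniqueFillers (by lia) (h.hasUniqueFillers _ (by lia))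
  · rcases Nat.lt_succ_iff_lt_or_eq.1 hl with hl | rfl
    · exact (h.trivialFibration l hl).of_isIso j hq' (fun l' hl' => H.isIso_app (by lia))
    · exact hfib H hq' hb

end Step

/-! ### Reedy factorizations -/

section Sequential

variable {A : Type*} {C : Type*} [Category* A] [Category* C]

/-- The colimit of a sequence of functors exists if at each object, almost all transition maps are
isomorphisms. -/
lemma exists_sequential_colimit (Z : ℕ → A ⥤ C) (j : ∀ k, Z k ⟶ Z (k + 1)) (d : A → ℕ)
    (hj : ∀ k a, d a < k → IsIso ((j k).app a)) :
    ∃ (W : A ⥤ C) (ι : ∀ k, Z k ⟶ W), (∀ k, j k ≫ ι (k + 1) = ι k) ∧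
      (∀ k a, d a < k → IsIso ((ι k).app a)) ∧
      ∀ {Y : A ⥤ C} (q : ∀ k, Z k ⟶ Y), (∀ k, j k ≫ q (k + 1) = q k) →
        ∃ t : W ⟶ Y, ∀ k, ι k ≫ t = q k := by
  let F := Functor.ofSequence j
  have hF (k : ℕ) : F.map (homOfLE (Nat.le_add_right k 1)) = j k :=
    Functor.ofSequence_map_homOfLE_succ j k
  have hconst (a : A) : (F.flip.obj a).IsEventuallyConstantFrom (d a + 1) := by
    intro l φ
    obtain ⟨n, rfl⟩ := Nat.exists_eq_add_of_le (leOfHom φ)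
    change IsIso ((F.map φ).app a)
    induction n with
    | zero =>
      obtain rfl : φ = 𝟙 _ := Subsingleton.elim _ _
      rw [F.map_id]
      infer_instance
    | succ n ih =>
      obtain rfl : φ = homOfLE (Nat.le_add_right (d a + 1) n) ≫
        homOfLE (Nat.le_add_right (d a + 1 + n) 1) := Subsingleton.elim _ _
      rw [F.map_comp, hF]
      exact IsIso.comp_isIso' (ih _) (hj (d a + 1 + n) a (by lia))
  have (a : A) : HasColimit (F.flip.obj a) := (hconst a).hasColimit
  refine ⟨colimit F, fun k => colimit.ι F k, fun k => ?_, fun k a hk => ?_, fun {Y} q hq => ?_⟩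
  · rw [← hF]
    exact colimit.w F _
  · exact (hconst a).isIso_ι_of_isColimit'
      (isColimitOfPreserves ((evaluation A C).obj a) (colimit.isColimit F)) k (homOfLE hk)
  · let c : Cocone F :=
      { pt := Y
        ι := NatTrans.ofSequence (F := F) (G := (Functor.const ℕ).obj Y) q (fun k => by
          rw [hF]
          exact (hq k).trans (Category.comp_id _).symm) }
    exact ⟨colimit.desc F c, fun k => colimit.ι_desc c k⟩

end Sequential

section Factorization

variable {C : Type u} [Category.{v} C] [ModelCategory C] {X Y : CosimplicialObject C}

/-- The stages of the Reedy factorization of `g`. -/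
structure FactorizationStage (g : X ⟶ Y) (k : ℕ) where
  /-- the intermediate object -/
  Z : CosimplicialObject C
  /-- the first factor -/
  f : X ⟶ Z
  /-- the second factor -/
  q : Z ⟶ Y
  fac : f ≫ q = g
  isPartialFactorization : IsPartialFactorization f q k

/-- Every map is a Reedy cofibration followed by a Reedy equivalence. -/
theorem exists_reedy_factorization (g : X ⟶ Y) :
    ∃ (Z : CosimplicialObject C) (f : X ⟶ Z) (q : Z ⟶ Y), f ≫ q = g ∧ IsReedyCofibration f ∧
      IsReedyEquivalence q := by
  have step (k : ℕ) (S : FactorizationStage g k) : ∃ (S' : FactorizationStage g (k + 1))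
      (j : S.Z ⟶ S'.Z), S.f ≫ j = S'.f ∧ j ≫ S'.q = S.q ∧ ∀ l < k, IsIso (j.app ⦋l⦌) := by
    obtain ⟨Z', j, q', hq, hj, h⟩ := S.isPartialFactorization.exists_succ
    exact ⟨⟨Z', S.f ≫ j, q', by rw [Category.assoc, hq, S.fac], h⟩, j, rfl, hq, hj⟩
  choose next j hf hq hj using step
  let S (k : ℕ) : FactorizationStage g k :=
    Nat.rec ⟨X, 𝟙 X, g, Category.id_comp g, isPartialFactorization_zero g⟩ (fun k S => next k S) k
  obtain ⟨W, ι, hι, hι', hd⟩ : ∃ (W : CosimplicialObject C) (ι : ∀ k, (S k).Z ⟶ W),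
      (∀ k, j k (S k) ≫ ι (k + 1) = ι k) ∧
      (∀ k (a : SimplexCategory), a.len < k → IsIso ((ι k).app a)) ∧
      ∀ {Y : CosimplicialObject C} (q : ∀ k, (S k).Z ⟶ Y), (∀ k, j k (S k) ≫ q (k + 1) = q k) →
        ∃ t : W ⟶ Y, ∀ k, ι k ≫ t = q k :=
    exists_sequential_colimit (fun k => (S k).Z)
    (fun k => j k (S k)) SimplexCategory.len (fun k a ha => hj k (S k) a.len ha)
  obtain ⟨t, ht⟩ := hd (fun k => (S k).q) (fun k => hq k (S k))
  have hfι (k : ℕ) : (S k).f ≫ ι k = (S 0).f ≫ ι 0 := by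
    induction k with
    | zero => rfl
    | succ k ih =>
      rw [← ih, ← hι k]
      change (next k (S k)).f ≫ _ = _
      rw [← hf, Category.assoc]
  refine ⟨W, (S 0).f ≫ ι 0, t, ?_, (isReedyCofibration_iff_forall _).2 (fun m => ?_), ?_⟩
  · rw [Category.assoc, ht, (S 0).fac]
  · exact (IsReedyCofibrationAt.comp_iff (S (m + 1)).f (ι (m + 1)) (hfι _)
      (fun l hl => hι' _ _ (Nat.lt_succ_of_le hl))).2
      ((S (m + 1)).isPartialFactorization.cofibration m (Nat.lt_succ_self m))
  · refine weakEquivalence_of_isTrivialFibrationAt (fun m => ?_)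
    exact ((S (m + 1)).isPartialFactorization.trivialFibration m (Nat.lt_succ_self m)).of_isIso
      (ι (m + 1)) (ht _) (fun l hl => hι' _ _ (Nat.lt_succ_of_le hl))

end Factorization

/-! ### Comparison of Reedy cofibrant approximations -/

section Stability

variable {M : Type u} [Category.{v} M] [ModelCategory M] {X X' Z Z' W Y : CosimplicialObject M}

lemma IsReedyCofibration.comp {f : X ⟶ Z} {g : Z ⟶ W} (hf : IsReedyCofibration f)
    (hg : IsReedyCofibration g) : IsReedyCofibration (f ≫ g) := by
  have hfg (l : ℕ) : (f ≫ g).app ⦋l⦌ = f.app ⦋l⦌ ≫ g.app ⦋l⦌ := rfl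
  refine ⟨?_, fun m E B p _ _ z x b hz hx hb hxb => ?_⟩
  · have := hf.zero
    have := hg.zero
    rw [hfg]
    infer_instance
  · obtain ⟨y, hy, hy', hy''⟩ := hf.exists_filler m p (fun i => g.app ⦋m⦌ ≫ z i) x
      (g.app ⦋m + 1⦌ ≫ b) (hz.precomp g)
      (fun i hi => by rw [← hx i hi, hfg, Category.assoc])
      (fun i hi => by rw [Category.assoc, hb i hi, reassoc_of% app_naturality])
      (by rw [hxb, hfg, Category.assoc])
    obtain ⟨t, ht, ht', ht''⟩ := hg.exists_filler m p z y b hz (fun i hi => (hy i hi).symm) hb hy''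
    exact ⟨t, ht, by rw [hfg, Category.assoc, ht', hy'], ht''⟩

lemma IsReedyCofibration.of_isPushout {f : X ⟶ Z} {g : X ⟶ X'} {g' : Z ⟶ Z'} {f' : X' ⟶ Z'}
    (hf : IsReedyCofibration f) (sq : ∀ a, IsPushout (f.app a) (g.app a) (g'.app a) (f'.app a)) :
    IsReedyCofibration f' := by
  refine ⟨?_, fun m E B p _ _ z x b hz hx hb hxb => ?_⟩
  · have := hf.zero
    exact cofibration_of_lift _ (fun {E F} p _ _ a b w => by
      obtain ⟨y, hy, hy'⟩ := exists_lift_of_comm (f.app ⦋0⦌) p (a := g.app _ ≫ a)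
        (b := g'.app _ ≫ b) (by rw [Category.assoc, w, reassoc_of% (sq _).w])
      obtain ⟨t, ht, ht'⟩ := (sq ⦋0⦌).exists_desc y a hy
      exact ⟨t, ht', (sq ⦋0⦌).hom_ext (by rw [reassoc_of% ht, hy']) (by rw [reassoc_of% ht', w])⟩)
  · obtain ⟨y, hy, hy', hy''⟩ := hf.exists_filler m p (fun i => g'.app ⦋m⦌ ≫ z i)
      (g.app ⦋m + 1⦌ ≫ x) (g'.app ⦋m + 1⦌ ≫ b) (hz.precomp g')
      (fun i hi => by
        rw [reassoc_of% (sq _).w, hx i hi, reassoc_of% app_naturality])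
      (fun i hi => by rw [Category.assoc, hb i hi, reassoc_of% app_naturality])
      (by rw [Category.assoc, hxb, reassoc_of% (sq _).w])
    obtain ⟨t, ht, ht'⟩ := (sq ⦋m + 1⦌).exists_desc y x hy'
    refine ⟨t, fun i hi => (sq ⦋m⦌).hom_ext ?_ ?_, ht',
      (sq ⦋m + 1⦌).hom_ext (by rw [reassoc_of% ht, hy'']) (by rw [reassoc_of% ht', hxb])⟩
    · rw [reassoc_of% app_naturality, ht, hy i hi]
    · rw [reassoc_of% app_naturality, ht', hx i hi]

lemma exists_pushout (f : X ⟶ Z) (g : X ⟶ X') :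
    ∃ (Z' : CosimplicialObject M) (g' : Z ⟶ Z') (f' : X' ⟶ Z'), IsPushout f g g' f' ∧
      ∀ a, IsPushout (f.app a) (g.app a) (g'.app a) (f'.app a) := by
  obtain ⟨Z', g', f', sq⟩ : ∃ (Z' : SimplexCategory ⥤ M) (g' : (Z : SimplexCategory ⥤ M) ⟶ Z')
    (f' : (X' : SimplexCategory ⥤ M) ⟶ Z'),
    IsPushout (C := SimplexCategory ⥤ M) f g g' f' := ⟨_, _, _, IsPushout.of_hasPushout _ _⟩
  exact ⟨Z', g', f', sq, fun a => sq.map ((evaluation SimplexCategory M).obj a)⟩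

lemma isReedyEquivalence_of_comp {f : X ⟶ Z} {g : Z ⟶ Y} (hg : IsReedyEquivalence g)
    (hfg : IsReedyEquivalence (f ≫ g)) : IsReedyEquivalence f := fun s =>
  have := hg s
  have : WeakEquivalence (f.app ⦋s⦌ ≫ g.app ⦋s⦌) := hfg s
  weakEquivalence_of_postcomp _ (g.app ⦋s⦌)

variable [HasZeroObject M] [HasZeroMorphisms M]

lemma IsReedyCofibration.fromZero_target {f : X ⟶ Z} (hf : IsReedyCofibration f)
    (hX : IsReedyCofibration (fromZero X)) : IsReedyCofibration (fromZero Z) := by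
  have h : fromZero X ≫ f = fromZero Z := fromZero_hom_ext _ _
  exact h ▸ hX.comp hf

lemma nonempty_reedyCofibrantApproximation (f : X ⟶ Y) :
    Nonempty (ReedyCofibrantApproximation f) := by
  obtain ⟨X', i, p, hp, hi, hp'⟩ := exists_reedy_factorization (fromZero X)
  obtain ⟨Y', j, q, hq, hj, hq'⟩ := exists_reedy_factorization (p ≫ f)
  obtain rfl : i = fromZero X' := fromZero_hom_ext _ _
  exact ⟨⟨X', Y', j, p, q, hq, (isReedyCofibrant_iff _).2 hi,
    (isReedyCofibrant_iff _).2 (hj.fromZero_target hi), hp', hq'⟩⟩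

/-- Any two Reedy cofibrant approximations map to a third one: the map from the coproduct of the
two sources to `X` is factored, and so is the map to `Y` from the coproduct of the two targets,
enlarged by the cells attached to the sources. -/
lemma exists_common_approximation {f : X ⟶ Y} (A B : ReedyCofibrantApproximation f) :
    ∃ (D : ReedyCofibrantApproximation f) (a : A.source ⟶ D.source) (a' : A.target ⟶ D.target)
      (b : B.source ⟶ D.source) (b' : B.target ⟶ D.target),
      A.map ≫ a' = a ≫ D.map ∧ B.map ≫ b' = b ≫ D.map ∧ IsReedyEquivalence a ∧
        IsReedyEquivalence a' ∧ IsReedyEquivalence b ∧ IsReedyEquivalence b' := by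
  -- the coproducts of the sources and of the targets
  obtain ⟨P, iA, iB, sqP, sqP'⟩ := exists_pushout (fromZero A.source) (fromZero B.source)
  obtain ⟨Q, kA, kB, sqQ, sqQ'⟩ := exists_pushout (fromZero A.target) (fromZero B.target)
  have hB := (isReedyCofibrant_iff _).1 B.source_cofibrant
  have hB' := (isReedyCofibrant_iff _).1 B.target_cofibrant
  have hP : IsReedyCofibration (fromZero P) :=
    (((isReedyCofibrant_iff _).1 A.source_cofibrant).of_isPushout sqP').fromZero_target hB
  have hQ : IsReedyCofibration (fromZero Q) :=
    (((isReedyCofibrant_iff _).1 A.target_cofibrant).of_isPushout sqQ').fromZero_target hB'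
  obtain ⟨p, hpA, hpB⟩ := sqP.exists_desc A.toSource B.toSource (fromZero_hom_ext _ _)
  obtain ⟨q, hqA, hqB⟩ := sqQ.exists_desc A.toTarget B.toTarget (fromZero_hom_ext _ _)
  obtain ⟨φ, hφA, hφB⟩ := sqP.exists_desc (A.map ≫ kA) (B.map ≫ kB) (fromZero_hom_ext _ _)
  have hφ : φ ≫ q = p ≫ f := sqP.hom_ext
    (by rw [reassoc_of% hφA, reassoc_of% hpA, hqA, A.comm])
    (by rw [reassoc_of% hφB, reassoc_of% hpB, hqB, B.comm])
  obtain ⟨Z, c, r, hcr, hc, hr⟩ := exists_reedy_factorization p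
  obtain ⟨V, e, d, sqV, sqV'⟩ := exists_pushout c φ
  obtain ⟨y, hy, hy'⟩ := sqV.exists_desc (r ≫ f) q (by rw [reassoc_of% hcr, hφ])
  obtain ⟨W, g, t, hgt, hg, ht⟩ := exists_reedy_factorization y
  have hd := hc.of_isPushout sqV'
  have ha : (iA ≫ c) ≫ r = A.toSource := by rw [Category.assoc, hcr, hpA]
  have hb : (iB ≫ c) ≫ r = B.toSource := by rw [Category.assoc, hcr, hpB]
  have ha' : (kA ≫ d ≫ g) ≫ t = A.toTarget := by
    rw [Category.assoc, Category.assoc, hgt, hy', hqA]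
  have hb' : (kB ≫ d ≫ g) ≫ t = B.toTarget := by
    rw [Category.assoc, Category.assoc, hgt, hy', hqB]
  have hA' : A.map ≫ kA ≫ d ≫ g = (iA ≫ c) ≫ e ≫ g := by
    rw [← reassoc_of% hφA, Category.assoc, ← reassoc_of% sqV.w]
  have hB' : B.map ≫ kB ≫ d ≫ g = (iB ≫ c) ≫ e ≫ g := by
    rw [← reassoc_of% hφB, Category.assoc, ← reassoc_of% sqV.w]
  refine ⟨⟨Z, W, e ≫ g, r, t, by rw [Category.assoc, hgt, hy],
    (isReedyCofibrant_iff _).2 (hc.fromZero_target hP),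
    (isReedyCofibrant_iff _).2 (hg.fromZero_target (hd.fromZero_target hQ)), hr, ht⟩,
    iA ≫ c, kA ≫ d ≫ g, iB ≫ c, kB ≫ d ≫ g, hA', hB', isReedyEquivalence_of_comp hr ?_,
    isReedyEquivalence_of_comp ht ?_, isReedyEquivalence_of_comp hr ?_,
    isReedyEquivalence_of_comp ht ?_⟩
  · rw [ha]; exact A.toSource_equivalence
  · rw [ha']; exact A.toTarget_equivalence
  · rw [hb]; exact B.toSource_equivalence
  · rw [hb']; exact B.toTarget_equivalence

end Stability

section Invariance

variable {M : Type u} [Category.{v} M] [ModelCategory M] [HasZeroObject M] [HasZeroMorphisms M]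

lemma homotopyGroupMap_bijective_of_isIso {K L : SSet.{w}} (φ : K ⟶ L) [IsIso φ] (s : ℕ)
    {x : K _⦋0⦌} {y : L _⦋0⦌} (h : φ.app _ x = y) :
    Function.Bijective (homotopyGroupMap s φ h) := by
  have h' : (inv φ).app _ y = x := by
    rw [← h]
    exact congrArg (fun ψ : K ⟶ K => ψ.app _ x) (IsIso.hom_inv_id φ)
  have comp {K L : SSet.{w}} (φ : K ⟶ L) (ψ : L ⟶ K) (w : φ ≫ ψ = 𝟙 K) {x : K _⦋0⦌} {y : L _⦋0⦌}
      (h : φ.app _ x = y) (h' : ψ.app _ y = x) (a : homotopyGroup s K x) :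
      homotopyGroupMap s ψ h' (homotopyGroupMap s φ h a) = a := by
    induction a using Quot.ind with
    | mk a =>
      refine congrArg (Quot.mk _) (simplexOf_injective ?_)
      rw [simplexOf_mapPtSimplex, simplexOf_mapPtSimplex]
      exact congrArg (fun ψ : K ⟶ K => ψ.app _ (simplexOf a)) w
  exact ⟨Function.LeftInverse.injective (comp φ (inv φ) (IsIso.hom_inv_id φ) h h'),
    Function.RightInverse.surjective (comp (inv φ) φ (IsIso.inv_hom_id φ) h' h)⟩

omit [HasZeroObject M] in
lemma IsReedyEquivalence.isGEquivalence {X Y : CosimplicialObject M} {f : X ⟶ Y}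
    (hf : IsReedyEquivalence f) (𝒢 : ObjectProperty M) : IsGEquivalence 𝒢 f := by
  intro G _ s
  have (n : ℕ) : IsIso ((toHo M).map (f.app ⦋n⦌)) :=
    have := hf n
    isIso_map_of_weakEquivalence (toHo M) _
  have : IsIso (homSSetMap (((CosimplicialObject.whiskering _ _).obj (toHo M)).map f)
      ((toHo M).obj G)) := by
    have (n : SimplexCategoryᵒᵖ) : IsIso ((homSSetMap
        (((CosimplicialObject.whiskering _ _).obj (toHo M)).map f) ((toHo M).obj G)).app n) := by
      rw [isIso_iff_bijective]
      obtain ⟨i, hi, -⟩ := (this n.unop.len).out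
      refine ⟨fun x y hxy => ?_, fun x => ⟨i ≫ x, ?_⟩⟩
      · exact (@cancel_epi _ _ _ _ _ _ (@IsIso.epi_of_iso _ _ _ _ _ (this n.unop.len)) _ _).1 hxy
      · exact (Category.assoc _ _ _).symm.trans ((congrArg (· ≫ x) hi).trans (Category.id_comp x))
    exact NatIso.isIso_of_isIso_app _
  exact homotopyGroupMap_bijective_of_isIso _ s _

/-- Natural homotopy groups of Reedy cofibrant objects are invariant under Reedy equivalences, as
the homotopy groups of `[-, G]` obviously are. -/
lemma naturalPiMap_bijective_of_square [IsLeftProper M] {𝒢 : ObjectProperty M}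
    (h𝒢 : IsClassOfInjectiveModels 𝒢) {X Y X' Y' : CosimplicialObject M}
    (hX : IsReedyCofibrant X) (hY : IsReedyCofibrant Y) (hX' : IsReedyCofibrant X')
    (hY' : IsReedyCofibrant Y') {f : X ⟶ Y} {f' : X' ⟶ Y'} {a : X ⟶ X'} {b : Y ⟶ Y'}
    (w : f ≫ b = a ≫ f') (ha : IsReedyEquivalence a) (hb : IsReedyEquivalence b) {G : M}
    (hG : 𝒢 G) (s : ℕ) : Function.Bijective (naturalPiMap s f G) ↔
      Function.Bijective (naturalPiMap s f' G) := by
  simp only [isReedyCofibrant_iff] at hX hY hX' hY'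
  have ha' := (isGEquivalence_iff_naturalPiMap_bijective h𝒢 hX hX' a).1 (ha.isGEquivalence 𝒢) G hG s
  have hb' := (isGEquivalence_iff_naturalPiMap_bijective h𝒢 hY hY' b).1 (hb.isGEquivalence 𝒢) G hG s
  rw [← hb'.of_comp_iff, ← naturalPiMap_comp, w, naturalPiMap_comp, ha'.of_comp_iff']

lemma ReedyCofibrantApproximation.naturalPiMap_bijective_iff [IsLeftProper M]
    {𝒢 : ObjectProperty M} (h𝒢 : IsClassOfInjectiveModels 𝒢) {X Y : CosimplicialObject M}
    {f : X ⟶ Y} (A B : ReedyCofibrantApproximation f) {G : M} (hG : 𝒢 G) (s : ℕ) :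
    Function.Bijective (naturalPiMap s A.map G) ↔ Function.Bijective (naturalPiMap s B.map G) := by
  obtain ⟨D, a, a', b, b', hA, hB, ha, ha', hb, hb'⟩ := exists_common_approximation A B
  exact (naturalPiMap_bijective_of_square h𝒢 A.source_cofibrant A.target_cofibrant
    D.source_cofibrant D.target_cofibrant hA ha ha' hG s).trans
    (naturalPiMap_bijective_of_square h𝒢 B.source_cofibrant B.target_cofibrant
    D.source_cofibrant D.target_cofibrant hB hb hb' hG s).symm

end Invariance

end

end TruncatedResolution

theorem mainTheorem4 {M : Type u} [Category.{v} M] [ModelCategory M]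
    [HasZeroObject M] [HasZeroMorphisms M] [TruncatedResolution.IsLeftProper M]
    (𝒢 : ObjectProperty M) (h𝒢 : TruncatedResolution.IsClassOfInjectiveModels 𝒢)
    (n : ℕ) {X Y : CosimplicialObject M} (f : X ⟶ Y) :
    List.TFAE
      [TruncatedResolution.IsNGEquivalence 𝒢 n f,
        ∀ A : TruncatedResolution.ReedyCofibrantApproximation f,
          TruncatedResolution.IsGEquivalence 𝒢 ((TruncatedResolution.sk M (n + 1)).map A.map),
        ∀ A : TruncatedResolution.ReedyCofibrantApproximation f, ∀ G : M, 𝒢 G →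
          ∀ s : ℕ, s ≤ n → Function.Bijective (TruncatedResolution.naturalPiMap s A.map G),
        ∃ A : TruncatedResolution.ReedyCofibrantApproximation f, ∀ G : M, 𝒢 G →
          ∀ s : ℕ, s ≤ n → Function.Bijective (TruncatedResolution.naturalPiMap s A.map G)] := by
  have h (A : TruncatedResolution.ReedyCofibrantApproximation f) :
      TruncatedResolution.IsGEquivalence 𝒢 ((TruncatedResolution.sk M (n + 1)).map A.map) ↔
        ∀ G : M, 𝒢 G → ∀ s : ℕ, s ≤ n →
          Function.Bijective (TruncatedResolution.naturalPiMap s A.map G) :=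
    TruncatedResolution.isGEquivalence_sk_iff h𝒢
      ((TruncatedResolution.isReedyCofibrant_iff _).1 A.source_cofibrant)
      ((TruncatedResolution.isReedyCofibrant_iff _).1 A.target_cofibrant) A.map n
  tfae_have 2 ↔ 3 := forall_congr' h
  tfae_have 1 ↔ 4 := exists_congr h
  tfae_have 3 → 4 := fun H =>
    have ⟨A⟩ := TruncatedResolution.nonempty_reedyCofibrantApproximation f
    ⟨A, H A⟩
  tfae_have 4 → 3 := fun ⟨A, H⟩ B G hG s hs =>
    (A.naturalPiMap_bijective_iff h𝒢 B hG s).1 (H G hG s hs)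
  tfae_finish
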